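/- **Setting.** A polygonal curve is a map $P:[0,1]\to\mathbb R^d$ with parameters $0=t_1<\dots<t_n=1$ such that $P$ is the linear interpolation of $P(t_i)$ and $P(t_{i+1})$ (an edge of $P$) on each $[t_i,t_{i+1}]$; its complexity is $|P|=n$, and $\mathbb X^d_\ell$ is the set of all polygonal curves of complexity at most $\ell$. $P[s,t]$ is the subcurve from $s$ to $t$, $\overleftarrow{P}$ the reversed curve, $d_{\mathcal F}$ the continuous Fréchet distance, $\|\cdot\|$ the Lebesgue measure, and $$\mathrm{Cov}_P(\mathcal Q,\delta)=\bigcup_{Q\in\mathcal Q}\ \bigcup_{0\le s\le t\le 1,\ d_{\mathcal F}(P[s,t],Q)\le\delta}[s,t].$$ Let $\Delta,\varepsilon>0$, $\ell\ge 2$, $k\ge 0$, and let $S$ be a simplification of $P$: a polygonal curve with $d_{\mathcal F}(S,P)\le 2\Delta$ such that for all $Q\in\mathbb X^d_\ell$ and all $P[s,t]$ with $d_{\mathcal F}(Q,P[s,t])\le\Delta$ there is a subcurve $S[s',t']$ of complexity at most $\ell+2$ with $d_{\mathcal F}(P[s,t],S[s',t'])\le 2\Delta$. **Free spaces.** For every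 edge $e$ of $S$ (parametrized over $[0,1]$) let $A_e\subset[0,1]^2$ be a piecewise linear $(1+\varepsilon/4)$-approximate $4\Delta$-free space of $e$ and $P$: $\{(x,y):\|P(x)-e(y)\|\le4\Delta\}\subset A_e\subset\{(x,y):\|P(x)-e(y)\|\le(4+\varepsilon)\Delta\}$; inside the interior of each cell $[t_i,t_{i+1}]\times[0,1]$, $A_e$ is empty or a (non-degenerate) convex polygon; and a point on the boundary of a cell is in $A_e$ iff, for every cell containing it, it is in the closed region $K_i$, the closure of the part of $A_e$ in the interior of the cell. Let $\mathcal E_e=\{\varepsilon_1<\varepsilon_2<\dots\}$ be the set of $y$-coordinates of the extremal (left-, right-, bottom-, top-most) points and of the polygon vertices of the $K_i$. Let $l_i(y)$, $r_i(y)$ be the $x$-coordinates of the left- and rightmost point of $K_i$ at height $y$, where they exist. **Candidates.** The candidate set consists of (I) the subcurves of $S$ from its $i$th to its $(i+2^m)$th vertex, $2^m+1\le\ell$; (II) the subedges $e[0,\varepsilon_i]$, $e[\varepsilon_i,1]$ with $\varepsilon_i\in\mathcal E_e$, and their reversals; (III) the subedges $e[\varepsilon_i,\varepsilon_{i+2^m}]$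 with $\varepsilon_i,\varepsilon_{i+2^m}\in\mathcal E_e$, $0\le m\le\lfloor\log_2|\mathcal E_e|\rfloor$, and their reversals. **Proxy coverage.** For a candidate $c$ of type (I), $\widehat{\mathrm{Cov}}(c)=\mathrm{Cov}_P(\{c\},4\Delta)$. For a subedge $e[s,t]$, let $\mathcal R$ be the set of pairs $(i,j)$ such that there is a path in $\bigcup_i K_i$, monotone in both coordinates, from a point of $K_i$ at height $s$ to a point of $K_j$ at height $t$, and that are maximal with respect to inclusion of index intervals. An index $i$ is bad if $l_i(s)$ and $r_i(t)$ exist, all top-most points of $K_i$ have $x$-coordinate at most $l_i(s)$ and at most $r_i(t)$, and all bottom-most points of $K_i$ have $x$-coordinate at least $l_i(s)$ and at least $r_i(t)$; otherwise it is good. Let $\widetilde{\mathcal G}$ arise from $\{(i,j)\in\mathcal R: i<j\}$ by merging pairs $(a,b),(c,d)$ into $(a,d)$, transitively, whenever $a<c<b<d$, or $b=c$ is good. Put $\hat l_i=l_i(s)$, $\hat r_i=r_i(t)$ if $i$ is good and $\hat l_i=r_i(s)$, $\hat r_i=l_i(t)$ if $i$ is bad. Then $$\widehat{\mathrm{Cov}}(e[s,t])=\bigcup_{(i,i)\in\mathcal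 R,\ i\text{ good}}[l_i(s),r_i(t)]\ \cup\bigcup_{(i,j)\in\widetilde{\mathcal G}}[\hat l_i,\hat r_j],$$ and the proxy coverage of $\overleftarrow{e[s,t]}$ is that of the subedge $\overleftarrow e[1-t,1-s]$ with respect to the mirrored free space $\{(x,1-y):(x,y)\in A_e\}$. **Theorem.** Let $R$ be obtained from $\emptyset$ in $k$ rounds, each of which adds a candidate $c$ that maximizes $$\Big\|\widehat{\mathrm{Cov}}(c)\setminus\bigcup_{r\in R}\widehat{\mathrm{Cov}}(r)\Big\|$$ among all candidates, with $R$ the current set and ties broken arbitrarily. Then $R\subset\mathbb X^d_\ell$, and for every set $C^*\subset\mathbb X^d_\ell$ of $k$ curves $$\|\mathrm{Cov}_P(R,(4+\varepsilon)\Delta)\|\ \ge\ \frac{e-1}{16e}\,\|\mathrm{Cov}_P(C^*,\Delta)\|,$$ where in the constant $e$ is Euler's number. -/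

import Mathlib

open Set MeasureTheory
open scoped ENNReal

noncomputable section

namespace SubtrajectoryCoverage

/-! ### Curves, the Fréchet distance, and coverage -/

/-- Curves in `ℝ^d`, as maps from the unit interval. -/
abbrev Curve (d : ℕ) := unitInterval → EuclideanSpace ℝ (Fin d)

/-- The subcurve `γ[s,t]`, reparametrised linearly over `[0,1]`. The argument of `projIcc` is a
convex combination of `s` and `t`, so it already lies in `[0,1]`. -/
def subcurve {d : ℕ} (γ : Curve d) (s t : unitInterval) : Curve d :=
  fun u => γ (projIcc (0 : ℝ) 1 zero_le_one ((s : ℝ) + (u : ℝ) * ((t : ℝ) - (s : ℝ))))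

/-- The curve traversed backwards. -/
def reverseCurve {d : ℕ} (γ : Curve d) : Curve d := fun u => γ (unitInterval.symm u)

/-- A polygonal curve: a map on `[0,1]` together with parameters
`0 = time 0 < time 1 < ... < time numEdges = 1` of its vertices, such that the map is the linear
interpolation of consecutive vertices between consecutive parameters. The parametrisation need not
be uniform, and consecutive vertices may coincide. -/
structure PolygonalCurve (d : ℕ) where
  toCurve : Curve d
  numEdges : ℕ
  time : Fin (numEdges + 1) → unitInterval
  time_strictMono : StrictMono time
  time_zero : time 0 = 0
  time_last : time (Fin.last numEdges) = 1
  linear : ∀ (i : Fin numEdges) (u : unitInterval),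
    subcurve toCurve (time i.castSucc) (time i.succ) u =
      AffineMap.lineMap (toCurve (time i.castSucc)) (toCurve (time i.succ)) (u : ℝ)

/-- The number of vertices. -/
def PolygonalCurve.complexity {d : ℕ} (P : PolygonalCurve d) : ℕ := P.numEdges + 1

/-- The `i`-th edge, as a curve over `[0,1]`. -/
def PolygonalCurve.edge {d : ℕ} (P : PolygonalCurve d) (i : Fin P.numEdges) : Curve d :=
  subcurve P.toCurve (P.time i.castSucc) (P.time i.succ)

/-- The complexity of the subcurve from parameter `s` to parameter `t`: its two endpoints and the
vertices strictly between them. -/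
def PolygonalCurve.subcurveComplexity {d : ℕ} (P : PolygonalCurve d) (s t : unitInterval) : ℕ :=
  {i : Fin (P.numEdges + 1) | s < P.time i ∧ P.time i < t}.ncard + 2

/-- The set of all polygonal curves in `ℝ^d` of complexity at most `l`. -/
def curveSpace (d l : ℕ) : Set (Curve d) :=
  {γ | ∃ P : PolygonalCurve d, P.complexity ≤ l ∧ P.toCurve = γ}

/-- The continuous Fréchet distance. -/
def frechetDist {d : ℕ} (γ η : Curve d) : ℝ≥0∞ :=
  ⨅ (f : unitInterval → unitInterval) (g : unitInterval → unitInterval)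
    (_ : Monotone f ∧ Function.Surjective f) (_ : Monotone g ∧ Function.Surjective g),
    ⨆ t : unitInterval, edist (γ (f t)) (η (g t))

/-- The `δ`-coverage of a set `Q` of curves on `P`, a subset of `[0,1]`. -/
def coverage {d : ℕ} (P : Curve d) (Q : Set (Curve d)) (δ : ℝ) : Set ℝ :=
  {x | ∃ q ∈ Q, ∃ s t : unitInterval, s ≤ t ∧
    frechetDist (subcurve P s t) q ≤ ENNReal.ofReal δ ∧ x ∈ Icc (s : ℝ) (t : ℝ)}

/-- `S` is a simplification of `P` (for the radius `Δ` and the complexity `l`). -/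
def IsSimplification {d : ℕ} (P S : PolygonalCurve d) (Δ : ℝ) (l : ℕ) : Prop :=
  frechetDist S.toCurve P.toCurve ≤ ENNReal.ofReal (2 * Δ) ∧
  ∀ q ∈ curveSpace d l, ∀ s t : unitInterval, s ≤ t →
    frechetDist q (subcurve P.toCurve s t) ≤ ENNReal.ofReal Δ →
    ∃ s' t' : unitInterval, s' ≤ t' ∧
      frechetDist (subcurve P.toCurve s t) (subcurve S.toCurve s' t') ≤
        ENNReal.ofReal (2 * Δ) ∧
      S.subcurveComplexity s' t' ≤ l + 2

/-! ### Approximate free spaces of an edge and a polygonal curve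

The first coordinate is the parameter on the curve `P`, the second one the parameter on the edge. -/

/-- The `δ`-free space of `e` and `P`. -/
def freeSpace {d : ℕ} (P e : Curve d) (δ : ℝ) : Set (ℝ × ℝ) :=
  {p | ∃ x y : unitInterval, p = ((x : ℝ), (y : ℝ)) ∧ dist (P x) (e y) ≤ δ}

/-- The `i`-th cell of the free space diagram of an edge and `P`. -/
def PolygonalCurve.cell {d : ℕ} (P : PolygonalCurve d) (i : Fin P.numEdges) : Set (ℝ × ℝ) :=
  Icc (P.time i.castSucc : ℝ) (P.time i.succ : ℝ) ×ˢ Icc (0 : ℝ) 1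

/-- The interior of the `i`-th cell. -/
def PolygonalCurve.cellInterior {d : ℕ} (P : PolygonalCurve d) (i : Fin P.numEdges) :
    Set (ℝ × ℝ) :=
  Ioo (P.time i.castSucc : ℝ) (P.time i.succ : ℝ) ×ˢ Ioo (0 : ℝ) 1

/-- The closed region that `A` defines in the `i`-th cell: the closure of the restriction of `A`
to the interior of that cell. -/
def cellRegion {d : ℕ} (P : PolygonalCurve d) (A : Set (ℝ × ℝ)) (i : Fin P.numEdges) :
    Set (ℝ × ℝ) :=
  closure (A ∩ P.cellInterior i)

/-- `A` is an `α`-approximate `δ`-free space of the edge `e` and `P`. -/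
structure IsApproxFreeSpace {d : ℕ} (P : PolygonalCurve d) (e : Curve d) (α δ : ℝ)
    (A : Set (ℝ × ℝ)) : Prop where
  lower : freeSpace P.toCurve e δ ⊆ A
  upper : A ⊆ freeSpace P.toCurve e (α * δ)
  convex : ∀ i, Convex ℝ (A ∩ P.cellInterior i)
  boundary : ∀ p, (∃ i, p ∈ P.cell i \ P.cellInterior i) →
    (p ∈ A ↔ ∀ i, p ∈ P.cell i → p ∈ cellRegion P A i)

/-- `A` is piecewise linear: in the interior of every cell it is empty or a convex polygon (the
convex hull of finitely many points, not all on a line). -/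
def IsPiecewiseLinear {d : ℕ} (P : PolygonalCurve d) (A : Set (ℝ × ℝ)) : Prop :=
  ∀ i, A ∩ P.cellInterior i = ∅ ∨
    ∃ V : Finset (ℝ × ℝ), (V : Set (ℝ × ℝ)) ⊆ P.cell i ∧
      (interior (convexHull ℝ (V : Set (ℝ × ℝ)))).Nonempty ∧
      A ∩ P.cellInterior i = convexHull ℝ (V : Set (ℝ × ℝ)) ∩ P.cellInterior i

/-- The left-most points of a planar set. -/
def leftmost (K : Set (ℝ × ℝ)) : Set (ℝ × ℝ) := {p ∈ K | ∀ q ∈ K, p.1 ≤ q.1}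

/-- The right-most points of a planar set. -/
def rightmost (K : Set (ℝ × ℝ)) : Set (ℝ × ℝ) := {p ∈ K | ∀ q ∈ K, q.1 ≤ p.1}

/-- The bottom-most points of a planar set. -/
def bottommost (K : Set (ℝ × ℝ)) : Set (ℝ × ℝ) := {p ∈ K | ∀ q ∈ K, p.2 ≤ q.2}

/-- The top-most points of a planar set. -/
def topmost (K : Set (ℝ × ℝ)) : Set (ℝ × ℝ) := {p ∈ K | ∀ q ∈ K, q.2 ≤ p.2}

/-- The extremal points of a compact convex set: the endpoints of the segments formed by its
left-, right-, bottom- and top-most points. -/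
def extremalPoints (K : Set (ℝ × ℝ)) : Set (ℝ × ℝ) :=
  (leftmost K).extremePoints ℝ ∪ (rightmost K).extremePoints ℝ ∪
    (bottommost K).extremePoints ℝ ∪ (topmost K).extremePoints ℝ

/-- The `y`-coordinates of the extremal points and of the polygon vertices of `A`. -/
def heights {d : ℕ} (P : PolygonalCurve d) (A : Set (ℝ × ℝ)) : Set ℝ :=
  {y | ∃ (i : Fin P.numEdges) (x : ℝ),
    (x, y) ∈ extremalPoints (cellRegion P A i) ∪ (cellRegion P A i).extremePoints ℝ}

/-! ### The proxy coverage of subedges -/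

/-- There is a path from `p` to `q` inside `A` that is monotone in both coordinates. -/
def MonotonePath (A : Set (ℝ × ℝ)) (p q : ℝ × ℝ) : Prop :=
  ∃ γ : unitInterval → ℝ × ℝ, Continuous γ ∧ Monotone γ ∧ γ 0 = p ∧ γ 1 = q ∧ ∀ u, γ u ∈ A

/-- The region in the `i`-th cell contains a point at height `y`. -/
def Meets {d : ℕ} (P : PolygonalCurve d) (A : Set (ℝ × ℝ)) (i : Fin P.numEdges) (y : ℝ) : Prop :=
  ∃ x, (x, y) ∈ cellRegion P A i

/-- The `x`-coordinate `l_i(y)` of the leftmost point at height `y` in the `i`-th cell (used only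
where such a point exists). -/
def leftEnd {d : ℕ} (P : PolygonalCurve d) (A : Set (ℝ × ℝ)) (i : Fin P.numEdges) (y : ℝ) : ℝ :=
  sInf {x | (x, y) ∈ cellRegion P A i}

/-- The `x`-coordinate `r_i(y)` of the rightmost point at height `y` in the `i`-th cell (used only
where such a point exists). -/
def rightEnd {d : ℕ} (P : PolygonalCurve d) (A : Set (ℝ × ℝ)) (i : Fin P.numEdges) (y : ℝ) : ℝ :=
  sSup {x | (x, y) ∈ cellRegion P A i}

/-- There is a monotone path from the `i`-th cell at height `s` to the `j`-th cell at height `t`.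
The closure only adds points on the boundary of cells; it is the union of the cell regions. -/
def Reaches {d : ℕ} (P : PolygonalCurve d) (A : Set (ℝ × ℝ)) (s t : ℝ)
    (ij : Fin P.numEdges × Fin P.numEdges) : Prop :=
  ∃ x x' : ℝ, (x, s) ∈ cellRegion P A ij.1 ∧ (x', t) ∈ cellRegion P A ij.2 ∧
    MonotonePath (closure A) (x, s) (x', t)

/-- The combinatorial representation of the coverage of `e[s,t]`: the inclusionwise maximal index
pairs, where `(i,j)` includes `(i',j')` if `i ≤ i'` and `j' ≤ j`. -/
def combinatorialRep {d : ℕ} (P : PolygonalCurve d) (A : Set (ℝ × ℝ)) (s t : ℝ) :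
    Set (Fin P.numEdges × Fin P.numEdges) :=
  {p | Reaches P A s t p ∧ ∀ q, Reaches P A s t q → q.1 ≤ p.1 → p.2 ≤ q.2 → q = p}

/-- The global group. -/
def globalGroup {d : ℕ} (P : PolygonalCurve d) (A : Set (ℝ × ℝ)) (s t : ℝ) :
    Set (Fin P.numEdges × Fin P.numEdges) :=
  {p ∈ combinatorialRep P A s t | p.1 < p.2}

/-- The indices `i` such that `(i,i)` is in the local group. -/
def localGroup {d : ℕ} (P : PolygonalCurve d) (A : Set (ℝ × ℝ)) (s t : ℝ) :
    Set (Fin P.numEdges) :=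
  {i | (i, i) ∈ combinatorialRep P A s t}

/-- The index `i` is bad for `e[s,t]`: all top-most points of cell `i` are to the left of `l_i(s)`
and `r_i(t)`, which are both to the left of all bottom-most points. -/
def IsBad {d : ℕ} (P : PolygonalCurve d) (A : Set (ℝ × ℝ)) (s t : ℝ) (i : Fin P.numEdges) :
    Prop :=
  Meets P A i s ∧ Meets P A i t ∧
  (∀ p ∈ topmost (cellRegion P A i), p.1 ≤ leftEnd P A i s ∧ p.1 ≤ rightEnd P A i t) ∧
  (∀ p ∈ bottommost (cellRegion P A i), leftEnd P A i s ≤ p.1 ∧ rightEnd P A i t ≤ p.1)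

/-- Two index pairs `(a,b)` and `(c,d)` of the global group that are to be merged. -/
def Mergeable {d : ℕ} (P : PolygonalCurve d) (A : Set (ℝ × ℝ)) (s t : ℝ)
    (p q : Fin P.numEdges × Fin P.numEdges) : Prop :=
  p ∈ globalGroup P A s t ∧ q ∈ globalGroup P A s t ∧
  ((p.1 < q.1 ∧ q.1 < p.2 ∧ p.2 < q.2) ∨ (p.2 = q.1 ∧ ¬ IsBad P A s t p.2))

/-- The reduced global group: each class of index pairs connected by merging is replaced by the
pair of its smallest first index and its largest second index. -/
def reducedGlobalGroup {d : ℕ} (P : PolygonalCurve d) (A : Set (ℝ × ℝ)) (s t : ℝ) :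
    Set (Fin P.numEdges × Fin P.numEdges) :=
  {ab | ∃ p ∈ globalGroup P A s t, ∃ q ∈ globalGroup P A s t,
    Relation.EqvGen (Mergeable P A s t) p q ∧ ab = (p.1, q.2) ∧
    ∀ r, Relation.EqvGen (Mergeable P A s t) p r → p.1 ≤ r.1 ∧ r.2 ≤ q.2}

open Classical in
/-- `l_i(s)` if `i` is good for `e[s,t]`, and `r_i(s)` if it is bad. -/
def proxyLeft {d : ℕ} (P : PolygonalCurve d) (A : Set (ℝ × ℝ)) (s t : ℝ) (i : Fin P.numEdges) :
    ℝ :=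
  if IsBad P A s t i then rightEnd P A i s else leftEnd P A i s

open Classical in
/-- `r_j(t)` if `j` is good for `e[s,t]`, and `l_j(t)` if it is bad. -/
def proxyRight {d : ℕ} (P : PolygonalCurve d) (A : Set (ℝ × ℝ)) (s t : ℝ) (j : Fin P.numEdges) :
    ℝ :=
  if IsBad P A s t j then leftEnd P A j t else rightEnd P A j t

/-- The proxy coverage of the subedge `e[s,t]`, where `A` is an approximate free space of `e`
and `P`. -/
def subedgeProxy {d : ℕ} (P : PolygonalCurve d) (A : Set (ℝ × ℝ)) (s t : ℝ) : Set ℝ :=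
  (⋃ i ∈ {i ∈ localGroup P A s t | ¬ IsBad P A s t i}, Icc (leftEnd P A i s) (rightEnd P A i t)) ∪
  (⋃ ij ∈ reducedGlobalGroup P A s t, Icc (proxyLeft P A s t ij.1) (proxyRight P A s t ij.2))

/-- The approximate free space of the reversed edge. -/
def mirror (A : Set (ℝ × ℝ)) : Set (ℝ × ℝ) := {p | (p.1, 1 - p.2) ∈ A}

/-! ### Candidates and the greedy algorithm -/

/-- Subcurves of `S` between two vertices, subedges of `S`, and reversed subedges of `S`. -/
inductive Candidate {d : ℕ} (S : PolygonalCurve d) where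
  | vertexVertex (i j : Fin (S.numEdges + 1))
  | subedge (e : Fin S.numEdges) (s t : unitInterval)
  | reversed (e : Fin S.numEdges) (s t : unitInterval)

/-- The curve that a candidate stands for. -/
def Candidate.curve {d : ℕ} {S : PolygonalCurve d} : Candidate S → Curve d
  | .vertexVertex i j => subcurve S.toCurve (S.time i) (S.time j)
  | .subedge e s t => subcurve (S.edge e) s t
  | .reversed e s t => reverseCurve (subcurve (S.edge e) s t)

/-- The parameters of an edge-affix `e[0,t]` or `e[s,1]` induced by the set `E` of heights. -/
def IsTypeTwo (E : Set ℝ) (s t : unitInterval) : Prop :=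
  (s = 0 ∧ (t : ℝ) ∈ E) ∨ ((s : ℝ) ∈ E ∧ t = 1)

/-- The parameters of a subedge from the `i`-th to the `(i+j)`-th smallest element of `E`, where
`j = 2^m` with `m ≤ log₂ |E|`: there are `j` elements of `E` in `(s,t]`. -/
def IsTypeThree (E : Set ℝ) (s t : unitInterval) : Prop :=
  (s : ℝ) ∈ E ∧ (t : ℝ) ∈ E ∧
    ∃ m ≤ Nat.log 2 E.ncard, (E ∩ Ioc (s : ℝ) (t : ℝ)).ncard = 2 ^ m

/-- The candidate set: the vertex-vertex-subcurves from the `i`-th to the `(i+2^m)`-th vertex of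
complexity `2^m + 1 ≤ l`, and the edge-affixes and subedges, and their reversals, induced by the
sets `E e` of heights. -/
def IsCandidate {d : ℕ} {S : PolygonalCurve d} (l : ℕ) (E : Fin S.numEdges → Set ℝ) :
    Candidate S → Prop
  | .vertexVertex i j => ∃ m : ℕ, (j : ℕ) = (i : ℕ) + 2 ^ m ∧ 2 ^ m + 1 ≤ l
  | .subedge e s t => IsTypeTwo (E e) s t ∨ IsTypeThree (E e) s t
  | .reversed e s t => IsTypeTwo (E e) s t ∨ IsTypeThree (E e) s t

/-- The proxy coverage of a candidate; `A e` is an approximate `δ`-free space of the edge `e` of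
`S` and `P`. -/
def proxyCoverage {d : ℕ} (P : PolygonalCurve d) {S : PolygonalCurve d} (δ : ℝ)
    (A : Fin S.numEdges → Set (ℝ × ℝ)) : Candidate S → Set ℝ
  | .vertexVertex i j => coverage P.toCurve {(Candidate.vertexVertex i j).curve} δ
  | .subedge e s t => subedgeProxy P (A e) s t
  | .reversed e s t => subedgeProxy P (mirror (A e)) (1 - (t : ℝ)) (1 - (s : ℝ))

/-- `c` lists the choices of `k` rounds of the greedy algorithm: each round takes an admissible
element that maximises the measure of the newly covered part. -/
def IsGreedyRun {α : Type*} (admissible : α → Prop) (cov : α → Set ℝ) {k : ℕ} (c : Fin k → α) :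
    Prop :=
  ∀ i, admissible (c i) ∧ ∀ a, admissible a →
    volume (cov a \ ⋃ j : {j : Fin k // j < i}, cov (c j)) ≤
      volume (cov (c i) \ ⋃ j : {j : Fin k // j < i}, cov (c j))

end SubtrajectoryCoverage

end

open SubtrajectoryCoverage

namespace SubtrajectoryCoverage

/-! ### Curves and subcurves -/

/-! The greedy rule is the one for maximum coverage, and the proof rests on three facts: proxy
coverages are sound, ten candidates per optimal curve are complete, and the greedy choice loses only
a constant factor.

Soundness (`proxyCoverage_subset_coverage`). For a subedge, the proxy coverage lies in the reach
region, the union of the intervals `[l_i(s), r_j(t)]` over all pairs joined by a monotone path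
(`subedgeProxy_subset_reachRegion`). Such a path lies in the closed `(4+ε)Δ`-free space, so it is a
pair of traversals witnessing the Fréchet bound (`reachRegion_subset_coverage`).

Completeness (`exists_candidates_cover`). Fix one subcurve of `P` close to `q` and the subcurve
`S[s',t']` that the simplification assigns to it. By the triangle inequality every other subcurve of
`P` within `Δ` of `q` is within `Δ + Δ + 2Δ = 4Δ` of this same `S[s',t']`. It therefore suffices to
cover all `4Δ`-traversals along one subcurve of `S`, which splits into the end of an edge, a
vertex-to-vertex part and the beginning of an edge. Two overlapping dyadic windows cover the middle
part (`pathsCovered_vertexVertex`).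

On an edge, heights between the first and last elements of `E` in the range are covered by dyadic
pairs (`exists_dyadicPairs`). A matched point beyond these lies in a gap of `E`. There a cell
polygon has no vertex, so the point lies on a segment of the polygon that spans the gap. Depending
on the slope of the segment, the subedge or its reversal reaches the point
(`mem_bothRegion_of_heights`). Exchanging reach regions for proxy coverages costs finitely many
points: what bad indices cut off is recovered by the reversal (`exists_finite_reachRegion_subset`).

Greedy (`greedy_bound`). The optimum is covered, up to a null set, by at most `16k` candidates, so
each round gains at least a `1/(16k)` fraction of what is missing. After `k` rounds the missing
fraction is at most `exp(-1/16)`, and convexity of `exp` gives the stated constant.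

The paths have to live at distance exactly `4Δ`, and coverages have to be measurable. Both follow
because the infimum in the Fréchet distance of continuous curves is attained (`frechetDist_le_iff`).
-/

theorem convexComb_mem (s t u : unitInterval) :
    (s : ℝ) + u * ((t : ℝ) - s) ∈ Icc (0 : ℝ) 1 := by
  obtain ⟨s, hs0, hs1⟩ := s
  obtain ⟨t, ht0, ht1⟩ := t
  obtain ⟨u, hu0, hu1⟩ := u
  constructor <;> simp only <;> nlinarith

/-- The point of `[s,t]` at relative position `u`. -/
noncomputable def intervalPoint (s t u : unitInterval) : unitInterval :=
  projIcc (0 : ℝ) 1 zero_le_one ((s : ℝ) + (u : ℝ) * ((t : ℝ) - (s : ℝ)))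

theorem coe_intervalPoint (s t u : unitInterval) :
    (intervalPoint s t u : ℝ) = s + u * ((t : ℝ) - s) := by
  rw [intervalPoint, projIcc_of_mem _ (convexComb_mem s t u)]

theorem subcurve_apply {d : ℕ} (γ : Curve d) (s t u : unitInterval) :
    subcurve γ s t u = γ (intervalPoint s t u) := rfl

theorem intervalPoint_zero (s t : unitInterval) : intervalPoint s t 0 = s := by
  ext; simp [coe_intervalPoint]

theorem intervalPoint_one (s t : unitInterval) : intervalPoint s t 1 = t := by
  ext; simp [coe_intervalPoint]

theorem continuous_intervalPoint :
    Continuous fun p : unitInterval × unitInterval × unitInterval =>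
      intervalPoint p.1 p.2.1 p.2.2 := by
  unfold intervalPoint
  exact continuous_projIcc.comp (by fun_prop)

theorem intervalPoint_monotone {s t : unitInterval} (h : s ≤ t) :
    Monotone (intervalPoint s t) := by
  intro u v huv
  rw [← Subtype.coe_le_coe, coe_intervalPoint, coe_intervalPoint]
  have : (u : ℝ) ≤ v := huv
  have : (s : ℝ) ≤ t := h
  nlinarith

theorem intervalPoint_mem {s t : unitInterval} (h : s ≤ t) (u : unitInterval) :
    intervalPoint s t u ∈ Icc s t := by
  constructor
  · simpa [intervalPoint_zero] using intervalPoint_monotone h (unitInterval.nonneg' (t := u))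
  · simpa [intervalPoint_one] using intervalPoint_monotone h (unitInterval.le_one' (t := u))

theorem exists_intervalPoint_eq {s t x : unitInterval} (hx : x ∈ Icc s t) :
    ∃ u, intervalPoint s t u = x := by
  rcases eq_or_lt_of_le (hx.1.trans hx.2) with h | h
  · subst h
    exact ⟨0, by rw [intervalPoint_zero]; exact le_antisymm hx.1 hx.2⟩
  · have h' : (s : ℝ) < t := h
    have h1 : (s : ℝ) ≤ x := hx.1
    have h2 : (x : ℝ) ≤ t := hx.2
    refine ⟨⟨((x : ℝ) - s) / (t - s), div_nonneg (by linarith) (by linarith),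
      (div_le_one (by linarith)).2 (by linarith)⟩, ?_⟩
    ext
    rw [coe_intervalPoint]
    have : (t : ℝ) - s ≠ 0 := by linarith
    simp only
    field_simp
    ring

theorem intervalPoint_intervalPoint (s t a b u : unitInterval) :
    intervalPoint s t (intervalPoint a b u) =
      intervalPoint (intervalPoint s t a) (intervalPoint s t b) u := by
  ext
  simp only [coe_intervalPoint]
  ring

theorem subcurve_subcurve {d : ℕ} (γ : Curve d) (s t a b : unitInterval) :
    subcurve (subcurve γ s t) a b =
      subcurve γ (intervalPoint s t a) (intervalPoint s t b) := by
  funext u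
  simp only [subcurve_apply, intervalPoint_intervalPoint]

theorem Continuous.subcurve {d : ℕ} {γ : Curve d} (hγ : Continuous γ) (s t : unitInterval) :
    Continuous (subcurve γ s t) :=
  hγ.comp (continuous_intervalPoint.comp
    (f := fun u => (s, t, u)) (by fun_prop))

theorem reverseCurve_subcurve {d : ℕ} (γ : Curve d) (s t : unitInterval) :
    reverseCurve (subcurve γ s t) =
      subcurve (reverseCurve γ) (unitInterval.symm t) (unitInterval.symm s) := by
  funext u
  simp only [reverseCurve, subcurve_apply]
  congr 1
  ext
  simp only [coe_intervalPoint, unitInterval.coe_symm_eq]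
  ring

theorem PolygonalCurve.numEdges_pos {d : ℕ} (P : PolygonalCurve d) : 0 < P.numEdges := by
  rcases Nat.eq_zero_or_pos P.numEdges with h | h
  · have h0 := P.time_zero
    have h1 := P.time_last
    have : (Fin.last P.numEdges) = 0 := by ext; simp [h]
    rw [this, h0] at h1
    exact absurd h1 zero_ne_one
  · exact h

theorem PolygonalCurve.time_lt {d : ℕ} (P : PolygonalCurve d) (i : Fin P.numEdges) :
    P.time i.castSucc < P.time i.succ := P.time_strictMono Fin.castSucc_lt_succ

theorem PolygonalCurve.exists_edge {d : ℕ} (P : PolygonalCurve d) {x : unitInterval}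
    (hx : x < 1) : ∃ i : Fin P.numEdges, P.time i.castSucc ≤ x ∧ x < P.time i.succ := by
  by_contra! hcon
  have key : ∀ i : Fin (P.numEdges + 1), P.time i ≤ x := by
    intro i
    induction i using Fin.induction with
    | zero => rw [P.time_zero]; exact x.2.1
    | succ i ih => exact hcon i ih
  have := key (Fin.last _)
  rw [P.time_last] at this
  exact absurd hx (not_lt.2 this)

theorem PolygonalCurve.exists_edge_Icc {d : ℕ} (P : PolygonalCurve d) (x : unitInterval) :
    ∃ i : Fin P.numEdges, x ∈ Icc (P.time i.castSucc) (P.time i.succ) := by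
  rcases lt_or_eq_of_le (show x ≤ 1 from x.2.2) with h | h
  · obtain ⟨i, h1, h2⟩ := P.exists_edge h
    exact ⟨i, h1, h2.le⟩
  · have hp := P.numEdges_pos
    refine ⟨⟨P.numEdges - 1, by omega⟩, ?_, ?_⟩
    · rw [h]; exact unitInterval.le_one _
    · have : (⟨P.numEdges - 1, by omega⟩ : Fin P.numEdges).succ = Fin.last _ := by
        ext; simp; omega
      rw [this, P.time_last]
      exact unitInterval.le_one _

theorem PolygonalCurve.continuous {d : ℕ} (P : PolygonalCurve d) : Continuous P.toCurve := by
  refine (locallyFinite_of_finite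
    (fun i : Fin P.numEdges => Icc (P.time i.castSucc) (P.time i.succ))).continuous
    ?_ (fun i => isClosed_Icc) ?_
  · exact eq_univ_of_forall fun x => mem_iUnion.2 (P.exists_edge_Icc x)
  · intro i
    have hlt : (P.time i.castSucc : ℝ) < P.time i.succ := P.time_lt i
    have : ContinuousOn (fun x : unitInterval =>
        AffineMap.lineMap (k := ℝ) (P.toCurve (P.time i.castSucc)) (P.toCurve (P.time i.succ))
          (((x : ℝ) - P.time i.castSucc) / (P.time i.succ - P.time i.castSucc)))
        (Icc (P.time i.castSucc) (P.time i.succ)) := by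
      refine Continuous.continuousOn ?_
      exact AffineMap.lineMap_continuous.comp (by fun_prop)
    refine this.congr fun x hx => ?_
    obtain ⟨u, hu⟩ := exists_intervalPoint_eq hx
    have h1 := P.linear i u
    rw [subcurve_apply, hu] at h1
    rw [h1]
    congr 1
    rw [← hu, coe_intervalPoint]
    have : (P.time i.succ : ℝ) - P.time i.castSucc ≠ 0 := by linarith
    field_simp
    ring

theorem PolygonalCurve.continuous_edge {d : ℕ} (P : PolygonalCurve d) (i : Fin P.numEdges) :
    Continuous (P.edge i) := Continuous.subcurve P.continuous _ _

theorem continuous_of_mem_curveSpace {d l : ℕ} {q : Curve d} (hq : q ∈ curveSpace d l) :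
    Continuous q := by
  obtain ⟨Q, -, rfl⟩ := hq
  exact Q.continuous

/-! ### The Fréchet distance -/

theorem frechetDist_comm {d : ℕ} (γ η : Curve d) : frechetDist γ η = frechetDist η γ := by
  have key : ∀ γ η : Curve d, frechetDist γ η ≤ frechetDist η γ := by
    intro γ η
    refine le_iInf fun f => le_iInf fun g => le_iInf fun hf => le_iInf fun hg => ?_
    refine iInf_le_of_le g <| iInf_le_of_le f <| iInf_le_of_le hg <| iInf_le_of_le hf ?_
    simp only [edist_comm, le_refl]
  exact le_antisymm (key _ _) (key _ _)

theorem frechetDist_le_of_maps {d : ℕ} {γ η : Curve d} {f g : unitInterval → unitInterval}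
    (hf : Monotone f ∧ Function.Surjective f) (hg : Monotone g ∧ Function.Surjective g)
    {δ : ℝ} (h : ∀ u, dist (γ (f u)) (η (g u)) ≤ δ) : frechetDist γ η ≤ ENNReal.ofReal δ := by
  refine iInf_le_of_le f <| iInf_le_of_le g <| iInf_le_of_le hf <| iInf_le_of_le hg <|
    iSup_le fun u => ?_
  rw [edist_dist]
  exact ENNReal.ofReal_le_ofReal (h u)

theorem exists_maps_of_frechetDist_lt {d : ℕ} {γ η : Curve d} {δ : ℝ}
    (h : frechetDist γ η < ENNReal.ofReal δ) :
    ∃ f g : unitInterval → unitInterval, (Monotone f ∧ Function.Surjective f) ∧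
      (Monotone g ∧ Function.Surjective g) ∧ ∀ u, dist (γ (f u)) (η (g u)) ≤ δ := by
  simp only [frechetDist, iInf_lt_iff] at h
  obtain ⟨f, g, hf, hg, h⟩ := h
  refine ⟨f, g, hf, hg, fun u => ?_⟩
  have h1 := (le_iSup (fun t => edist (γ (f t)) (η (g t))) u).trans_lt h
  rw [edist_dist] at h1
  exact ((ENNReal.ofReal_lt_ofReal_iff_of_nonneg dist_nonneg).1 h1).le

theorem map_zero_of_monotone_surjective {f : unitInterval → unitInterval}
    (hf : Monotone f ∧ Function.Surjective f) : f 0 = 0 := by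
  obtain ⟨u, hu⟩ := hf.2 0
  exact le_antisymm ((hf.1 unitInterval.nonneg').trans_eq hu) unitInterval.nonneg'

theorem map_one_of_monotone_surjective {f : unitInterval → unitInterval}
    (hf : Monotone f ∧ Function.Surjective f) : f 1 = 1 := by
  obtain ⟨u, hu⟩ := hf.2 1
  exact le_antisymm unitInterval.le_one' (hu.symm.trans_le (hf.1 unitInterval.le_one'))

theorem surjective_of_continuous_of_endpoints {f : unitInterval → unitInterval}
    (hc : Continuous f) (h0 : f 0 = 0) (h1 : f 1 = 1) : Function.Surjective f := by
  intro y
  have := intermediate_value_univ (0 : unitInterval) 1 hc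
  rw [h0, h1] at this
  exact this ⟨y.2.1, y.2.2⟩

/-- Monotone, 2-Lipschitz maps of the unit interval to itself that fix the endpoints. -/
def normalizedMaps : Set (unitInterval → unitInterval) :=
  {F | Monotone F ∧ F 0 = 0 ∧ F 1 = 1 ∧ ∀ u v, dist (F u) (F v) ≤ 2 * dist u v}

theorem isClosed_normalizedMaps : IsClosed normalizedMaps := by
  have h1 : IsClosed {F : unitInterval → unitInterval | Monotone F} := by
    simp only [Monotone, ofPred_forall]
    exact isClosed_iInter fun u => isClosed_iInter fun v => isClosed_iInter fun _ =>
      isClosed_le (continuous_apply u) (continuous_apply v)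
  have h2 : IsClosed {F : unitInterval → unitInterval | F 0 = 0} :=
    isClosed_eq (continuous_apply _) continuous_const
  have h3 : IsClosed {F : unitInterval → unitInterval | F 1 = 1} :=
    isClosed_eq (continuous_apply _) continuous_const
  have h4 : IsClosed {F : unitInterval → unitInterval | ∀ u v, dist (F u) (F v) ≤ 2 * dist u v} := by
    simp only [ofPred_forall]
    exact isClosed_iInter fun u => isClosed_iInter fun v =>
      isClosed_le ((continuous_apply u).dist (continuous_apply v)) continuous_const
  exact h1.inter (h2.inter (h3.inter h4))

theorem continuous_of_mem_normalizedMaps {F : unitInterval → unitInterval}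
    (hF : F ∈ normalizedMaps) : Continuous F :=
  (LipschitzWith.of_dist_le_mul (K := 2) hF.2.2.2).continuous

theorem surjective_of_mem_normalizedMaps {F : unitInterval → unitInterval}
    (hF : F ∈ normalizedMaps) : Monotone F ∧ Function.Surjective F :=
  ⟨hF.1, surjective_of_continuous_of_endpoints (continuous_of_mem_normalizedMaps hF) hF.2.1
    hF.2.2.1⟩

/-- Reparametrise by the mean of `f` and `g`: for each `w` pick `t` with `f t + g t = 2w`. Both
values are monotone in `w` and their increments add up to `2(w' - w)`, so each is 2-Lipschitz. This
replaces arbitrary traversals by a compact family. -/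
theorem exists_normalizedMaps {f g : unitInterval → unitInterval}
    (hf : Monotone f ∧ Function.Surjective f) (hg : Monotone g ∧ Function.Surjective g) :
    ∃ F ∈ normalizedMaps, ∃ G ∈ normalizedMaps, ∀ w, ∃ t, F w = f t ∧ G w = g t := by
  have hfc := hf.1.continuous_of_surjective hf.2
  have hgc := hg.1.continuous_of_surjective hg.2
  have hsum : ∀ w : unitInterval, ∃ t : unitInterval, (f t : ℝ) + g t = 2 * w := by
    intro w
    have h := intermediate_value_univ (0 : unitInterval) 1
      (f := fun t => (f t : ℝ) + g t) (by fun_prop)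
    rw [map_zero_of_monotone_surjective hf, map_zero_of_monotone_surjective hg,
      map_one_of_monotone_surjective hf, map_one_of_monotone_surjective hg] at h
    have := w.2.1
    have := w.2.2
    obtain ⟨t, ht⟩ := h (show (2 * w : ℝ) ∈ _ by constructor <;> norm_num <;> linarith)
    exact ⟨t, ht⟩
  choose t ht using hsum
  have key : ∀ w w' : unitInterval, w ≤ w' → f (t w) ≤ f (t w') ∧ g (t w) ≤ g (t w') ∧
      ((f (t w') : ℝ) - f (t w)) ≤ 2 * (w' - w) ∧ ((g (t w') : ℝ) - g (t w)) ≤ 2 * (w' - w) := by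
    intro w w' hw
    have e1 := ht w
    have e2 := ht w'
    have hw' : (w : ℝ) ≤ w' := hw
    have hle : f (t w) ≤ f (t w') ∧ g (t w) ≤ g (t w') := by
      rcases le_total (t w) (t w') with h | h
      -- The chosen `t` need not be monotone. In the other case neither summand increases from `t w`
      -- to `t w'` although their sum does not drop, so both stay equal.
      · exact ⟨hf.1 h, hg.1 h⟩
      · have a1 : (f (t w') : ℝ) ≤ f (t w) := hf.1 h
        have a2 : (g (t w') : ℝ) ≤ g (t w) := hg.1 h
        constructor <;> rw [← Subtype.coe_le_coe] <;> linarith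
    have a1 : (f (t w) : ℝ) ≤ f (t w') := hle.1
    have a2 : (g (t w) : ℝ) ≤ g (t w') := hle.2
    exact ⟨hle.1, hle.2, by linarith, by linarith⟩
  have e0 := ht 0
  have e1 := ht 1
  have b1 := (f (t 0)).2.1
  have b2 := (g (t 0)).2.1
  have b3 := (f (t 1)).2.2
  have b4 := (g (t 1)).2.2
  simp only [Icc.coe_zero, Icc.coe_one] at e0 e1
  have lip : ∀ φ : unitInterval → unitInterval,
      (∀ w w' : unitInterval, w ≤ w' → φ w ≤ φ w' ∧ ((φ w' : ℝ) - φ w) ≤ 2 * (w' - w)) →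
      ∀ u v, dist (φ u) (φ v) ≤ 2 * dist u v := by
    intro φ hφ u v
    rw [Subtype.dist_eq, Subtype.dist_eq, Real.dist_eq, Real.dist_eq]
    rcases le_total u v with h | h
    · obtain ⟨c1, c2⟩ := hφ u v h
      have c1 : (φ u : ℝ) ≤ φ v := c1
      have h : (u : ℝ) ≤ v := h
      rw [abs_sub_comm, abs_of_nonneg (by linarith), abs_sub_comm, abs_of_nonneg (by linarith)]
      exact c2
    · obtain ⟨c1, c2⟩ := hφ v u h
      have c1 : (φ v : ℝ) ≤ φ u := c1
      have h : (v : ℝ) ≤ u := h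
      rw [abs_of_nonneg (by linarith), abs_of_nonneg (by linarith)]
      exact c2
  refine ⟨fun w => f (t w), ⟨fun w w' h => (key w w' h).1, ?_, ?_,
    lip _ fun w w' h => ⟨(key w w' h).1, (key w w' h).2.2.1⟩⟩,
    fun w => g (t w), ⟨fun w w' h => (key w w' h).2.1, ?_, ?_,
    lip _ fun w w' h => ⟨(key w w' h).2.1, (key w w' h).2.2.2⟩⟩, fun w => ⟨t w, rfl, rfl⟩⟩
  all_goals ext; simp only [Icc.coe_zero, Icc.coe_one]; linarith

/-- The infimum is attained. Pairs of normalized maps with error `δ + 1/(n+1)` form decreasing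
nonempty closed sets in a product of copies of the unit interval, which is compact, so they have a
common element. -/
theorem frechetDist_le_iff {d : ℕ} {γ η : Curve d} (hγ : Continuous γ) (hη : Continuous η)
    {δ : ℝ} (hδ : 0 ≤ δ) :
    frechetDist γ η ≤ ENNReal.ofReal δ ↔
      ∃ F ∈ normalizedMaps, ∃ G ∈ normalizedMaps, ∀ u, dist (γ (F u)) (η (G u)) ≤ δ := by
  constructor
  · intro h
    let C : ℕ → Set ((unitInterval → unitInterval) × (unitInterval → unitInterval)) := fun n =>
      {p | p.1 ∈ normalizedMaps ∧ p.2 ∈ normalizedMaps ∧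
        ∀ u, dist (γ (p.1 u)) (η (p.2 u)) ≤ δ + 1 / ((n : ℝ) + 1)}
    have hclosed : ∀ n, IsClosed (C n) := by
      intro n
      refine (isClosed_normalizedMaps.preimage continuous_fst).inter
        ((isClosed_normalizedMaps.preimage continuous_snd).inter ?_)
      change IsClosed {p : (unitInterval → unitInterval) × (unitInterval → unitInterval) |
        ∀ u, dist (γ (p.1 u)) (η (p.2 u)) ≤ δ + 1 / ((n : ℝ) + 1)}
      rw [ofPred_forall]
      refine isClosed_iInter fun u => isClosed_le ?_ continuous_const
      exact (hγ.comp ((continuous_apply u).comp continuous_fst)).dist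
        (hη.comp ((continuous_apply u).comp continuous_snd))
    have hne : ∀ n, (C n).Nonempty := by
      intro n
      have hpos : (0 : ℝ) < 1 / ((n : ℝ) + 1) := by positivity
      obtain ⟨f, g, hf, hg, hd⟩ := exists_maps_of_frechetDist_lt
        (h.trans_lt ((ENNReal.ofReal_lt_ofReal_iff_of_nonneg hδ).2
          (show δ < δ + 1 / ((n : ℝ) + 1) by linarith)))
      obtain ⟨F, hF, G, hG, hFG⟩ := exists_normalizedMaps hf hg
      refine ⟨(F, G), hF, hG, fun u => ?_⟩
      obtain ⟨t, h1, h2⟩ := hFG u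
      simp only [h1, h2]
      exact hd t
    have hmono : ∀ n, C (n + 1) ⊆ C n := by
      intro n p hp
      refine ⟨hp.1, hp.2.1, fun u => (hp.2.2 u).trans ?_⟩
      have : (1 : ℝ) / (((n + 1 : ℕ) : ℝ) + 1) ≤ 1 / ((n : ℝ) + 1) :=
        one_div_le_one_div_of_le (by positivity) (by push_cast; linarith)
      linarith
    obtain ⟨p, hp⟩ := IsCompact.nonempty_iInter_of_sequence_nonempty_isCompact_isClosed C hmono
      hne (hclosed 0).isCompact hclosed
    rw [mem_iInter] at hp
    refine ⟨p.1, (hp 0).1, p.2, (hp 0).2.1, fun u => ?_⟩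
    refine ge_of_tendsto' (f := fun n : ℕ => δ + 1 / ((n : ℝ) + 1)) (x := Filter.atTop) ?_
      fun n => (hp n).2.2 u
    simpa using tendsto_const_nhds.add (tendsto_one_div_add_atTop_nhds_zero_nat (𝕜 := ℝ))
  · rintro ⟨F, hF, G, hG, h⟩
    exact frechetDist_le_of_maps (surjective_of_mem_normalizedMaps hF)
      (surjective_of_mem_normalizedMaps hG) h

/-- At the price of `ρ`, one traversal can be made the identity: mix a little of the identity into
`g` so that it becomes a bijection, and compose `f` with its inverse. Traversals in this form can be
composed, which yields the triangle inequality. -/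
theorem exists_map_of_frechetDist_le {d : ℕ} {γ η : Curve d} (hη : Continuous η)
    {δ ρ : ℝ} (hδ : 0 ≤ δ) (hρ : 0 < ρ) (h : frechetDist γ η ≤ ENNReal.ofReal δ) :
    ∃ φ : unitInterval → unitInterval, (Monotone φ ∧ Function.Surjective φ) ∧
      ∀ u, dist (γ (φ u)) (η u) ≤ δ + ρ := by
  obtain ⟨f, g, hf, hg, hd⟩ := exists_maps_of_frechetDist_lt
    (h.trans_lt ((ENNReal.ofReal_lt_ofReal_iff_of_nonneg hδ).2
      (show δ < δ + ρ / 2 by linarith)))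
  obtain ⟨r, hr, hun⟩ := Metric.uniformContinuous_iff.1
    (CompactSpace.uniformContinuous_of_continuous (f := fun u => η u) hη) (ρ / 2) (by linarith)
  -- Mixing with weight `τ` moves `g` by at most `τ`, which has to stay below the modulus `r` of
  -- uniform continuity of `η`; `τ ≤ 1/2` keeps `1 - τ` positive.
  let τ : ℝ := min (r / 2) (1 / 2)
  have hτ0 : 0 < τ := by positivity
  have hτ1 : τ ≤ 1 / 2 := min_le_right _ _
  have hτr : τ < r := (min_le_left _ _).trans_lt (by linarith)
  have hgc := hg.1.continuous_of_surjective hg.2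
  let g' : unitInterval → unitInterval := fun u => ⟨(1 - τ) * g u + τ * u, by
    have := (g u).2.1; have := (g u).2.2; have := u.2.1; have := u.2.2
    constructor <;> nlinarith⟩
  have hg'c : Continuous g' := by
    have hgc' : Continuous fun u => (g u : ℝ) := continuous_subtype_val.comp hgc
    exact ((continuous_const.mul hgc').add
      (continuous_const.mul continuous_subtype_val)).subtype_mk _
  have hg'm : StrictMono g' := by
    intro u v huv
    have h1 : (g u : ℝ) ≤ g v := hg.1 huv.le
    have h2 : (u : ℝ) < v := huv
    change (1 - τ) * g u + τ * u < (1 - τ) * g v + τ * v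
    nlinarith
  have hg's : Function.Surjective g' := by
    refine surjective_of_continuous_of_endpoints hg'c ?_ ?_
    · ext; simp [g', map_zero_of_monotone_surjective hg]
    · ext; simp [g', map_one_of_monotone_surjective hg]
  let ψ := hg'm.orderIsoOfSurjective g' hg's
  refine ⟨fun u => f (ψ.symm u), ⟨hf.1.comp ψ.symm.monotone, hf.2.comp ψ.symm.surjective⟩, ?_⟩
  intro u
  have e : g' (ψ.symm u) = u := ψ.apply_symm_apply u
  have h1 := hd (ψ.symm u)
  have h2 : dist (g (ψ.symm u)) (g' (ψ.symm u)) < r := by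
    set v := ψ.symm u
    rw [Subtype.dist_eq, Real.dist_eq]
    have : ((g v : ℝ) - (g' v : ℝ)) = τ * (g v - v) := by simp only [g']; ring
    rw [this, abs_mul, abs_of_pos hτ0]
    have : |(g v : ℝ) - v| ≤ 1 := by
      have := (g v).2.1; have := (g v).2.2; have := v.2.1; have := v.2.2
      rw [abs_le]; constructor <;> linarith
    nlinarith
  have h3 := hun h2
  rw [e] at h3
  calc dist (γ (f (ψ.symm u))) (η u)
      ≤ dist (γ (f (ψ.symm u))) (η (g (ψ.symm u))) + dist (η (g (ψ.symm u))) (η u) :=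
        dist_triangle _ _ _
    _ ≤ δ + ρ := by linarith

theorem frechetDist_triangle_le {d : ℕ} {γ η ζ : Curve d} (hη : Continuous η) (hζ : Continuous ζ)
    {δ δ' : ℝ} (hδ : 0 ≤ δ) (hδ' : 0 ≤ δ') (h : frechetDist γ η ≤ ENNReal.ofReal δ)
    (h' : frechetDist η ζ ≤ ENNReal.ofReal δ') :
    frechetDist γ ζ ≤ ENNReal.ofReal (δ + δ') := by
  refine ENNReal.le_of_forall_pos_le_add fun ρ hρ _ => ?_
  have hρ' : (0 : ℝ) < ρ / 2 := by positivity
  obtain ⟨φ, hφ, h1⟩ := exists_map_of_frechetDist_le hη hδ hρ' h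
  obtain ⟨ψ, hψ, h2⟩ := exists_map_of_frechetDist_le hζ hδ' hρ' h'
  have h3 : frechetDist γ ζ ≤ ENNReal.ofReal (δ + δ' + ρ) := by
    refine frechetDist_le_of_maps (f := fun u => φ (ψ u)) (g := id)
      ⟨hφ.1.comp hψ.1, hφ.2.comp hψ.2⟩ ⟨monotone_id, Function.surjective_id⟩ fun u => ?_
    calc _ ≤ dist (γ (φ (ψ u))) (η (ψ u)) + dist (η (ψ u)) (ζ u) := dist_triangle _ _ _
      _ ≤ _ := by linarith [h1 (ψ u), h2 u]
  rw [ENNReal.ofReal_add (by positivity) (by positivity)] at h3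
  simpa using h3

theorem exists_reparam {X : unitInterval → unitInterval} (hc : Continuous X) (hm : Monotone X) :
    ∃ f : unitInterval → unitInterval, (Monotone f ∧ Function.Surjective f) ∧
      ∀ u, intervalPoint (X 0) (X 1) (f u) = X u := by
  have hb : ∀ u, (X 0 : ℝ) ≤ X u ∧ (X u : ℝ) ≤ X 1 := fun u => ⟨hm unitInterval.nonneg', hm unitInterval.le_one'⟩
  rcases eq_or_lt_of_le (hm (zero_le_one : (0 : unitInterval) ≤ 1)) with h | h
  · refine ⟨id, ⟨monotone_id, Function.surjective_id⟩, fun u => ?_⟩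
    have h' : (X 0 : ℝ) = X 1 := by rw [h]
    ext
    rw [coe_intervalPoint, h']
    have := hb u
    linarith
  · have h' : (X 0 : ℝ) < X 1 := h
    have hne : (X 1 : ℝ) - X 0 ≠ 0 := by linarith
    let f : unitInterval → unitInterval := fun u => ⟨((X u : ℝ) - X 0) / (X 1 - X 0),
      div_nonneg (by linarith [hb u]) (by linarith),
      (div_le_one (by linarith)).2 (by linarith [hb u])⟩
    refine ⟨f, ⟨fun u v huv => ?_, surjective_of_continuous_of_endpoints ?_ ?_ ?_⟩, fun u => ?_⟩
    · have : (X u : ℝ) ≤ X v := hm huv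
      change ((X u : ℝ) - X 0) / (X 1 - X 0) ≤ ((X v : ℝ) - X 0) / (X 1 - X 0)
      gcongr
    · refine Continuous.subtype_mk ?_ _
      fun_prop
    · ext; simp [f]
    · ext; simp [f, hne]
    · ext
      rw [coe_intervalPoint]
      simp only [f]
      field_simp
      ring

/-- Passes from monotone paths in the free space to the Fréchet distance: `exists_reparam` rescales
the range of each path to `[0,1]`, and a constant path needs no rescaling. -/
theorem frechetDist_subcurve_le {d : ℕ} {γ η : Curve d} {X Y : unitInterval → unitInterval}
    (hX : Continuous X) (hX' : Monotone X) (hY : Continuous Y) (hY' : Monotone Y) {δ : ℝ}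
    (h : ∀ u, dist (γ (X u)) (η (Y u)) ≤ δ) :
    frechetDist (subcurve γ (X 0) (X 1)) (subcurve η (Y 0) (Y 1)) ≤ ENNReal.ofReal δ := by
  obtain ⟨f, hf, hfX⟩ := exists_reparam hX hX'
  obtain ⟨g, hg, hgY⟩ := exists_reparam hY hY'
  refine frechetDist_le_of_maps hf hg fun u => ?_
  rw [subcurve_apply, subcurve_apply, hfX, hgY]
  exact h u

/-! ### Coverage -/

theorem coverage_mono {d : ℕ} (P : Curve d) {Q Q' : Set (Curve d)} (hQ : Q ⊆ Q') {δ δ' : ℝ}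
    (h : δ ≤ δ') : coverage P Q δ ⊆ coverage P Q' δ' := by
  rintro x ⟨q, hq, s, t, hst, hd, hx⟩
  exact ⟨q, hQ hq, s, t, hst, hd.trans (ENNReal.ofReal_le_ofReal h), hx⟩

theorem coverage_subset_Icc {d : ℕ} (P : Curve d) (Q : Set (Curve d)) (δ : ℝ) :
    coverage P Q δ ⊆ Icc 0 1 := by
  rintro x ⟨q, -, s, t, -, -, hx⟩
  exact ⟨s.2.1.trans hx.1, hx.2.trans t.2.2⟩

/-- Since the Fréchet distance is attained on normalized maps, the coverage is a projection of the
compact set of tuples (point, subcurve endpoints, two normalized maps). -/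
theorem isClosed_coverage {d : ℕ} {P q : Curve d} (hP : Continuous P) (hq : Continuous q)
    {δ : ℝ} (hδ : 0 ≤ δ) : IsClosed (coverage P {q} δ) := by
  let C : Set (unitInterval × unitInterval × unitInterval × (unitInterval → unitInterval) ×
      (unitInterval → unitInterval)) := {p | p.2.1 ≤ p.1 ∧ p.1 ≤ p.2.2.1 ∧ p.2.2.2.1 ∈ normalizedMaps ∧
    p.2.2.2.2 ∈ normalizedMaps ∧
    ∀ u, dist (P (intervalPoint p.2.1 p.2.2.1 (p.2.2.2.1 u))) (q (p.2.2.2.2 u)) ≤ δ}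
  have hC : IsClosed C := by
    refine (isClosed_le (by fun_prop) (by fun_prop)).inter
      ((isClosed_le (by fun_prop) (by fun_prop)).inter
      ((isClosed_normalizedMaps.preimage (by fun_prop)).inter
      ((isClosed_normalizedMaps.preimage (by fun_prop)).inter ?_)))
    change IsClosed {p : unitInterval × unitInterval × unitInterval ×
      (unitInterval → unitInterval) × (unitInterval → unitInterval) | ∀ u, dist (P (intervalPoint p.2.1 p.2.2.1 (p.2.2.2.1 u))) (q (p.2.2.2.2 u)) ≤ δ}
    rw [ofPred_forall]
    refine isClosed_iInter fun u => isClosed_le (Continuous.dist ?_ ?_) continuous_const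
    · refine hP.comp (continuous_intervalPoint.comp
        (f := fun p : _ × _ × _ × (unitInterval → unitInterval) × (unitInterval → unitInterval) =>
          (p.2.1, p.2.2.1, p.2.2.2.1 u)) ?_)
      have : Continuous fun p : unitInterval × unitInterval × unitInterval ×
          (unitInterval → unitInterval) × (unitInterval → unitInterval) => p.2.2.2.1 u :=
        (continuous_apply u).comp (by fun_prop)
      fun_prop
    · exact hq.comp ((continuous_apply u).comp (by fun_prop))
  have himg : coverage P {q} δ = (fun p => (p.1 : ℝ)) '' C := by
    ext x
    constructor
    · rintro ⟨_, rfl, s, t, hst, hd, hx⟩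
      obtain ⟨F, hF, G, hG, h⟩ := (frechetDist_le_iff (Continuous.subcurve hP s t) hq hδ).1 hd
      exact ⟨(⟨x, s.2.1.trans hx.1, hx.2.trans t.2.2⟩, s, t, F, G), ⟨hx.1, hx.2, hF, hG, h⟩, rfl⟩
    · rintro ⟨⟨x, s, t, F, G⟩, ⟨h1, h2, hF, hG, h⟩, rfl⟩
      exact ⟨q, rfl, s, t, h1.trans h2,
        (frechetDist_le_iff (Continuous.subcurve hP s t) hq hδ).2 ⟨F, hF, G, hG, h⟩, h1, h2⟩
  rw [himg]
  exact (hC.isCompact.image (by fun_prop)).isClosed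

/-! ### Cell regions -/

section CellRegion

variable {d : ℕ} {P : PolygonalCurve d} {A : Set (ℝ × ℝ)} {i : Fin P.numEdges} {x y s t : ℝ}

theorem cellRegion_subset_cell : cellRegion P A i ⊆ P.cell i := by
  refine closure_minimal (inter_subset_right.trans ?_) (isClosed_Icc.prod isClosed_Icc)
  exact prod_mono Ioo_subset_Icc_self Ioo_subset_Icc_self

theorem isCompact_cellRegion : IsCompact (cellRegion P A i) :=
  (isCompact_Icc.prod isCompact_Icc).of_isClosed_subset isClosed_closure cellRegion_subset_cell

theorem cellRegion_subset_closure : cellRegion P A i ⊆ closure A := closure_mono inter_subset_left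

theorem time_le_of_mem (h : (x, y) ∈ cellRegion P A i) : (P.time i.castSucc : ℝ) ≤ x :=
  (cellRegion_subset_cell h).1.1

theorem le_time_of_mem (h : (x, y) ∈ cellRegion P A i) : x ≤ (P.time i.succ : ℝ) :=
  (cellRegion_subset_cell h).1.2

theorem time_succ_le_time {i j : Fin P.numEdges} (h : i < j) :
    (P.time i.succ : ℝ) ≤ P.time j.castSucc :=
  P.time_strictMono.monotone (Fin.succ_le_castSucc_iff.2 h)

theorem isCompact_slice (y : ℝ) : IsCompact {x | (x, y) ∈ cellRegion P A i} := by
  have h : IsClosed {x | (x, y) ∈ cellRegion P A i} :=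
    isCompact_cellRegion.isClosed.preimage (f := fun x => (x, y)) (by fun_prop)
  exact (isCompact_Icc (a := (P.time i.castSucc : ℝ)) (b := P.time i.succ)).of_isClosed_subset h
    fun x hx => (cellRegion_subset_cell hx).1

theorem leftEnd_mem (h : Meets P A i y) : (leftEnd P A i y, y) ∈ cellRegion P A i :=
  (isCompact_slice y).sInf_mem h

theorem rightEnd_mem (h : Meets P A i y) : (rightEnd P A i y, y) ∈ cellRegion P A i :=
  (isCompact_slice y).sSup_mem h

theorem leftEnd_le (h : (x, y) ∈ cellRegion P A i) : leftEnd P A i y ≤ x :=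
  csInf_le (isCompact_slice y).bddBelow h

theorem le_rightEnd (h : (x, y) ∈ cellRegion P A i) : x ≤ rightEnd P A i y :=
  le_csSup (isCompact_slice y).bddAbove h

theorem leftEnd_le_rightEnd (h : Meets P A i y) : leftEnd P A i y ≤ rightEnd P A i y :=
  leftEnd_le (rightEnd_mem h)

theorem exists_topmost {K : Set (ℝ × ℝ)} (hK : IsCompact K) (hne : K.Nonempty) :
    ∃ p, p ∈ topmost K := by
  obtain ⟨p, hp, h⟩ := hK.exists_isMaxOn hne continuous_snd.continuousOn
  exact ⟨p, hp, fun q hq => h hq⟩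

theorem exists_bottommost {K : Set (ℝ × ℝ)} (hK : IsCompact K) (hne : K.Nonempty) :
    ∃ p, p ∈ bottommost K := by
  obtain ⟨p, hp, h⟩ := hK.exists_isMinOn hne continuous_snd.continuousOn
  exact ⟨p, hp, fun q hq => h hq⟩

/-- A segment in a convex planar set crosses every intermediate height. -/
theorem exists_mem_height {K : Set (ℝ × ℝ)} (hK : Convex ℝ K) {p q : ℝ × ℝ} (hp : p ∈ K)
    (hq : q ∈ K) (h1 : p.2 ≤ y) (h2 : y ≤ q.2) : ∃ x ∈ uIcc p.1 q.1, (x, y) ∈ K := by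
  rcases eq_or_lt_of_le (h1.trans h2) with h | h
  · refine ⟨p.1, left_mem_uIcc, ?_⟩
    have : p.2 = y := le_antisymm h1 (h ▸ h2)
    rw [← this]
    exact hp
  · have hpos : 0 < q.2 - p.2 := by linarith
    set a : ℝ := (y - p.2) / (q.2 - p.2)
    have ha0 : 0 ≤ a := div_nonneg (by linarith) hpos.le
    have ha1 : a ≤ 1 := (div_le_one hpos).2 (by linarith)
    have hay : a * (q.2 - p.2) = y - p.2 := div_mul_cancel₀ _ hpos.ne'
    have hmem := hK hp hq (show 0 ≤ 1 - a by linarith) ha0 (by ring)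
    refine ⟨(1 - a) * p.1 + a * q.1, ?_, ?_⟩
    · rw [← segment_eq_uIcc]
      exact ⟨1 - a, a, by linarith, ha0, by ring, by simp⟩
    · convert hmem using 1
      ext
      · simp
      · simp only [Prod.snd_add, Prod.smul_snd, smul_eq_mul]
        linarith

/-- If `r_i(t) < l_i(s)`, then `i` is bad. A top-most point to the right of `r_i(t)` would span with
`(l_i(s), s)` a segment crossing height `t` to the right of `r_i(t)`; bottom-most points are handled
symmetrically at height `s`. -/
theorem leftEnd_le_rightEnd_of_not_isBad (hconv : Convex ℝ (cellRegion P A i)) (hst : s ≤ t)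
    (hs : Meets P A i s) (ht : Meets P A i t) (hgood : ¬ IsBad P A s t i) :
    leftEnd P A i s ≤ rightEnd P A i t := by
  by_contra! hlt
  refine hgood ⟨hs, ht, fun p hp => ?_, fun p hp => ?_⟩
  · have hpt : p.1 ≤ rightEnd P A i t := by
      by_contra! hp'
      obtain ⟨x, hx, hxK⟩ := exists_mem_height hconv (leftEnd_mem hs) hp.1 hst
        (hp.2 _ (leftEnd_mem ht))
      have := le_rightEnd hxK
      have := hx.1
      have := lt_min hlt hp'
      simp only at *
      linarith
    exact ⟨by linarith, hpt⟩
  · have hps : leftEnd P A i s ≤ p.1 := by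
      by_contra! hp'
      obtain ⟨x, hx, hxK⟩ := exists_mem_height hconv hp.1 (rightEnd_mem ht)
        (hp.2 _ (leftEnd_mem hs)) hst
      have := leftEnd_le hxK
      have := hx.2
      have := max_lt hp' hlt
      simp only at *
      linarith
    exact ⟨hps, by linarith⟩

/-- The segment from `(l_i(s), s)` to a top-most point leads to the left and crosses height `t`.
Together with the analogous bound for right ends, this puts `[l_i(s), r_i(t)]` inside `[l_i(t),
r_i(s)]`, the interval belonging to the reversal. -/
theorem IsBad.leftEnd_le (h : IsBad P A s t i) (hconv : Convex ℝ (cellRegion P A i))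
    (hst : s ≤ t) : leftEnd P A i t ≤ leftEnd P A i s := by
  obtain ⟨T, hT⟩ := exists_topmost isCompact_cellRegion ⟨_, leftEnd_mem h.1⟩
  obtain ⟨x, hx, hxK⟩ := exists_mem_height hconv (leftEnd_mem h.1) hT.1 hst
    (hT.2 _ (leftEnd_mem h.2.1))
  exact (SubtrajectoryCoverage.leftEnd_le hxK).trans
    (hx.2.trans (max_le le_rfl (h.2.2.1 T hT).1))

theorem IsBad.rightEnd_le (h : IsBad P A s t i) (hconv : Convex ℝ (cellRegion P A i))
    (hst : s ≤ t) : rightEnd P A i t ≤ rightEnd P A i s := by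
  obtain ⟨B, hB⟩ := exists_bottommost isCompact_cellRegion ⟨_, leftEnd_mem h.1⟩
  obtain ⟨x, hx, hxK⟩ := exists_mem_height hconv hB.1 (rightEnd_mem h.2.1)
    (hB.2 _ (leftEnd_mem h.1)) hst
  exact ((le_min (h.2.2.2 B hB).2 le_rfl).trans hx.1).trans (le_rightEnd hxK)

end CellRegion

/-! ### Mirroring -/

section Mirror

variable {d : ℕ} {P : PolygonalCurve d} {A : Set (ℝ × ℝ)} {i : Fin P.numEdges} {x y s t : ℝ}

theorem mirror_mirror : mirror (mirror A) = A := by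
  ext ⟨x, y⟩
  simp [mirror]

/-- The reflection of the plane that mirrors free spaces. -/
def mirrorHomeomorph : (ℝ × ℝ) ≃ₜ (ℝ × ℝ) where
  toFun p := (p.1, 1 - p.2)
  invFun p := (p.1, 1 - p.2)
  left_inv p := by simp
  right_inv p := by simp
  continuous_toFun := by fun_prop
  continuous_invFun := by fun_prop

theorem mirror_eq_preimage : mirror A = mirrorHomeomorph ⁻¹' A := rfl

theorem cellRegion_mirror : cellRegion P (mirror A) i = mirror (cellRegion P A i) := by
  unfold cellRegion
  rw [mirror_eq_preimage, mirror_eq_preimage, mirrorHomeomorph.preimage_closure, preimage_inter]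
  congr 2
  ext ⟨x, y⟩
  change (x, y) ∈ P.cellInterior i ↔ (x, 1 - y) ∈ P.cellInterior i
  simp only [PolygonalCurve.cellInterior, mem_prod, mem_Ioo]
  constructor <;> rintro ⟨h, h1, h2⟩ <;> exact ⟨h, by linarith, by linarith⟩

theorem mem_cellRegion_mirror :
    (x, y) ∈ cellRegion P (mirror A) i ↔ (x, 1 - y) ∈ cellRegion P A i := by
  rw [cellRegion_mirror]
  rfl

theorem closure_mirror : closure (mirror A) = mirror (closure A) := by
  rw [mirror_eq_preimage, mirror_eq_preimage, mirrorHomeomorph.preimage_closure]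

theorem convex_mirror {K : Set (ℝ × ℝ)} (hK : Convex ℝ K) : Convex ℝ (mirror K) := by
  intro p hp q hq a b ha hb hab
  have := hK hp hq ha hb hab
  change (_, _) ∈ K
  convert this using 1
  ext
  · simp
  · simp only [Prod.snd_add, Prod.smul_snd, smul_eq_mul]
    linear_combination (-1 : ℝ) * hab

theorem meets_mirror : Meets P (mirror A) i (1 - y) ↔ Meets P A i y := by
  simp only [Meets, mem_cellRegion_mirror, sub_sub_cancel]

theorem leftEnd_mirror : leftEnd P (mirror A) i (1 - y) = leftEnd P A i y := by
  simp only [leftEnd, mem_cellRegion_mirror, sub_sub_cancel]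

theorem rightEnd_mirror : rightEnd P (mirror A) i (1 - y) = rightEnd P A i y := by
  simp only [rightEnd, mem_cellRegion_mirror, sub_sub_cancel]

theorem mirror_mem_topmost {K : Set (ℝ × ℝ)} {p : ℝ × ℝ} (h : p ∈ bottommost K) :
    (p.1, 1 - p.2) ∈ topmost (mirror K) := by
  refine ⟨by simpa [mirror] using h.1, fun q hq => ?_⟩
  have := h.2 _ hq
  simp only at *
  linarith

theorem mirror_mem_bottommost {K : Set (ℝ × ℝ)} {p : ℝ × ℝ} (h : p ∈ topmost K) :
    (p.1, 1 - p.2) ∈ bottommost (mirror K) := by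
  refine ⟨by simpa [mirror] using h.1, fun q hq => ?_⟩
  have := h.2 _ hq
  simp only at *
  linarith

/-- An index that is bad in both directions contributes at most one point. -/
theorem IsBad.eq_leftEnd_of_mirror (h : IsBad P A s t i)
    (h' : IsBad P (mirror A) (1 - t) (1 - s) i)
    (hx : x ∈ Icc (leftEnd P A i t) (rightEnd P A i s)) : x = leftEnd P A i s := by
  obtain ⟨T, hT⟩ := exists_topmost isCompact_cellRegion ⟨_, leftEnd_mem h.1⟩
  obtain ⟨B, hB⟩ := exists_bottommost isCompact_cellRegion ⟨_, leftEnd_mem h.1⟩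
  have h1 := h.2.2.1 T hT
  have h2 := h.2.2.2 B hB
  have h3 := h'.2.2.1 (B.1, 1 - B.2) (cellRegion_mirror ▸ mirror_mem_topmost hB)
  have h4 := h'.2.2.2 (T.1, 1 - T.2) (cellRegion_mirror ▸ mirror_mem_bottommost hT)
  rw [leftEnd_mirror, rightEnd_mirror] at h3 h4
  -- The inequalities close up to a cycle: `B.1 ≤ l_i(t) ≤ x ≤ r_i(s) ≤ T.1 ≤ l_i(s) ≤ B.1`.
  obtain ⟨hx1, hx2⟩ := hx
  simp only at *
  linarith [h1.1, h2.1, h3.1, h4.2]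

end Mirror

/-! ### Reachability between cells -/

section Reach

variable {d : ℕ} {P : PolygonalCurve d} {A : Set (ℝ × ℝ)} {s t : ℝ}

/-- The union of the intervals `[l_i(s), r_j(t)]` over all index pairs connected by a monotone
path. -/
def reachRegion {d : ℕ} (P : PolygonalCurve d) (A : Set (ℝ × ℝ)) (s t : ℝ) : Set ℝ :=
  ⋃ ij ∈ {ij | Reaches P A s t ij}, Icc (leftEnd P A ij.1 s) (rightEnd P A ij.2 t)

theorem mem_reachRegion {x : ℝ} : x ∈ reachRegion P A s t ↔ ∃ ij, Reaches P A s t ij ∧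
    x ∈ Icc (leftEnd P A ij.1 s) (rightEnd P A ij.2 t) := by
  simp only [reachRegion, mem_iUnion₂, mem_ofPred_eq, exists_prop]

theorem MonotonePath.le {p q : ℝ × ℝ} (h : MonotonePath A p q) : p ≤ q := by
  obtain ⟨γ, -, hm, rfl, rfl, -⟩ := h
  exact hm zero_le_one

theorem monotonePath_of_convex {K : Set (ℝ × ℝ)} (hK : Convex ℝ K) {p q : ℝ × ℝ} (hp : p ∈ K)
    (hq : q ∈ K) (hpq : p ≤ q) : MonotonePath K p q := by
  refine ⟨fun u => AffineMap.lineMap p q (u : ℝ), ?_, ?_, by simp, by simp, fun u => ?_⟩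
  · exact AffineMap.lineMap_continuous.comp continuous_subtype_val
  · intro u v huv
    have h : (u : ℝ) ≤ v := huv
    have h1 : p.1 ≤ q.1 := hpq.1
    have h2 : p.2 ≤ q.2 := hpq.2
    constructor <;> simp only [AffineMap.lineMap_apply, vsub_eq_sub, vadd_eq_add, smul_eq_mul,
      Prod.fst_add, Prod.snd_add, Prod.smul_fst, Prod.smul_snd, Prod.fst_sub, Prod.snd_sub] <;>
      nlinarith
  · exact hK.segment_subset hp hq (segment_eq_image_lineMap ℝ p q ▸ mem_image_of_mem _ u.2)

theorem MonotonePath.mono {B : Set (ℝ × ℝ)} (hAB : A ⊆ B) {p q : ℝ × ℝ}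
    (h : MonotonePath A p q) : MonotonePath B p q := by
  obtain ⟨γ, h1, h2, h3, h4, h5⟩ := h
  exact ⟨γ, h1, h2, h3, h4, fun u => hAB (h5 u)⟩

theorem Reaches.meets_left {ij : Fin P.numEdges × Fin P.numEdges} (h : Reaches P A s t ij) :
    Meets P A ij.1 s := by
  obtain ⟨x, x', h1, -, -⟩ := h
  exact ⟨x, h1⟩

theorem Reaches.meets_right {ij : Fin P.numEdges × Fin P.numEdges} (h : Reaches P A s t ij) :
    Meets P A ij.2 t := by
  obtain ⟨x, x', -, h1, -⟩ := h
  exact ⟨x', h1⟩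

theorem Reaches.leftEnd_le_rightEnd {ij : Fin P.numEdges × Fin P.numEdges}
    (h : Reaches P A s t ij) : leftEnd P A ij.1 s ≤ rightEnd P A ij.2 t := by
  obtain ⟨x, x', h1, h2, h3⟩ := h
  exact (leftEnd_le h1).trans (h3.le.1.trans (le_rightEnd h2))

theorem reaches_self {i : Fin P.numEdges} (hconv : Convex ℝ (cellRegion P A i)) (hst : s ≤ t)
    (hs : Meets P A i s) (ht : Meets P A i t) (h : leftEnd P A i s ≤ rightEnd P A i t) :
    Reaches P A s t (i, i) :=
  ⟨_, _, leftEnd_mem hs, rightEnd_mem ht, (monotonePath_of_convex hconv (leftEnd_mem hs)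
    (rightEnd_mem ht) ⟨h, hst⟩).mono cellRegion_subset_closure⟩

/-- A monotone path can be extended horizontally at both ends. -/
theorem Reaches.monotonePath {ij : Fin P.numEdges × Fin P.numEdges}
    (hconv : ∀ i, Convex ℝ (cellRegion P A i)) (h : Reaches P A s t ij) :
    MonotonePath (closure A) (leftEnd P A ij.1 s, s) (rightEnd P A ij.2 t, t) := by
  have hl := leftEnd_mem h.meets_left
  have hr := rightEnd_mem h.meets_right
  obtain ⟨x, x', h1, h2, γ, hγc, hγm, hγ0, hγ1, hγA⟩ := h
  have hlx := leftEnd_le h1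
  have hrx := le_rightEnd h2
  set l := leftEnd P A ij.1 s
  set r := rightEnd P A ij.2 t
  let pr : ℝ → unitInterval := projIcc (0 : ℝ) 1 zero_le_one
  have hprc : Continuous pr := continuous_projIcc
  have hprm : Monotone pr := monotone_projIcc _
  have hpr0 : ∀ z ≤ 0, pr z = 0 := fun z hz => projIcc_of_le_left _ hz
  have hpr1 : ∀ z ≥ 1, pr z = 1 := fun z hz => projIcc_of_right_le _ hz
  -- Clamped clocks for the three thirds of the time: `a` runs the horizontal move from `l` to `x`,
  -- `b` runs `γ`, and `c` runs the move from `x'` to `r`. With them the concatenation is a single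
  -- continuous formula.
  let a : unitInterval → unitInterval := fun w => pr (3 * w)
  let b : unitInterval → unitInterval := fun w => pr (3 * w - 1)
  let c : unitInterval → unitInterval := fun w => pr (3 * w - 2)
  have hac : Continuous a := hprc.comp (by fun_prop)
  have hbc : Continuous b := hprc.comp (by fun_prop)
  have hcc : Continuous c := hprc.comp (by fun_prop)
  have ha : Monotone a := fun u v huv => hprm (by have : (u : ℝ) ≤ v := huv; linarith)
  have hb : Monotone b := fun u v huv => hprm (by have : (u : ℝ) ≤ v := huv; linarith)
  have hc : Monotone c := fun u v huv => hprm (by have : (u : ℝ) ≤ v := huv; linarith)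
  have hseg : ∀ (i : Fin P.numEdges) (x₁ x₂ y : ℝ) (u : unitInterval),
      (x₁, y) ∈ cellRegion P A i → (x₂, y) ∈ cellRegion P A i →
      (x₁ + u * (x₂ - x₁), y) ∈ closure A := by
    intro i x₁ x₂ y u m1 m2
    have := hconv i m1 m2 (show 0 ≤ 1 - (u : ℝ) by linarith [u.2.2]) u.2.1 (by ring)
    refine cellRegion_subset_closure (i := i) ?_
    convert this using 1
    ext
    · simp only [Prod.fst_add, Prod.smul_fst, smul_eq_mul]; ring
    · simp only [Prod.snd_add, Prod.smul_snd, smul_eq_mul]; ring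
  refine ⟨fun w => (l + a w * (x - l) + ((γ (b w)).1 - x) + c w * (r - x'), (γ (b w)).2),
    by fun_prop, fun u v huv => ?_, ?_, ?_, fun w => ?_⟩
  · have h1 : (a u : ℝ) ≤ a v := ha huv
    have h2 : γ (b u) ≤ γ (b v) := hγm (hb huv)
    have h3 : (c u : ℝ) ≤ c v := hc huv
    have h4 := h2.1
    refine ⟨?_, h2.2⟩
    simp only
    nlinarith
  · have e1 : a 0 = 0 := hpr0 _ (by simp)
    have e2 : b 0 = 0 := hpr0 _ (by simp)
    have e3 : c 0 = 0 := hpr0 _ (by simp)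
    simp [e1, e2, e3, hγ0]
  · have e1 : a 1 = 1 := hpr1 _ (by norm_num)
    have e2 : b 1 = 1 := hpr1 _ (by norm_num)
    have e3 : c 1 = 1 := hpr1 _ (by norm_num)
    simp [e1, e2, e3, hγ1]
  · rcases le_total (3 * (w : ℝ)) 1 with hw | hw
    · have e2 : b w = 0 := hpr0 _ (by linarith)
      have e3 : c w = 0 := hpr0 _ (by linarith)
      simpa [e2, e3, hγ0] using hseg _ _ _ _ (a w) hl h1
    · have e1 : a w = 1 := hpr1 _ hw
      rcases le_total (3 * (w : ℝ)) 2 with hw' | hw'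
      · have e3 : c w = 0 := hpr0 _ (by linarith)
        simpa [e1, e3] using hγA (b w)
      · have e2 : b w = 1 := hpr1 _ (by linarith)
        simpa [e1, e2, hγ1] using hseg _ _ _ _ (c w) h2 hr

/-! ### The reach region contains the proxy coverage -/

theorem subedgeProxy_subset_reachRegion (hconv : ∀ i, Convex ℝ (cellRegion P A i))
    (hst : s ≤ t) : subedgeProxy P A s t ⊆ reachRegion P A s t := by
  let J : Fin P.numEdges × Fin P.numEdges → Set ℝ := fun p =>
    Icc (leftEnd P A p.1 s) (rightEnd P A p.2 t)
  have hJ : ∀ p, Reaches P A s t p → J p ⊆ reachRegion P A s t := fun p hp x hx =>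
    mem_reachRegion.2 ⟨p, hp, hx⟩
  have hJc : ∀ p, ∀ x ∈ J p, ∀ y ∈ J p, uIcc x y ⊆ J p := fun p x hx y hy =>
    ordConnected_Icc.uIcc_subset hx hy
  -- Merging joins only overlapping intervals: crossing pairs overlap because cells are ordered
  -- along `P`, and pairs sharing a good index `b` because `l_b(s) ≤ r_b(t)`. Hence the hull of a
  -- merged class stays in the reach region.
  have hmerge : ∀ p q, Mergeable P A s t p q → (J p ∩ J q).Nonempty := by
    rintro p q ⟨hp, hq, h | ⟨h, hgood⟩⟩
    · refine ⟨leftEnd P A q.1 s, ⟨?_, ?_⟩, le_rfl, hq.1.1.leftEnd_le_rightEnd⟩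
      · exact (le_time_of_mem (leftEnd_mem hp.1.1.meets_left)).trans ((time_succ_le_time h.1).trans
          (time_le_of_mem (leftEnd_mem hq.1.1.meets_left)))
      · exact (le_time_of_mem (leftEnd_mem hq.1.1.meets_left)).trans
          ((time_succ_le_time h.2.1).trans (time_le_of_mem (rightEnd_mem hp.1.1.meets_right)))
    · refine ⟨leftEnd P A q.1 s, ⟨?_, ?_⟩, le_rfl, hq.1.1.leftEnd_le_rightEnd⟩
      · rw [← h]
        exact (le_time_of_mem (leftEnd_mem hp.1.1.meets_left)).trans ((time_succ_le_time hp.2).trans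
          (time_le_of_mem (leftEnd_mem (h ▸ hq.1.1.meets_left))))
      · rw [← h]
        exact leftEnd_le_rightEnd_of_not_isBad (hconv _) hst (h ▸ hq.1.1.meets_left)
          hp.1.1.meets_right hgood
  have hclass : ∀ p q, Relation.EqvGen (Mergeable P A s t) p q → p = q ∨
      (p ∈ globalGroup P A s t ∧ q ∈ globalGroup P A s t ∧
        ∀ x ∈ J p, ∀ y ∈ J q, uIcc x y ⊆ reachRegion P A s t) := by
    intro p q h
    induction h with
    | rel p q h =>
      refine Or.inr ⟨h.1, h.2.1, fun x hx y hy => ?_⟩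
      obtain ⟨z, hzp, hzq⟩ := hmerge p q h
      exact uIcc_subset_uIcc_union_uIcc.trans (union_subset
        ((hJc p x hx z hzp).trans (hJ p h.1.1.1)) ((hJc q z hzq y hy).trans (hJ q h.2.1.1.1)))
    | refl p => exact Or.inl rfl
    | symm p q _ ih =>
      rcases ih with rfl | ⟨h1, h2, h3⟩
      · exact Or.inl rfl
      · exact Or.inr ⟨h2, h1, fun x hx y hy => uIcc_comm y x ▸ h3 y hy x hx⟩
    | trans p q r _ _ ih1 ih2 =>
      rcases ih1 with rfl | ⟨h1, h2, h3⟩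
      · exact ih2
      rcases ih2 with rfl | ⟨h4, h5, h6⟩
      · exact Or.inr ⟨h1, h2, h3⟩
      refine Or.inr ⟨h1, h5, fun x hx y hy => ?_⟩
      have hz : leftEnd P A q.1 s ∈ J q := ⟨le_rfl, h2.1.1.leftEnd_le_rightEnd⟩
      exact uIcc_subset_uIcc_union_uIcc.trans (union_subset (h3 x hx _ hz) (h6 _ hz y hy))
  refine union_subset ?_ ?_
  · refine iUnion₂_subset fun i hi => ?_
    exact hJ (i, i) hi.1.1
  · rintro x hx
    obtain ⟨ab, ⟨p, hp, q, hq, hpq, rfl, -⟩, hx1, hx2⟩ := mem_iUnion₂.1 hx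
    have hl : leftEnd P A p.1 s ≤ x := by
      refine le_trans ?_ hx1
      unfold proxyLeft
      split_ifs
      · exact SubtrajectoryCoverage.leftEnd_le_rightEnd hp.1.1.meets_left
      · exact le_rfl
    have hr : x ≤ rightEnd P A q.2 t := by
      refine hx2.trans ?_
      unfold proxyRight
      split_ifs
      · exact SubtrajectoryCoverage.leftEnd_le_rightEnd hq.1.1.meets_right
      · exact le_rfl
    rcases hclass p q hpq with rfl | ⟨-, -, h⟩
    · exact hJ p hp.1.1 ⟨hl, hr⟩
    · exact h _ ⟨le_rfl, hp.1.1.leftEnd_le_rightEnd⟩ _ ⟨hq.1.1.leftEnd_le_rightEnd, le_rfl⟩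
        (Icc_subset_uIcc ⟨hl, hr⟩)

/-! ### The proxy coverage contains the reach region -/

/-- There are finitely many index pairs, so each one lies below a maximal one; inclusion becomes a
product order once the second index is dualised. -/
theorem exists_mem_combinatorialRep {ij : Fin P.numEdges × Fin P.numEdges}
    (h : Reaches P A s t ij) :
    ∃ ab ∈ combinatorialRep P A s t, ab.1 ≤ ij.1 ∧ ij.2 ≤ ab.2 := by
  obtain ⟨⟨a, b⟩, ⟨hab, h1, h2⟩, hmax⟩ :=
    ({p | Reaches P A s t p ∧ p.1 ≤ ij.1 ∧ ij.2 ≤ p.2} : Set _).toFinite.exists_minimalFor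
    (fun p => (p.1, OrderDual.toDual p.2)) _ ⟨ij, h, le_rfl, le_rfl⟩
  refine ⟨(a, b), ⟨hab, fun q hq hq1 hq2 => ?_⟩, h1, h2⟩
  have := hmax ⟨hq, hq1.trans h1, h2.trans hq2⟩ ⟨hq1, hq2⟩
  exact Prod.ext (le_antisymm hq1 this.1) (le_antisymm this.2 hq2)

theorem proxyLeft_mem {i : Fin P.numEdges} (h : Meets P A i s) :
    (proxyLeft P A s t i, s) ∈ cellRegion P A i := by
  unfold proxyLeft
  split_ifs
  · exact rightEnd_mem h
  · exact leftEnd_mem h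

theorem proxyRight_mem {i : Fin P.numEdges} (h : Meets P A i t) :
    (proxyRight P A s t i, t) ∈ cellRegion P A i := by
  unfold proxyRight
  split_ifs
  · exact leftEnd_mem h
  · exact rightEnd_mem h

theorem mem_globalGroup_of_eqvGen {p q : Fin P.numEdges × Fin P.numEdges}
    (hp : p ∈ globalGroup P A s t) (h : Relation.EqvGen (Mergeable P A s t) p q) :
    q ∈ globalGroup P A s t := by
  have : ∀ p q, Relation.EqvGen (Mergeable P A s t) p q →
      (p ∈ globalGroup P A s t ↔ q ∈ globalGroup P A s t) := by
    intro p q h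
    induction h with
    | rel p q h => exact ⟨fun _ => h.2.1, fun _ => h.1⟩
    | refl p => rfl
    | symm p q _ ih => exact ih.symm
    | trans p q r _ _ ih1 ih2 => exact ih1.trans ih2
  exact (this p q h).1 hp

/-- The merged pair of the class of `p` has the extreme indices of that class. Either an extreme
index agrees with that of `p`, or its whole cell lies further out, so the endpoint can only move
outwards, whether the index is good or bad. -/
theorem Icc_proxy_subset_of_mem_globalGroup {p : Fin P.numEdges × Fin P.numEdges}
    (hp : p ∈ globalGroup P A s t) :
    Icc (proxyLeft P A s t p.1) (proxyRight P A s t p.2) ⊆ subedgeProxy P A s t := by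
  have hfin : ({r | Relation.EqvGen (Mergeable P A s t) p r} : Set _).Finite := toFinite _
  obtain ⟨a, ha, hamin⟩ := exists_min_image _ (fun r => r.1) hfin ⟨p, .refl p⟩
  obtain ⟨b, hb, hbmax⟩ := exists_max_image _ (fun r => r.2) hfin ⟨p, .refl p⟩
  have hag := mem_globalGroup_of_eqvGen hp ha
  have hbg := mem_globalGroup_of_eqvGen hp hb
  have hred : (a.1, b.2) ∈ reducedGlobalGroup P A s t :=
    ⟨a, hag, b, hbg, (ha.symm).trans _ _ _ hb, rfl, fun r hr =>
      ⟨hamin r (ha.trans _ _ _ hr), hbmax r (ha.trans _ _ _ hr)⟩⟩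
  refine fun x hx => Or.inr (mem_iUnion₂.2 ⟨_, hred, ?_, ?_⟩)
  · refine le_trans ?_ hx.1
    rcases eq_or_lt_of_le (hamin p (.refl p)) with h | h
    · rw [h]
    · exact (le_time_of_mem (proxyLeft_mem hag.1.1.meets_left)).trans
        ((time_succ_le_time h).trans (time_le_of_mem (proxyLeft_mem hp.1.1.meets_left)))
  · refine hx.2.trans ?_
    rcases eq_or_lt_of_le (hbmax p (.refl p)) with h | h
    · rw [h]
    · exact (le_time_of_mem (proxyRight_mem hp.1.1.meets_right)).trans
        ((time_succ_le_time h).trans (time_le_of_mem (proxyRight_mem hbg.1.1.meets_right)))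

/-- If `(i,i)` is maximal, it is a good member of the local group. Otherwise a larger pair of the
global group absorbs the interval; should it end at `i`, goodness ensures that its endpoint there is
not shortened. -/
theorem Icc_subset_subedgeProxy_of_not_isBad {i : Fin P.numEdges}
    (h : Reaches P A s t (i, i)) (hgood : ¬ IsBad P A s t i) :
    Icc (leftEnd P A i s) (rightEnd P A i t) ⊆ subedgeProxy P A s t := by
  obtain ⟨⟨a, b⟩, hab, h1, h2⟩ := exists_mem_combinatorialRep h
  simp only at h1 h2
  have hi : Meets P A i s := h.meets_left
  have hi' : Meets P A i t := h.meets_right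
  rcases eq_or_lt_of_le (h1.trans h2) with heq | hlt
  · obtain rfl : a = i := le_antisymm h1 (heq ▸ h2)
    subst heq
    exact fun x hx => Or.inl (mem_iUnion₂.2 ⟨a, ⟨hab, hgood⟩, hx⟩)
  · refine subset_trans (Icc_subset_Icc ?_ ?_)
      (Icc_proxy_subset_of_mem_globalGroup (p := (a, b)) ⟨hab, hlt⟩)
    · rcases eq_or_lt_of_le h1 with rfl | h
      · simp [proxyLeft, hgood]
      · exact (le_time_of_mem (proxyLeft_mem hab.1.meets_left)).trans
          ((time_succ_le_time h).trans (time_le_of_mem (leftEnd_mem hi)))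
    · rcases eq_or_lt_of_le h2 with rfl | h
      · simp [proxyRight, hgood]
      · exact (le_time_of_mem (rightEnd_mem hi')).trans
          ((time_succ_le_time h).trans (time_le_of_mem (proxyRight_mem hab.1.meets_right)))

/-- What a bad index loses is regained by the reversal, whose interval in cell `i` is `[l_i(t),
r_i(s)]`. The index is good there, since being bad in both directions would collapse this interval
to the excluded point. -/
theorem mem_mirror_proxy_of_isBad (hconv : ∀ i, Convex ℝ (cellRegion P A i)) (hst : s ≤ t)
    {i : Fin P.numEdges} (hbad : IsBad P A s t i) {x : ℝ} (hne : x ≠ leftEnd P A i s)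
    (hx : x ∈ Icc (leftEnd P A i t) (rightEnd P A i s)) :
    x ∈ subedgeProxy P (mirror A) (1 - t) (1 - s) := by
  have hgood : ¬ IsBad P (mirror A) (1 - t) (1 - s) i := fun h =>
    hne (hbad.eq_leftEnd_of_mirror h hx)
  refine Icc_subset_subedgeProxy_of_not_isBad (i := i) (reaches_self ?_ (by linarith)
    (meets_mirror.2 hbad.2.1) (meets_mirror.2 hbad.1) ?_) hgood ?_
  · rw [cellRegion_mirror]
    exact convex_mirror (hconv i)
  · rw [leftEnd_mirror, rightEnd_mirror]
    exact hx.1.trans hx.2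
  · rwa [leftEnd_mirror, rightEnd_mirror]

/-- Up to finitely many points, the reach region of a subedge is covered by the proxy coverages of
the subedge and of its reversal. -/
theorem exists_finite_reachRegion_subset (hconv : ∀ i, Convex ℝ (cellRegion P A i))
    (hst : s ≤ t) : ∃ N : Set ℝ, N.Finite ∧ reachRegion P A s t ⊆
      N ∪ (subedgeProxy P A s t ∪ subedgeProxy P (mirror A) (1 - t) (1 - s)) := by
  refine ⟨range (fun i => (P.time i : ℝ)) ∪ range (fun i => leftEnd P A i s),
    (finite_range _).union (finite_range _), fun x hx => ?_⟩
  by_cases hxN : x ∈ range (fun i => (P.time i : ℝ)) ∪ range (fun i => leftEnd P A i s)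
  · exact Or.inl hxN
  have hxt : ∀ i, (P.time i : ℝ) ≠ x := fun i h => hxN (Or.inl ⟨i, h⟩)
  have hxl : ∀ i, x ≠ leftEnd P A i s := fun i h => hxN (Or.inr ⟨i, h.symm⟩)
  refine Or.inr ?_
  obtain ⟨⟨i, j⟩, hij, hx1, hx2⟩ := mem_reachRegion.1 hx
  obtain ⟨⟨a, b⟩, hab, h1, h2⟩ := exists_mem_combinatorialRep hij
  simp only at h1 h2 hx1 hx2
  have hix := (time_le_of_mem (leftEnd_mem hij.meets_left)).trans hx1
  have hjx := hx2.trans (le_time_of_mem (rightEnd_mem hij.meets_right))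
  simp only at hix hjx
  have hilt := lt_of_le_of_ne hix (hxt _)
  have hjlt := lt_of_le_of_ne hjx (hxt _).symm
  -- A backward pair can only be realised at a common vertex parameter of the cells, and these are
  -- in the exceptional set.
  have hle : i ≤ j := by
    by_contra! h
    linarith [time_succ_le_time (P := P) h]
  rcases eq_or_lt_of_le (h1.trans (hle.trans h2)) with heq | hlt
  · subst heq
    obtain rfl : a = i := le_antisymm h1 (hle.trans h2)
    obtain rfl : a = j := le_antisymm hle h2
    by_cases hbad : IsBad P A s t a
    · exact Or.inr (mem_mirror_proxy_of_isBad hconv hst hbad (hxl a)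
        ⟨(hbad.leftEnd_le (hconv a) hst).trans hx1, hx2.trans (hbad.rightEnd_le (hconv a) hst)⟩)
    · exact Or.inl (Icc_subset_subedgeProxy_of_not_isBad hij hbad ⟨hx1, hx2⟩)
  · by_cases hl : proxyLeft P A s t a ≤ x
    · by_cases hr : x ≤ proxyRight P A s t b
      · exact Or.inl (Icc_proxy_subset_of_mem_globalGroup (p := (a, b)) ⟨hab, hlt⟩ ⟨hl, hr⟩)
      -- Only the shortened end of a maximal pair can miss `x`. Then `x` lies in the cell of that
      -- end, its index is bad, and the reversal takes over.
      · push Not at hr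
        have hjb : j = b := by
          by_contra hne
          have := time_succ_le_time (P := P) (lt_of_le_of_ne h2 hne)
          have := time_le_of_mem (proxyRight_mem (s := s) hab.1.meets_right)
          simp only at this
          linarith
        subst hjb
        have hbad : IsBad P A s t j := by
          by_contra hgood
          simp only [proxyRight, hgood, if_false] at hr
          linarith
        simp only [proxyRight, hbad, if_true] at hr
        exact Or.inr (mem_mirror_proxy_of_isBad hconv hst hbad (hxl j)
          ⟨hr.le, hx2.trans (hbad.rightEnd_le (hconv j) hst)⟩)
    · push Not at hl
      have hia : i = a := by
        by_contra hne
        have := time_succ_le_time (P := P) (lt_of_le_of_ne h1 (Ne.symm hne))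
        have := le_time_of_mem (proxyLeft_mem (t := t) hab.1.meets_left)
        simp only at this
        linarith
      subst hia
      have hbad : IsBad P A s t i := by
        by_contra hgood
        simp only [proxyLeft, hgood, if_false] at hl
        linarith
      simp only [proxyLeft, hbad, if_true] at hl
      exact Or.inr (mem_mirror_proxy_of_isBad hconv hst hbad (hxl i)
        ⟨(hbad.leftEnd_le (hconv i) hst).trans hx1, hl.le⟩)

end Reach

/-! ### The reach region and the coverage -/

section ReachCoverage

variable {d : ℕ} {P : PolygonalCurve d} {A : Set (ℝ × ℝ)}

theorem isClosed_freeSpace {γ e : Curve d} (hγ : Continuous γ) (he : Continuous e) (δ : ℝ) :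
    IsClosed (freeSpace γ e δ) := by
  have : freeSpace γ e δ = (fun p : unitInterval × unitInterval => ((p.1 : ℝ), (p.2 : ℝ))) ''
      {p | dist (γ p.1) (e p.2) ≤ δ} := by
    ext p
    constructor
    · rintro ⟨x, y, rfl, h⟩
      exact ⟨(x, y), h, rfl⟩
    · rintro ⟨⟨x, y⟩, h, rfl⟩
      exact ⟨x, y, rfl, h⟩
  rw [this]
  refine (IsCompact.image (IsClosed.isCompact ?_) (by fun_prop)).isClosed
  exact isClosed_le ((hγ.comp continuous_fst).dist (he.comp continuous_snd)) continuous_const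

theorem freeSpace_reverseCurve (γ e : Curve d) (δ : ℝ) :
    freeSpace γ (reverseCurve e) δ = mirror (freeSpace γ e δ) := by
  ext ⟨a, b⟩
  constructor
  · rintro ⟨x, y, h, hd⟩
    obtain ⟨rfl, rfl⟩ := Prod.ext_iff.1 h
    exact ⟨x, unitInterval.symm y, by simp, hd⟩
  · rintro ⟨x, y, h, hd⟩
    obtain ⟨rfl, h2⟩ := Prod.ext_iff.1 h
    simp only at h2
    refine ⟨x, unitInterval.symm y, ?_, by simpa [reverseCurve] using hd⟩
    rw [unitInterval.coe_symm_eq, ← h2, sub_sub_cancel]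

/-- A monotone path extended to the outermost points at its two heights is a pair of traversals, of
a subcurve of `P` and of `e[s,t]`. The parameters swept on `P` are exactly the interval of the index
pair. -/
theorem reachRegion_subset_coverage {e : Curve d} {δ : ℝ}
    (hconv : ∀ i, Convex ℝ (cellRegion P A i)) (hA : closure A ⊆ freeSpace P.toCurve e δ)
    (s t : unitInterval) :
    reachRegion P A s t ⊆ coverage P.toCurve {subcurve e s t} δ := by
  intro x hx
  obtain ⟨ij, hij, hx1, hx2⟩ := mem_reachRegion.1 hx
  obtain ⟨γ, hγc, hγm, hγ0, hγ1, hγA⟩ := hij.monotonePath hconv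
  choose X Y hXY hd using fun u => hA (hγA u)
  have hX1 : ∀ u, (X u : ℝ) = (γ u).1 := fun u => by rw [hXY]
  have hY1 : ∀ u, (Y u : ℝ) = (γ u).2 := fun u => by rw [hXY]
  have hXc : Continuous X := by
    rw [Topology.IsInducing.subtypeVal.continuous_iff]
    exact (continuous_fst.comp hγc).congr fun u => (hX1 u).symm
  have hYc : Continuous Y := by
    rw [Topology.IsInducing.subtypeVal.continuous_iff]
    exact (continuous_snd.comp hγc).congr fun u => (hY1 u).symm
  have hXm : Monotone X := fun u v huv => by
    rw [← Subtype.coe_le_coe, hX1, hX1]; exact (hγm huv).1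
  have hYm : Monotone Y := fun u v huv => by
    rw [← Subtype.coe_le_coe, hY1, hY1]; exact (hγm huv).2
  have h0 : Y 0 = s := by ext; rw [hY1, hγ0]
  have h1 : Y 1 = t := by ext; rw [hY1, hγ1]
  have h2 : (X 0 : ℝ) = leftEnd P A ij.1 s := by rw [hX1, hγ0]
  have h3 : (X 1 : ℝ) = rightEnd P A ij.2 t := by rw [hX1, hγ1]
  have := frechetDist_subcurve_le hXc hXm hYc hYm hd
  rw [h0, h1] at this
  exact ⟨_, rfl, X 0, X 1, hXm zero_le_one, this, by rwa [h2], by rwa [h3]⟩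

theorem mem_reachRegion_of_path {e : Curve d} {δ : ℝ} (hA : freeSpace P.toCurve e δ ⊆ A)
    (hcov : A ⊆ ⋃ i, cellRegion P A i) {X Y : unitInterval → unitInterval}
    (hX : Continuous X) (hX' : Monotone X) (hY : Continuous Y) (hY' : Monotone Y)
    (h : ∀ u, dist (P.toCurve (X u)) (e (Y u)) ≤ δ) (u : unitInterval) :
    (X u : ℝ) ∈ reachRegion P A (Y 0) (Y 1) := by
  have hmem : ∀ u, ((X u : ℝ), (Y u : ℝ)) ∈ A := fun u => hA ⟨X u, Y u, rfl, h u⟩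
  obtain ⟨i, hi⟩ := mem_iUnion.1 (hcov (hmem 0))
  obtain ⟨j, hj⟩ := mem_iUnion.1 (hcov (hmem 1))
  refine mem_reachRegion.2 ⟨(i, j), ⟨_, _, hi, hj, fun u => ((X u : ℝ), (Y u : ℝ)), by fun_prop,
    fun u v huv => ⟨hX' huv, hY' huv⟩, rfl, rfl, fun u => subset_closure (hmem u)⟩, ?_, ?_⟩
  · exact (leftEnd_le hi).trans (hX' unitInterval.nonneg')
  · exact le_trans (hX' unitInterval.le_one') (le_rightEnd hj)

/-- Interior points of a cell lie in its region by construction, and for points on cell boundaries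
this is the boundary condition on `A`. -/
theorem IsApproxFreeSpace.subset_iUnion_cellRegion {e : Curve d} {α δ : ℝ}
    (h : IsApproxFreeSpace P e α δ A) : A ⊆ ⋃ i, cellRegion P A i := by
  intro p hp
  obtain ⟨x, y, rfl, -⟩ := h.upper hp
  obtain ⟨i, hi⟩ := P.exists_edge_Icc x
  have hcell : ((x : ℝ), (y : ℝ)) ∈ P.cell i := ⟨⟨hi.1, hi.2⟩, y.2⟩
  refine mem_iUnion.2 ⟨i, ?_⟩
  by_cases hint : ((x : ℝ), (y : ℝ)) ∈ P.cellInterior i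
  · exact subset_closure ⟨hp, hint⟩
  · exact (h.boundary _ ⟨i, hcell, hint⟩).1 hp i hcell

theorem IsApproxFreeSpace.convex_cellRegion {e : Curve d} {α δ : ℝ}
    (h : IsApproxFreeSpace P e α δ A) (i : Fin P.numEdges) : Convex ℝ (cellRegion P A i) :=
  (h.convex i).closure

theorem IsApproxFreeSpace.closure_subset {e : Curve d} {α δ : ℝ}
    (h : IsApproxFreeSpace P e α δ A) (he : Continuous e) :
    closure A ⊆ freeSpace P.toCurve e (α * δ) :=
  closure_minimal h.upper (isClosed_freeSpace P.continuous he _)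

end ReachCoverage

/-! ### Extreme points and heights -/

section Heights

variable {d : ℕ} {P : PolygonalCurve d} {A : Set (ℝ × ℝ)} {i : Fin P.numEdges}

/-- The interior of the polygon lies in the open cell, and a convex set with nonempty interior lies
in the closure of its interior. So intersecting with the open cell and closing up returns the
polygon. -/
theorem cellRegion_eq_convexHull (h : IsPiecewiseLinear P A) (hne : (cellRegion P A i).Nonempty) :
    ∃ V : Finset (ℝ × ℝ), (interior (convexHull ℝ (V : Set (ℝ × ℝ)))).Nonempty ∧
      cellRegion P A i = convexHull ℝ (V : Set (ℝ × ℝ)) := by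
  rcases h i with h | ⟨V, hV, hint, h⟩
  · rw [cellRegion, h, closure_empty] at hne
    exact absurd hne not_nonempty_empty
  refine ⟨V, hint, ?_⟩
  have hclosed : IsClosed (convexHull ℝ (V : Set (ℝ × ℝ))) :=
    (V.finite_toSet.isCompact_convexHull ℝ).isClosed
  have hcell : convexHull ℝ (V : Set (ℝ × ℝ)) ⊆ P.cell i :=
    convexHull_min hV ((convex_Icc _ _).prod (convex_Icc _ _))
  have hsub : interior (convexHull ℝ (V : Set (ℝ × ℝ))) ⊆ P.cellInterior i := by
    refine (interior_mono hcell).trans ?_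
    rw [PolygonalCurve.cell, interior_prod_eq, interior_Icc, interior_Icc]
    exact subset_rfl
  rw [cellRegion, h]
  refine subset_antisymm (closure_minimal inter_subset_left hclosed) ?_
  calc convexHull ℝ (V : Set (ℝ × ℝ)) ⊆ closure (convexHull ℝ (V : Set (ℝ × ℝ))) := subset_closure
    _ = closure (interior (convexHull ℝ (V : Set (ℝ × ℝ)))) :=
      ((convex_convexHull ℝ _).closure_interior_eq_closure_of_nonempty_interior hint).symm
    _ ⊆ _ := closure_mono (subset_inter interior_subset hsub)

theorem finite_extremePoints (h : IsPiecewiseLinear P A) :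
    ((cellRegion P A i).extremePoints ℝ).Finite := by
  rcases (cellRegion P A i).eq_empty_or_nonempty with he | hne
  · rw [he, extremePoints_empty]
    exact finite_empty
  · obtain ⟨V, -, hV⟩ := cellRegion_eq_convexHull h hne
    rw [hV]
    exact V.finite_toSet.subset extremePoints_convexHull_subset

theorem convexHull_extremePoints (h : IsPiecewiseLinear P A)
    (hconv : Convex ℝ (cellRegion P A i)) :
    convexHull ℝ ((cellRegion P A i).extremePoints ℝ) = cellRegion P A i := by
  have h1 := closure_convexHull_extremePoints isCompact_cellRegion hconv
  rwa [((finite_extremePoints h).isCompact_convexHull ℝ).isClosed.closure_eq] at h1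

theorem extremePoints_face_subset {K : Set (ℝ × ℝ)} (f : StrongDual ℝ (ℝ × ℝ)) :
    ({p ∈ K | ∀ q ∈ K, f q ≤ f p} : Set (ℝ × ℝ)).extremePoints ℝ ⊆ K.extremePoints ℝ := by
  have : IsExposed ℝ K {p ∈ K | ∀ q ∈ K, f q ≤ f p} := fun _ => ⟨f, rfl⟩
  exact this.isExtreme.extremePoints_subset_extremePoints

/-- The left-, right-, bottom- and top-most points form exposed faces, cut out by coordinate
functionals, and an extreme point of a face is extreme in `K`. Thus only polygon vertices contribute
heights. -/
theorem extremalPoints_subset {K : Set (ℝ × ℝ)} : extremalPoints K ⊆ K.extremePoints ℝ := by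
  refine union_subset (union_subset (union_subset ?_ ?_) ?_) ?_
  · simpa [leftmost] using
      extremePoints_face_subset (K := K) (-(ContinuousLinearMap.fst ℝ ℝ ℝ))
  · simpa [rightmost] using extremePoints_face_subset (K := K) (ContinuousLinearMap.fst ℝ ℝ ℝ)
  · simpa [bottommost] using
      extremePoints_face_subset (K := K) (-(ContinuousLinearMap.snd ℝ ℝ ℝ))
  · simpa [topmost] using extremePoints_face_subset (K := K) (ContinuousLinearMap.snd ℝ ℝ ℝ)

theorem finite_heights (h : IsPiecewiseLinear P A) : (heights P A).Finite := by
  refine (finite_iUnion fun i => (finite_extremePoints (i := i) h).image Prod.snd).subset ?_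
  rintro y ⟨i, x, hx⟩
  rw [union_eq_right.2 extremalPoints_subset] at hx
  exact mem_iUnion.2 ⟨i, _, hx, rfl⟩

theorem snd_mem_heights {p : ℝ × ℝ} (hp : p ∈ (cellRegion P A i).extremePoints ℝ) :
    p.2 ∈ heights P A := ⟨i, p.1, Or.inr hp⟩

theorem heights_subset_Icc : heights P A ⊆ Icc 0 1 := by
  rintro y ⟨i, x, hx⟩
  rw [union_eq_right.2 extremalPoints_subset] at hx
  exact (cellRegion_subset_cell (extremePoints_subset hx)).2

theorem exists_extremePoint_le (h : IsPiecewiseLinear P A)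
    (hconv : Convex ℝ (cellRegion P A i)) {x y : ℝ} (hxy : (x, y) ∈ cellRegion P A i) :
    ∃ p ∈ (cellRegion P A i).extremePoints ℝ, p.2 ≤ y := by
  by_contra! hcon
  have hsub : convexHull ℝ ((cellRegion P A i).extremePoints ℝ) ⊆ {p | y < p.2} :=
    convexHull_min hcon (convex_halfSpace_gt (f := Prod.snd) (LinearMap.snd ℝ ℝ ℝ).isLinear y)
  rw [convexHull_extremePoints h hconv] at hsub
  exact lt_irrefl y (hsub hxy)

theorem exists_le_extremePoint (h : IsPiecewiseLinear P A)
    (hconv : Convex ℝ (cellRegion P A i)) {x y : ℝ} (hxy : (x, y) ∈ cellRegion P A i) :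
    ∃ p ∈ (cellRegion P A i).extremePoints ℝ, y ≤ p.2 := by
  by_contra! hcon
  have hsub : convexHull ℝ ((cellRegion P A i).extremePoints ℝ) ⊆ {p | p.2 < y} :=
    convexHull_min hcon (convex_halfSpace_lt (f := Prod.snd) (LinearMap.snd ℝ ℝ ℝ).isLinear y)
  rw [convexHull_extremePoints h hconv] at hsub
  exact lt_irrefl y (hsub hxy)

/-- Otherwise the polygon would lie on a horizontal line and have empty interior. This is where
nondegeneracy enters; it makes the height range of every nonempty cell region proper. -/
theorem exists_extremePoint_ne (h : IsPiecewiseLinear P A)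
    (hconv : Convex ℝ (cellRegion P A i)) (hne : (cellRegion P A i).Nonempty) (y : ℝ) :
    ∃ p ∈ (cellRegion P A i).extremePoints ℝ, p.2 ≠ y := by
  by_contra! hcon
  have hsub : convexHull ℝ ((cellRegion P A i).extremePoints ℝ) ⊆ {p | p.2 = y} :=
    convexHull_min hcon (convex_hyperplane (f := Prod.snd) (LinearMap.snd ℝ ℝ ℝ).isLinear y)
  rw [convexHull_extremePoints h hconv] at hsub
  obtain ⟨V, hint, hV⟩ := cellRegion_eq_convexHull h hne
  rw [hV] at hsub
  obtain ⟨p, hp⟩ := hint.mono (interior_mono hsub)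
  have he : {p : ℝ × ℝ | p.2 = y} = univ ×ˢ {y} := by
    ext q
    simp
  rw [he, interior_prod_eq, interior_singleton, prod_empty] at hp
  exact hp

/-- The heights of two extreme points of a cell region enclose each of its points. -/
theorem exists_heights_around (h : IsPiecewiseLinear P A)
    (hconv : Convex ℝ (cellRegion P A i)) {x y : ℝ} (hxy : (x, y) ∈ cellRegion P A i) :
    ∃ p ∈ (cellRegion P A i).extremePoints ℝ, ∃ q ∈ (cellRegion P A i).extremePoints ℝ,
      p.2 ≤ y ∧ y ≤ q.2 ∧ p.2 < q.2 := by
  obtain ⟨p, hp, hpy⟩ := exists_extremePoint_le h hconv hxy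
  obtain ⟨q, hq, hqy⟩ := exists_le_extremePoint h hconv hxy
  obtain ⟨r, hr, hry⟩ := exists_extremePoint_ne h hconv ⟨_, hxy⟩ y
  rcases lt_or_gt_of_ne hry with hlt | hgt
  · exact ⟨r, hr, q, hq, hlt.le, hqy, hlt.trans_le hqy⟩
  · exact ⟨p, hp, r, hr, hpy, hgt.le, hpy.trans_lt hgt⟩

/-- The reach regions of a subedge and of its reversal. -/
def bothRegion {d : ℕ} (P : PolygonalCurve d) (A : Set (ℝ × ℝ)) (s t : ℝ) : Set ℝ :=
  reachRegion P A s t ∪ reachRegion P (mirror A) (1 - t) (1 - s)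

/-- No vertex of the polygon has its height strictly between `h₀` and `h₁`, so the polygon is the
join of the hulls of its lower and its upper vertices. Hence `(x,y)` lies on a segment `[p,q]` in it
that spans the gap. If the segment leads to the right, `x` lies in `[l_i(h₀), r_i(h₁)]`; if to the
left, in the corresponding interval of the reversal. -/
theorem mem_bothRegion_of_heights (h : IsPiecewiseLinear P A)
    (hconv : Convex ℝ (cellRegion P A i)) {x y h₀ h₁ : ℝ} (hxy : (x, y) ∈ cellRegion P A i)
    (hy₀ : h₀ ≤ y) (hy₁ : y ≤ h₁) (hgap : ∀ z ∈ heights P A, z ≤ h₀ ∨ h₁ ≤ z)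
    (hlow : ∃ p ∈ (cellRegion P A i).extremePoints ℝ, p.2 ≤ h₀)
    (hhigh : ∃ p ∈ (cellRegion P A i).extremePoints ℝ, h₁ ≤ p.2) :
    x ∈ bothRegion P A h₀ h₁ := by
  set K := cellRegion P A i with hK
  have hunion : K.extremePoints ℝ =
      {p ∈ K.extremePoints ℝ | p.2 ≤ h₀} ∪ {p ∈ K.extremePoints ℝ | h₁ ≤ p.2} := by
    ext p
    constructor
    · intro hp
      exact (hgap p.2 (snd_mem_heights hp)).imp (fun h => ⟨hp, h⟩) (fun h => ⟨hp, h⟩)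
    · rintro (hp | hp) <;> exact hp.1
  have hmem : (x, y) ∈ convexHull ℝ (K.extremePoints ℝ) := by
    rw [hK, convexHull_extremePoints h hconv]
    exact hxy
  have hlow' : ({p ∈ K.extremePoints ℝ | p.2 ≤ h₀} : Set (ℝ × ℝ)).Nonempty := hlow
  have hhigh' : ({p ∈ K.extremePoints ℝ | h₁ ≤ p.2} : Set (ℝ × ℝ)).Nonempty := hhigh
  rw [hunion, convexHull_union hlow' hhigh'] at hmem
  obtain ⟨p, hp, q, hq, hpq⟩ := mem_convexJoin.1 hmem
  have hKsub : ∀ B ⊆ K.extremePoints ℝ, convexHull ℝ B ⊆ K := fun B hB =>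
    convexHull_min (hB.trans extremePoints_subset) hconv
  have hpK := hKsub _ (sep_subset _ _) hp
  have hqK := hKsub _ (sep_subset _ _) hq
  have hp2 : p ∈ {p : ℝ × ℝ | p.2 ≤ h₀} := convexHull_min (fun _ h => h.2)
    (convex_halfSpace_le (f := Prod.snd) (LinearMap.snd ℝ ℝ ℝ).isLinear h₀) hp
  have hq2 : q ∈ {p : ℝ × ℝ | h₁ ≤ p.2} := convexHull_min (fun _ h => h.2)
    (convex_halfSpace_ge (f := Prod.snd) (LinearMap.snd ℝ ℝ ℝ).isLinear h₁) hq
  have hx : x ∈ uIcc p.1 q.1 := by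
    rw [← segment_eq_uIcc]
    obtain ⟨a, b, ha, hb, hab, he⟩ := hpq
    exact ⟨a, b, ha, hb, hab, congrArg Prod.fst he⟩
  obtain ⟨x₀, hx₀, hx₀K⟩ := exists_mem_height hconv hpK hxy hp2 hy₀
  obtain ⟨x₁, hx₁, hx₁K⟩ := exists_mem_height hconv hxy hqK hy₁ hq2
  simp only at hx₀ hx₁
  rcases le_total p.1 q.1 with hle | hle
  · rw [uIcc_of_le hle] at hx
    rw [uIcc_of_le hx.1] at hx₀
    rw [uIcc_of_le hx.2] at hx₁
    have e1 := (leftEnd_le hx₀K).trans hx₀.2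
    have e2 := hx₁.1.trans (le_rightEnd hx₁K)
    exact Or.inl (mem_reachRegion.2 ⟨(i, i), reaches_self hconv (hy₀.trans hy₁) ⟨_, hx₀K⟩
      ⟨_, hx₁K⟩ (e1.trans e2), e1, e2⟩)
  · rw [uIcc_of_ge hle] at hx
    rw [uIcc_of_ge hx.2] at hx₀
    rw [uIcc_of_ge hx.1] at hx₁
    have e1 := (leftEnd_le hx₁K).trans hx₁.2
    have e2 := hx₀.1.trans (le_rightEnd hx₀K)
    refine Or.inr (mem_reachRegion.2 ⟨(i, i), reaches_self ?_ (by linarith)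
      (meets_mirror.2 ⟨_, hx₁K⟩) (meets_mirror.2 ⟨_, hx₀K⟩) ?_, ?_⟩)
    · rw [cellRegion_mirror]
      exact convex_mirror hconv
    · rw [leftEnd_mirror, rightEnd_mirror]
      exact e1.trans e2
    · simp only [leftEnd_mirror, rightEnd_mirror]
      exact ⟨e1, e2⟩

/-- Apply the one-sided statement to `A` and to its mirror image; mirroring merely swaps the two
proxy coverages on the right. -/
theorem exists_finite_bothRegion_subset {s t : ℝ} (hconv : ∀ i, Convex ℝ (cellRegion P A i))
    (hst : s ≤ t) : ∃ N : Set ℝ, N.Finite ∧ bothRegion P A s t ⊆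
      N ∪ (subedgeProxy P A s t ∪ subedgeProxy P (mirror A) (1 - t) (1 - s)) := by
  obtain ⟨N, hN, h⟩ := exists_finite_reachRegion_subset hconv hst
  obtain ⟨N', hN', h'⟩ := exists_finite_reachRegion_subset (A := mirror A) (s := 1 - t)
    (t := 1 - s) (fun i => by rw [cellRegion_mirror]; exact convex_mirror (hconv i))
    (by linarith)
  rw [mirror_mirror, sub_sub_cancel, sub_sub_cancel, union_comm (subedgeProxy _ _ _ _)] at h'
  refine ⟨N ∪ N', hN.union hN', union_subset (h.trans ?_) (h'.trans ?_)⟩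
  · exact union_subset_union_left _ subset_union_left
  · exact union_subset_union_left _ subset_union_right

end Heights

/-! ### Covering an interval of heights by dyadic pairs -/

section Dyadic

variable {α : Type*} [LinearOrder α]

/-- Pairs of elements of `E` at a dyadic distance. -/
def IsDyadicPair (E : Finset α) (s t : α) : Prop :=
  s ∈ E ∧ t ∈ E ∧ ∃ m ≤ Nat.log 2 E.card, (E.filter fun z => s < z ∧ z ≤ t).card = 2 ^ m

theorem card_filter_le_orderEmbOfFin (F : Finset α) {n : ℕ} (hn : F.card = n) (k : Fin n) :
    (F.filter fun z => z ≤ F.orderEmbOfFin hn k).card = k + 1 := by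
  have : (F.filter fun z => z ≤ F.orderEmbOfFin hn k) =
      (Finset.Iic k).map (F.orderEmbOfFin hn).toEmbedding := by
    ext z
    simp only [Finset.mem_filter, Finset.mem_map, Finset.mem_Iic]
    constructor
    · rintro ⟨hz, hle⟩
      have : z ∈ range (F.orderEmbOfFin hn) := by rw [Finset.range_orderEmbOfFin]; exact hz
      obtain ⟨j, rfl⟩ := this
      exact ⟨j, (F.orderEmbOfFin hn).le_iff_le.1 hle, rfl⟩
    · rintro ⟨j, hj, rfl⟩
      exact ⟨Finset.orderEmbOfFin_mem _ _ _, (F.orderEmbOfFin hn).le_iff_le.2 hj⟩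
  rw [this, Finset.card_map, Fin.card_Iic]

theorem isDyadicPair_of_gap {E : Finset α} {s t : α} (hs : s ∈ E) (ht : t ∈ E) (hst : s < t)
    (hgap : ∀ z ∈ E, z ≤ s ∨ t ≤ z) : IsDyadicPair E s t := by
  refine ⟨hs, ht, 0, Nat.zero_le _, ?_⟩
  rw [pow_zero, Finset.card_eq_one]
  refine ⟨t, ?_⟩
  ext z
  simp only [Finset.mem_filter, Finset.mem_singleton]
  constructor
  · rintro ⟨hz, h1, h2⟩
    exact le_antisymm h2 ((hgap z hz).resolve_left (not_le.2 h1))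
  · rintro rfl
    exact ⟨ht, hst, le_rfl⟩

/-- Two dyadic pairs cover the interval between two elements of `E`. -/
theorem exists_dyadicPairs {E : Finset α} {a b : α} (ha : a ∈ E) (hb : b ∈ E) (hab : a < b) :
    ∃ a' b', IsDyadicPair E a b' ∧ IsDyadicPair E a' b ∧ a ≤ a' ∧ a' ≤ b' ∧ b' ≤ b := by
  set F := E.filter fun z => a < z ∧ z ≤ b with hF
  have hn0 : F.card ≠ 0 := (Finset.card_pos.2 ⟨b, by simp [hF, hb, hab]⟩).ne'
  set n := F.card with hn
  set m := Nat.log 2 n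
  have hm1 : 2 ^ m ≤ n := Nat.pow_log_le_self 2 hn0
  have hm2 : n < 2 ^ (m + 1) := Nat.lt_pow_succ_log_self one_lt_two n
  have hmE : m ≤ Nat.log 2 E.card := Nat.log_mono_right (Finset.card_filter_le _ _)
  have hpos : 0 < 2 ^ m := by positivity
  let f := F.orderEmbOfFin hn.symm
  have hfF : ∀ k, f k ∈ F := fun k => Finset.orderEmbOfFin_mem _ _ _
  have hfE : ∀ k, f k ∈ E ∧ a < f k ∧ f k ≤ b := fun k => Finset.mem_filter.1 (hfF k)
  have hk : 2 ^ m - 1 < n := by omega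
  -- `b'` is the `2^m`-th element of `F` (indices start at `0`), and `a'` will be the element with
  -- exactly `2^m` elements of `F` above it. They overlap because `n < 2^(m+1)`.
  have hb' : IsDyadicPair E a (f ⟨2 ^ m - 1, hk⟩) := by
    refine ⟨ha, (hfE _).1, m, hmE, ?_⟩
    have h1 := card_filter_le_orderEmbOfFin F hn.symm ⟨2 ^ m - 1, hk⟩
    have h2 : (E.filter fun z => a < z ∧ z ≤ f ⟨2 ^ m - 1, hk⟩) =
        F.filter fun z => z ≤ f ⟨2 ^ m - 1, hk⟩ := by
      ext z
      simp only [hF, Finset.mem_filter]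
      constructor
      · rintro ⟨h1, h2, h3⟩
        exact ⟨⟨h1, h2, h3.trans (hfE _).2.2⟩, h3⟩
      · rintro ⟨⟨h1, h2, -⟩, h3⟩
        exact ⟨h1, h2, h3⟩
    rw [h2]
    change (F.filter fun z => z ≤ f ⟨2 ^ m - 1, hk⟩).card = _ at h1
    simp only at h1
    omega
  -- If `n = 2^m`, then `a'` is `a` itself, which is not in `F`.
  rcases eq_or_lt_of_le hm1 with heq | hlt
  · refine ⟨a, _, hb', ⟨ha, hb, m, hmE, ?_⟩, le_rfl, (hfE _).2.1.le, (hfE _).2.2⟩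
    rw [← hF, ← hn, heq]
  · have hk' : n - 2 ^ m - 1 < n := by omega
    refine ⟨f ⟨n - 2 ^ m - 1, hk'⟩, _, hb', ⟨(hfE _).1, hb, m, hmE, ?_⟩, (hfE _).2.1.le,
      f.monotone ?_, (hfE _).2.2⟩
    · have h1 := card_filter_le_orderEmbOfFin F hn.symm ⟨n - 2 ^ m - 1, hk'⟩
      have h2 : (E.filter fun z => f ⟨n - 2 ^ m - 1, hk'⟩ < z ∧ z ≤ b) =
          F.filter fun z => ¬ z ≤ f ⟨n - 2 ^ m - 1, hk'⟩ := by
        ext z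
        simp only [hF, Finset.mem_filter, not_le]
        constructor
        · rintro ⟨h1, h2, h3⟩
          exact ⟨⟨h1, (hfE _).2.1.trans h2, h3⟩, h2⟩
        · rintro ⟨⟨h1, -, h2⟩, h3⟩
          exact ⟨h1, h3, h2⟩
      have h3 := Finset.card_filter_add_card_filter_not (s := F)
        (fun z => z ≤ f ⟨n - 2 ^ m - 1, hk'⟩)
      rw [h2]
      change (F.filter fun z => z ≤ f ⟨n - 2 ^ m - 1, hk'⟩).card = _ at h1
      rw [pow_succ] at hm2
      simp only at h1
      omega
    · rw [Fin.mk_le_mk]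
      rw [pow_succ] at hm2
      omega

variable {β : Type*}

/-- The point `x` at height `y` lies in a region with extremal heights `lo` and `hi` in `E`, so
that it is covered by every gap of `E` around `y` between these. -/
def GapCovered (E : Finset α) (cov : α → α → Set β) (x : β) (y : α) : Prop :=
  ∃ lo ∈ E, ∃ hi ∈ E, lo ≤ y ∧ y ≤ hi ∧ lo < hi ∧ ∀ h₀ ∈ E, ∀ h₁ ∈ E, lo ≤ h₀ → h₀ ≤ y → y ≤ h₁ →
    h₁ ≤ hi → (∀ z ∈ E, z ≤ h₀ ∨ h₁ ≤ z) → x ∈ cov h₀ h₁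

/-- One gap serves all heights `y` between `s` and the next element of `E`: the one from the last
element below `s` to the first element that is at least `s`. If either is missing, no region range
`[lo, hi]` meets the requirements. -/
theorem exists_gap_below (E : Finset α) (s : α) :
    ∃ D : Finset (α × α), D.card ≤ 1 ∧ (∀ p ∈ D, p.1 ≤ p.2 ∧ IsDyadicPair E p.1 p.2) ∧
      ∀ (y lo hi : α), s ≤ y → (∀ z ∈ E, s ≤ z → y ≤ z) → lo ∈ E → hi ∈ E → lo < s → y ≤ hi →
        ∃ p ∈ D, lo ≤ p.1 ∧ p.1 ≤ y ∧ y ≤ p.2 ∧ p.2 ≤ hi ∧ ∀ z ∈ E, z ≤ p.1 ∨ p.2 ≤ z := by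
  by_cases h : (E.filter (· < s)).Nonempty ∧ (E.filter (s ≤ ·)).Nonempty
  · obtain ⟨h0, h1⟩ := h
    have m0 := Finset.mem_filter.1 (Finset.max'_mem _ h0)
    have m1 := Finset.mem_filter.1 (Finset.min'_mem _ h1)
    set a₀ := (E.filter (· < s)).max' h0
    set a₁ := (E.filter (s ≤ ·)).min' h1
    have hgap : ∀ z ∈ E, z ≤ a₀ ∨ a₁ ≤ z := fun z hz => (lt_or_ge z s).imp
      (fun h => Finset.le_max' _ _ (Finset.mem_filter.2 ⟨hz, h⟩))
      (fun h => Finset.min'_le _ _ (Finset.mem_filter.2 ⟨hz, h⟩))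
    have hlt : a₀ < a₁ := m0.2.trans_le m1.2
    refine ⟨{(a₀, a₁)}, by simp, ?_, ?_⟩
    · simp only [Finset.mem_singleton, forall_eq]
      exact ⟨hlt.le, isDyadicPair_of_gap m0.1 m1.1 hlt hgap⟩
    · intro y lo hi hsy hy hlo hhi hls hyhi
      exact ⟨_, Finset.mem_singleton_self _, Finset.le_max' _ _ (Finset.mem_filter.2 ⟨hlo, hls⟩),
        m0.2.le.trans hsy, hy _ m1.1 m1.2,
        Finset.min'_le _ _ (Finset.mem_filter.2 ⟨hhi, hsy.trans hyhi⟩), hgap⟩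
  · refine ⟨∅, by simp, by simp, fun y lo hi hsy hy hlo hhi hls hyhi => (h ⟨?_, ?_⟩).elim⟩
    · exact ⟨lo, Finset.mem_filter.2 ⟨hlo, hls⟩⟩
    · exact ⟨hi, Finset.mem_filter.2 ⟨hhi, hsy.trans hyhi⟩⟩

theorem exists_gap_above (E : Finset α) (t : α) :
    ∃ D : Finset (α × α), D.card ≤ 1 ∧ (∀ p ∈ D, p.1 ≤ p.2 ∧ IsDyadicPair E p.1 p.2) ∧
      ∀ (y lo hi : α), y ≤ t → (∀ z ∈ E, z ≤ t → z ≤ y) → lo ∈ E → hi ∈ E → t < hi → lo ≤ y →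
        ∃ p ∈ D, lo ≤ p.1 ∧ p.1 ≤ y ∧ y ≤ p.2 ∧ p.2 ≤ hi ∧ ∀ z ∈ E, z ≤ p.1 ∨ p.2 ≤ z := by
  by_cases h : (E.filter (· ≤ t)).Nonempty ∧ (E.filter (t < ·)).Nonempty
  · obtain ⟨h0, h1⟩ := h
    have m0 := Finset.mem_filter.1 (Finset.max'_mem _ h0)
    have m1 := Finset.mem_filter.1 (Finset.min'_mem _ h1)
    set b₀ := (E.filter (· ≤ t)).max' h0
    set b₁ := (E.filter (t < ·)).min' h1
    have hgap : ∀ z ∈ E, z ≤ b₀ ∨ b₁ ≤ z := fun z hz => (le_or_gt z t).imp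
      (fun h => Finset.le_max' _ _ (Finset.mem_filter.2 ⟨hz, h⟩))
      (fun h => Finset.min'_le _ _ (Finset.mem_filter.2 ⟨hz, h⟩))
    have hlt : b₀ < b₁ := m0.2.trans_lt m1.2
    refine ⟨{(b₀, b₁)}, by simp, ?_, ?_⟩
    · simp only [Finset.mem_singleton, forall_eq]
      exact ⟨hlt.le, isDyadicPair_of_gap m0.1 m1.1 hlt hgap⟩
    · intro y lo hi hyt hy hlo hhi hth hly
      have hlo' : lo ≤ t := hly.trans hyt
      exact ⟨(b₀, b₁), Finset.mem_singleton_self _,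
        Finset.le_max' _ _ (Finset.mem_filter.2 ⟨hlo, hlo'⟩),
        hy _ m0.1 m0.2, hyt.trans m1.2.le,
        Finset.min'_le _ _ (Finset.mem_filter.2 ⟨hhi, hth⟩), hgap⟩
  · refine ⟨∅, by simp, by simp, fun y lo hi hyt hy hlo hhi hth hly => (h ⟨?_, ?_⟩).elim⟩
    · exact ⟨lo, Finset.mem_filter.2 ⟨hlo, hly.trans hyt⟩⟩
    · exact ⟨hi, Finset.mem_filter.2 ⟨hhi, hth⟩⟩

/-- `D` covers every point whose height lies in `[s,t]` and that is covered both by the gaps of `E`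
around its height and by all intervals around its height inside `[s,t]`. -/
def CoversBetween (E : Finset α) (s t : α) (D : Finset (α × α)) : Prop :=
  ∀ (cov : α → α → Set ℝ) (x : ℝ) (y : α), s ≤ y → y ≤ t →
    (∀ a b, s ≤ a → a ≤ y → y ≤ b → b ≤ t → x ∈ cov a b) → GapCovered E cov x y →
    ∃ p ∈ D, x ∈ cov p.1 p.2

/-- The four pairs are the gap around `s`, the gap around `t`, and two dyadic pairs spanning the
elements of `E` in `[s,t]`. -/
theorem exists_coversBetween (E : Finset α) (s t : α) :
    ∃ D : Finset (α × α), D.card ≤ 4 ∧ (∀ p ∈ D, p.1 ≤ p.2 ∧ IsDyadicPair E p.1 p.2) ∧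
      CoversBetween E s t D := by
  classical
  obtain ⟨D₀, hD₀, hD₀', hlow⟩ := exists_gap_below E s
  obtain ⟨D₁, hD₁, hD₁', hhigh⟩ := exists_gap_above E t
  have low : ∀ (cov : α → α → Set ℝ) (x : ℝ) (y lo hi : α), s ≤ y → (∀ z ∈ E, s ≤ z → y ≤ z) →
      lo ∈ E → hi ∈ E → lo < s → y ≤ hi → (∀ h₀ ∈ E, ∀ h₁ ∈ E, lo ≤ h₀ → h₀ ≤ y → y ≤ h₁ →
        h₁ ≤ hi → (∀ z ∈ E, z ≤ h₀ ∨ h₁ ≤ z) → x ∈ cov h₀ h₁) → ∃ p ∈ D₀, x ∈ cov p.1 p.2 := by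
    intro cov x y lo hi h1 h2 h3 h4 h5 h6 h7
    obtain ⟨p, hp, q1, q2, q3, q4, q5⟩ := hlow y lo hi h1 h2 h3 h4 h5 h6
    exact ⟨p, hp, h7 _ (hD₀' p hp).2.1 _ (hD₀' p hp).2.2.1 q1 q2 q3 q4 q5⟩
  have high : ∀ (cov : α → α → Set ℝ) (x : ℝ) (y lo hi : α), y ≤ t → (∀ z ∈ E, z ≤ t → z ≤ y) →
      lo ∈ E → hi ∈ E → t < hi → lo ≤ y → (∀ h₀ ∈ E, ∀ h₁ ∈ E, lo ≤ h₀ → h₀ ≤ y → y ≤ h₁ →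
        h₁ ≤ hi → (∀ z ∈ E, z ≤ h₀ ∨ h₁ ≤ z) → x ∈ cov h₀ h₁) → ∃ p ∈ D₁, x ∈ cov p.1 p.2 := by
    intro cov x y lo hi h1 h2 h3 h4 h5 h6 h7
    obtain ⟨p, hp, q1, q2, q3, q4, q5⟩ := hhigh y lo hi h1 h2 h3 h4 h5 h6
    exact ⟨p, hp, h7 _ (hD₁' p hp).2.1 _ (hD₁' p hp).2.2.1 q1 q2 q3 q4 q5⟩
  by_cases hT : (E.filter fun z => s ≤ z ∧ z ≤ t).Nonempty
  · have ma := Finset.mem_filter.1 (Finset.min'_mem _ hT)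
    have mb := Finset.mem_filter.1 (Finset.max'_mem _ hT)
    have hmin : ∀ z ∈ E, s ≤ z → z ≤ t → (E.filter fun z => s ≤ z ∧ z ≤ t).min' hT ≤ z :=
      fun z h1 h2 h3 => Finset.min'_le _ _ (Finset.mem_filter.2 ⟨h1, h2, h3⟩)
    have hmax : ∀ z ∈ E, s ≤ z → z ≤ t → z ≤ (E.filter fun z => s ≤ z ∧ z ≤ t).max' hT :=
      fun z h1 h2 h3 => Finset.le_max' _ _ (Finset.mem_filter.2 ⟨h1, h2, h3⟩)
    set a := (E.filter fun z => s ≤ z ∧ z ≤ t).min' hT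
    set b := (E.filter fun z => s ≤ z ∧ z ≤ t).max' hT
    obtain ⟨D₂, hD₂, hD₂', hmid⟩ : ∃ D₂ : Finset (α × α), D₂.card ≤ 2 ∧
        (∀ p ∈ D₂, p.1 ≤ p.2 ∧ IsDyadicPair E p.1 p.2) ∧
        ∀ y, a ≤ y → y ≤ b → a < b → ∃ p ∈ D₂, s ≤ p.1 ∧ p.1 ≤ y ∧ y ≤ p.2 ∧ p.2 ≤ t := by
      by_cases hab : a < b
      · obtain ⟨a', b', h1, h2, h3, h4, h5⟩ := exists_dyadicPairs ma.1 mb.1 hab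
        refine ⟨{(a, b'), (a', b)}, Finset.card_le_two, ?_, fun y hay hyb _ => ?_⟩
        · intro p hp
          rcases Finset.mem_insert.1 hp with rfl | hp
          · exact ⟨h3.trans h4, h1⟩
          · rw [Finset.mem_singleton.1 hp]
            exact ⟨h4.trans h5, h2⟩
        · rcases le_total y b' with h | h
          · exact ⟨(a, b'), by simp, ma.2.1, hay, h, h5.trans mb.2.2⟩
          · exact ⟨(a', b), by simp, ma.2.1.trans h3, h4.trans h, hyb, mb.2.2⟩
      · exact ⟨∅, by simp, by simp, fun y _ _ h => absurd h hab⟩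
    refine ⟨D₀ ∪ D₁ ∪ D₂, ?_, ?_, ?_⟩
    · have h1 := Finset.card_union_le (D₀ ∪ D₁) D₂
      have h2 := Finset.card_union_le D₀ D₁
      omega
    · intro p hp
      rcases Finset.mem_union.1 hp with hp | hp
      · exact (Finset.mem_union.1 hp).elim (hD₀' p) (hD₁' p)
      · exact hD₂' p hp
    · rintro cov x y hsy hyt hcov ⟨lo, hlo, hi, hhi, hly, hyh, hlh, hg⟩
      have useLow : lo < s → (∀ z ∈ E, s ≤ z → y ≤ z) → ∃ p ∈ D₀ ∪ D₁ ∪ D₂, x ∈ cov p.1 p.2 := by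
        intro h1 h2
        obtain ⟨p, hp, h⟩ := low cov x y lo hi hsy h2 hlo hhi h1 hyh hg
        exact ⟨p, by simp [hp], h⟩
      have useHigh : t < hi → (∀ z ∈ E, z ≤ t → z ≤ y) → ∃ p ∈ D₀ ∪ D₁ ∪ D₂, x ∈ cov p.1 p.2 := by
        intro h1 h2
        obtain ⟨p, hp, h⟩ := high cov x y lo hi hyt h2 hlo hhi h1 hly hg
        exact ⟨p, by simp [hp], h⟩
      rcases lt_or_ge y a with hya | hay
      · refine useLow ?_ fun z hz hsz => ?_
        · by_contra! h
          exact absurd (hmin lo hlo h (hly.trans hyt)) (not_le.2 (hly.trans_lt hya))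
        · rcases le_total z t with h | h
          · exact hya.le.trans (hmin z hz hsz h)
          · exact hyt.trans h
      rcases lt_or_ge b y with hby | hyb
      · refine useHigh ?_ fun z hz hzt => ?_
        · by_contra! h
          exact absurd (hmax hi hhi (hsy.trans hyh) h) (not_le.2 (hby.trans_le hyh))
        · rcases le_total s z with h | h
          · exact (hmax z hz h hzt).trans hby.le
          · exact h.trans hsy
      rcases lt_or_ge a b with hab | hba
      · obtain ⟨p, hp, q1, q2, q3, q4⟩ := hmid y hay hyb hab
        exact ⟨p, by simp [hp], hcov _ _ q1 q2 q3 q4⟩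
      -- Here `y` is the only element of `E` in `[s,t]`. Since `lo < hi`, the region extends
      -- strictly below or strictly above `y`, hence beyond `s` or beyond `t`, and the gap on that
      -- side applies.
      rcases lt_or_ge lo y with h | h
      · refine useLow ?_ fun z hz hsz => ?_
        · by_contra! h'
          exact absurd ((hyb.trans hba).trans (hmin lo hlo h' (hly.trans hyt))) (not_le.2 h)
        · rcases le_total z t with h | h
          · exact (hyb.trans hba).trans (hmin z hz hsz h)
          · exact hyt.trans h
      · refine useHigh ?_ fun z hz hzt => ?_
        · by_contra! h'
          exact absurd ((hmax hi hhi (hsy.trans hyh) h').trans (hba.trans (hay.trans h)))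
            (not_le.2 hlh)
        · rcases le_total s z with h | h
          · exact (hmax z hz h hzt).trans (hba.trans hay)
          · exact h.trans hsy
  · have hno : ∀ z ∈ E, s ≤ z → t < z := by
      intro z hz hsz
      by_contra! h
      exact hT ⟨z, Finset.mem_filter.2 ⟨hz, hsz, h⟩⟩
    -- With no element of `E` in `[s,t]` the two gaps coincide, so one suffices.
    refine ⟨D₀, by omega, hD₀', ?_⟩
    rintro cov x y hsy hyt hcov ⟨lo, hlo, hi, hhi, hly, hyh, hlh, hg⟩
    refine low cov x y lo hi hsy (fun z hz hsz => hyt.trans (hno z hz hsz).le) hlo hhi ?_ hyh hg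
    by_contra! h
    exact absurd (hno lo hlo h) (not_lt.2 (hly.trans hyt))

/-- At an end of the edge a single affix replaces the two dyadic pairs and the outer gap, which
halves the count. -/
theorem exists_coversBetween_bot [OrderBot α] (E : Finset α) (t : α) :
    ∃ D : Finset (α × α), D.card ≤ 2 ∧
      (∀ p ∈ D, p.1 ≤ p.2 ∧ (IsDyadicPair E p.1 p.2 ∨ (p.1 = ⊥ ∧ p.2 ∈ E))) ∧
      CoversBetween E ⊥ t D := by
  classical
  obtain ⟨D₁, hD₁, hD₁', hhigh⟩ := exists_gap_above E t
  by_cases hT : (E.filter (· ≤ t)).Nonempty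
  · have mb := Finset.mem_filter.1 (Finset.max'_mem _ hT)
    have hmax : ∀ z ∈ E, z ≤ t → z ≤ (E.filter (· ≤ t)).max' hT :=
      fun z h1 h2 => Finset.le_max' _ _ (Finset.mem_filter.2 ⟨h1, h2⟩)
    set b := (E.filter (· ≤ t)).max' hT
    refine ⟨insert (⊥, b) D₁, (Finset.card_insert_le _ _).trans (by omega), ?_, ?_⟩
    · intro p hp
      rcases Finset.mem_insert.1 hp with rfl | hp
      · exact ⟨bot_le, Or.inr ⟨rfl, mb.1⟩⟩
      · exact ⟨(hD₁' p hp).1, Or.inl (hD₁' p hp).2⟩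
    · rintro cov x y - hyt hcov ⟨lo, hlo, hi, hhi, hly, hyh, hlh, hg⟩
      rcases le_or_gt y b with h | h
      · exact ⟨(⊥, b), Finset.mem_insert_self _ _, hcov _ _ le_rfl bot_le h mb.2⟩
      · obtain ⟨p, hp, q1, q2, q3, q4, q5⟩ := hhigh y lo hi hyt
          (fun z hz hzt => (hmax z hz hzt).trans h.le) hlo hhi
          (by
            by_contra! h'
            exact absurd (hmax hi hhi h') (not_le.2 (h.trans_le hyh))) hly
        exact ⟨p, Finset.mem_insert_of_mem hp,
          hg _ (hD₁' p hp).2.1 _ (hD₁' p hp).2.2.1 q1 q2 q3 q4 q5⟩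
  · refine ⟨∅, by simp, by simp, ?_⟩
    rintro cov x y - hyt hcov ⟨lo, hlo, hi, hhi, hly, -⟩
    exact (hT ⟨lo, Finset.mem_filter.2 ⟨hlo, hly.trans hyt⟩⟩).elim

theorem exists_coversBetween_top [OrderTop α] (E : Finset α) (s : α) :
    ∃ D : Finset (α × α), D.card ≤ 2 ∧
      (∀ p ∈ D, p.1 ≤ p.2 ∧ (IsDyadicPair E p.1 p.2 ∨ (p.1 ∈ E ∧ p.2 = ⊤))) ∧
      CoversBetween E s ⊤ D := by
  classical
  obtain ⟨D₀, hD₀, hD₀', hlow⟩ := exists_gap_below E s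
  by_cases hT : (E.filter (s ≤ ·)).Nonempty
  · have ma := Finset.mem_filter.1 (Finset.min'_mem _ hT)
    have hmin : ∀ z ∈ E, s ≤ z → (E.filter (s ≤ ·)).min' hT ≤ z :=
      fun z h1 h2 => Finset.min'_le _ _ (Finset.mem_filter.2 ⟨h1, h2⟩)
    set a := (E.filter (s ≤ ·)).min' hT
    refine ⟨insert (a, ⊤) D₀, (Finset.card_insert_le _ _).trans (by omega), ?_, ?_⟩
    · intro p hp
      rcases Finset.mem_insert.1 hp with rfl | hp
      · exact ⟨le_top, Or.inr ⟨ma.1, rfl⟩⟩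
      · exact ⟨(hD₀' p hp).1, Or.inl (hD₀' p hp).2⟩
    · rintro cov x y hsy - hcov ⟨lo, hlo, hi, hhi, hly, hyh, hlh, hg⟩
      rcases le_or_gt a y with h | h
      · exact ⟨(a, ⊤), Finset.mem_insert_self _ _, hcov _ _ ma.2 h le_top le_rfl⟩
      · obtain ⟨p, hp, q1, q2, q3, q4, q5⟩ := hlow y lo hi hsy
          (fun z hz hsz => h.le.trans (hmin z hz hsz)) hlo hhi
          (by
            by_contra! h'
            exact absurd (hmin lo hlo h') (not_le.2 (hly.trans_lt h))) hyh
        exact ⟨p, Finset.mem_insert_of_mem hp,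
          hg _ (hD₀' p hp).2.1 _ (hD₀' p hp).2.2.1 q1 q2 q3 q4 q5⟩
  · refine ⟨∅, by simp, by simp, ?_⟩
    rintro cov x y hsy - hcov ⟨lo, hlo, hi, hhi, hly, hyh, -⟩
    exact (hT ⟨hi, Finset.mem_filter.2 ⟨hhi, hsy.trans hyh⟩⟩).elim

end Dyadic

/-! ### Matched paths -/

section Paths

variable {d : ℕ}

/-- Continuous monotone traversals of two curves that stay at distance at most `δ`. -/
structure IsMatching (γ η : Curve d) (δ : ℝ) (X Y : unitInterval → unitInterval) : Prop where
  continuous_left : Continuous X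
  monotone_left : Monotone X
  continuous_right : Continuous Y
  monotone_right : Monotone Y
  dist_le : ∀ u, dist (γ (X u)) (η (Y u)) ≤ δ

/-- By the intermediate value theorem `Y` attains `a` before `u` and `b` after `u`; cutting there
keeps the point `X u` on the path. -/
theorem IsMatching.restrict {γ η : Curve d} {δ : ℝ} {X Y : unitInterval → unitInterval}
    (h : IsMatching γ η δ X Y) {u a b : unitInterval} (ha : Y 0 ≤ a) (hau : a ≤ Y u)
    (hub : Y u ≤ b) (hb : b ≤ Y 1) :
    ∃ X' Y', IsMatching γ η δ X' Y' ∧ Y' 0 = a ∧ Y' 1 = b ∧ ∃ u', X' u' = X u := by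
  obtain ⟨u₀, hu₀, h₀⟩ := intermediate_value_Icc (unitInterval.nonneg' (t := u))
    h.continuous_right.continuousOn ⟨ha, hau⟩
  obtain ⟨u₁, hu₁, h₁⟩ := intermediate_value_Icc (unitInterval.le_one' (t := u))
    h.continuous_right.continuousOn ⟨hub, hb⟩
  have hm := intervalPoint_monotone (hu₀.2.trans hu₁.1)
  have hc : Continuous (intervalPoint u₀ u₁) :=
    continuous_intervalPoint.comp (f := fun u => (u₀, u₁, u)) (by fun_prop)
  obtain ⟨u', hu'⟩ := exists_intervalPoint_eq (show u ∈ Icc u₀ u₁ from ⟨hu₀.2, hu₁.1⟩)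
  exact ⟨fun w => X (intervalPoint u₀ u₁ w), fun w => Y (intervalPoint u₀ u₁ w),
    ⟨h.continuous_left.comp hc, h.monotone_left.comp hm, h.continuous_right.comp hc,
      h.monotone_right.comp hm, fun w => h.dist_le _⟩,
    by simp only [intervalPoint_zero, h₀], by simp only [intervalPoint_one, h₁], u', by
      simp only [hu']⟩

theorem IsMatching.mem_coverage {γ η : Curve d} {δ : ℝ} {X Y : unitInterval → unitInterval}
    (h : IsMatching γ η δ X Y) (u : unitInterval) :
    (X u : ℝ) ∈ coverage γ {subcurve η (Y 0) (Y 1)} δ :=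
  ⟨_, rfl, X 0, X 1, h.monotone_left zero_le_one,
    frechetDist_subcurve_le h.continuous_left h.monotone_left h.continuous_right h.monotone_right
      h.dist_le, h.monotone_left unitInterval.nonneg', h.monotone_left unitInterval.le_one'⟩

theorem intervalPoint_le_iff {a b u v : unitInterval} (hab : a < b) :
    intervalPoint a b u ≤ intervalPoint a b v ↔ u ≤ v := by
  have h : (a : ℝ) < b := hab
  rw [← Subtype.coe_le_coe, coe_intervalPoint, coe_intervalPoint, add_le_add_iff_left,
    mul_le_mul_iff_left₀ (by linarith), Subtype.coe_le_coe]

/-- A traversal of `η` that stays in `[a,b]` is a traversal of the subcurve `η[a,b]`. -/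
theorem IsMatching.exists_subcurve {γ η : Curve d} {δ : ℝ} {X G : unitInterval → unitInterval}
    (h : IsMatching γ η δ X G) {a b : unitInterval} (hab : a < b) (hG : ∀ w, G w ∈ Icc a b) :
    ∃ Y, IsMatching γ (subcurve η a b) δ X Y ∧ ∀ w, intervalPoint a b (Y w) = G w := by
  choose Y hY using fun w => exists_intervalPoint_eq (hG w)
  have hlt : (a : ℝ) < b := hab
  have hne : (b : ℝ) - a ≠ 0 := by linarith
  refine ⟨Y, ⟨h.continuous_left, h.monotone_left, ?_, fun w w' hw => ?_, fun w => ?_⟩, hY⟩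
  · rw [Topology.IsInducing.subtypeVal.continuous_iff]
    have hc := h.continuous_right
    have : Continuous fun w => ((G w : ℝ) - a) / (b - a) := by fun_prop
    refine this.congr fun w => ?_
    rw [← hY w, coe_intervalPoint]
    simp only [Function.comp_apply]
    field_simp
    ring
  · rw [← intervalPoint_le_iff hab, hY, hY]
    exact h.monotone_right hw
  · rw [subcurve_apply, hY]
    exact h.dist_le w

/-- The subcurve `S[s',t']` belongs to `P[s₀,t₀]`, yet it also matches `P[s,t]`: go from `P[s,t]` to
`q`, to `P[s₀,t₀]`, to `S[s',t']` at cost `Δ + Δ + 2Δ`. -/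
theorem exists_isMatching_of_frechetDist_le {P q S : Curve d} (hP : Continuous P)
    (hq : Continuous q) (hS : Continuous S) {Δ : ℝ} (hΔ : 0 ≤ Δ) {s t s₀ t₀ s' t' : unitInterval}
    (hst : s ≤ t) (hst' : s' ≤ t')
    (h : frechetDist (subcurve P s t) q ≤ ENNReal.ofReal Δ)
    (h₀ : frechetDist (subcurve P s₀ t₀) q ≤ ENNReal.ofReal Δ)
    (h' : frechetDist (subcurve P s₀ t₀) (subcurve S s' t') ≤ ENNReal.ofReal (2 * Δ))
    {x : unitInterval} (hx : x ∈ Icc s t) :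
    ∃ X G, IsMatching P S (4 * Δ) X G ∧ G 0 = s' ∧ G 1 = t' ∧ ∃ u, X u = x := by
  rw [frechetDist_comm] at h₀
  have h1 := frechetDist_triangle_le (Continuous.subcurve hP s₀ t₀) (Continuous.subcurve hS s' t')
    (by positivity) (by positivity)
    (frechetDist_triangle_le hq (Continuous.subcurve hP s₀ t₀) hΔ hΔ h h₀) h'
  rw [show Δ + Δ + 2 * Δ = 4 * Δ by ring, frechetDist_le_iff (Continuous.subcurve hP s t)
    (Continuous.subcurve hS s' t') (by positivity)] at h1
  obtain ⟨F, hF, G, hG, hd⟩ := h1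
  have hc : ∀ a b, Continuous (intervalPoint a b) := fun a b =>
    continuous_intervalPoint.comp (f := fun u => (a, b, u)) (by fun_prop)
  obtain ⟨w, hw⟩ := exists_intervalPoint_eq hx
  obtain ⟨u, hu⟩ := (surjective_of_mem_normalizedMaps hF).2 w
  exact ⟨fun u => intervalPoint s t (F u), fun u => intervalPoint s' t' (G u),
    ⟨(hc _ _).comp (continuous_of_mem_normalizedMaps hF), (intervalPoint_monotone hst).comp hF.1,
      (hc _ _).comp (continuous_of_mem_normalizedMaps hG), (intervalPoint_monotone hst').comp hG.1,
      hd⟩,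
    by simp only [hG.2.1, intervalPoint_zero], by simp only [hG.2.2.1, intervalPoint_one], u, by
      simp only [hu, hw]⟩

end Paths

/-! ### The height sets as finite sets of parameters -/

section HeightFinset

variable {d : ℕ} {P : PolygonalCurve d} {A : Set (ℝ × ℝ)}

theorem exists_heightFinset (h : IsPiecewiseLinear P A) :
    ∃ E : Finset unitInterval, heights P A = (fun z : unitInterval => (z : ℝ)) '' E := by
  have hfin : {z : unitInterval | (z : ℝ) ∈ heights P A}.Finite :=
    (finite_heights h).preimage Subtype.val_injective.injOn
  refine ⟨hfin.toFinset, ?_⟩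
  ext y
  constructor
  · intro hy
    exact ⟨⟨y, heights_subset_Icc hy⟩, by simpa using hy, rfl⟩
  · rintro ⟨z, hz, rfl⟩
    simpa using hz

theorem IsDyadicPair.isTypeThree {E : Finset unitInterval} {s t : unitInterval}
    (h : IsDyadicPair E s t) : IsTypeThree ((fun z : unitInterval => (z : ℝ)) '' E) s t := by
  obtain ⟨hs, ht, m, hm, hcard⟩ := h
  refine ⟨⟨s, hs, rfl⟩, ⟨t, ht, rfl⟩, m, ?_, ?_⟩
  · rwa [ncard_image_of_injective _ Subtype.val_injective, ncard_coe_finset]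
  · rw [← hcard, ← ncard_coe_finset, ← ncard_image_of_injective _ Subtype.val_injective]
    congr 1
    ext y
    constructor
    · rintro ⟨⟨z, hz, rfl⟩, h1, h2⟩
      exact ⟨z, by simpa using ⟨hz, h1, h2⟩, rfl⟩
    · rintro ⟨z, hz, rfl⟩
      have hz' := Finset.mem_filter.1 (Finset.mem_coe.1 hz)
      exact ⟨⟨z, hz'.1, rfl⟩, hz'.2⟩

theorem IsTypeTwo.le {E : Set ℝ} {s t : unitInterval} (h : IsTypeTwo E s t) : s ≤ t := by
  rcases h with ⟨rfl, -⟩ | ⟨-, rfl⟩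
  · exact unitInterval.nonneg'
  · exact unitInterval.le_one'

theorem IsTypeThree.le {E : Set ℝ} {s t : unitInterval} (h : IsTypeThree E s t) : s ≤ t := by
  obtain ⟨-, -, m, -, hm⟩ := h
  by_contra! hlt
  have : Ioc (s : ℝ) t = ∅ := Ioc_eq_empty (not_lt.2 (show (t : ℝ) ≤ s from hlt.le))
  rw [this, inter_empty, ncard_empty] at hm
  exact absurd hm.symm (by positivity)

theorem gapCovered_bothRegion {E : Finset unitInterval} (h : IsPiecewiseLinear P A)
    (hE : heights P A = (fun z : unitInterval => (z : ℝ)) '' E) {i : Fin P.numEdges}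
    (hconv : Convex ℝ (cellRegion P A i)) {x : ℝ} {y : unitInterval}
    (hxy : (x, (y : ℝ)) ∈ cellRegion P A i) :
    GapCovered E (fun s t => bothRegion P A s t) x y := by
  obtain ⟨p, hp, q, hq, hpy, hyq, hpq⟩ := exists_heights_around h hconv hxy
  have hpE := snd_mem_heights hp
  have hqE := snd_mem_heights hq
  rw [hE] at hpE hqE
  obtain ⟨lo, hlo, hlo'⟩ := hpE
  obtain ⟨hi, hhi, hhi'⟩ := hqE
  simp only at hlo' hhi'
  rw [← hlo'] at hpy hpq
  rw [← hhi'] at hyq hpq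
  refine ⟨lo, hlo, hi, hhi, hpy, hyq, hpq, fun h₀ _ h₁ _ h1 h2 h3 h4 hgap => ?_⟩
  refine mem_bothRegion_of_heights h hconv hxy h2 h3 ?_ ⟨p, hp, hlo' ▸ h1⟩ ⟨q, hq, hhi' ▸ h4⟩
  rw [hE]
  rintro _ ⟨z, hz, rfl⟩
  exact hgap z hz

end HeightFinset

/-! ### Covering matched paths by candidates -/

section Cover

variable {d : ℕ} {P S : PolygonalCurve d} {A : Fin S.numEdges → Set (ℝ × ℝ)} {α δ : ℝ} {l : ℕ}

/-- Supplies both inputs of `CoversBetween`: restricting the traversal to any heights around `G u`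
inside the range gives the forward reach region there, and the cell polygon containing the matched
point gives the gaps. -/
theorem IsMatching.exists_mem_bothRegion {e : Fin S.numEdges}
    (hA : IsApproxFreeSpace P (S.edge e) α δ (A e)) (hlin : IsPiecewiseLinear P (A e))
    {E : Finset unitInterval} (hE : heights P (A e) = (fun z : unitInterval => (z : ℝ)) '' E)
    {s t : unitInterval} {D : Finset (unitInterval × unitInterval)} (hD : CoversBetween E s t D)
    {X G : unitInterval → unitInterval} (h : IsMatching P.toCurve S.toCurve δ X G)
    (hs : G 0 ≤ intervalPoint (S.time e.castSucc) (S.time e.succ) s)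
    (ht : intervalPoint (S.time e.castSucc) (S.time e.succ) t ≤ G 1) {u : unitInterval}
    (hsu : intervalPoint (S.time e.castSucc) (S.time e.succ) s ≤ G u)
    (hut : G u ≤ intervalPoint (S.time e.castSucc) (S.time e.succ) t) :
    ∃ p ∈ D, (X u : ℝ) ∈ bothRegion P (A e) p.1 p.2 := by
  have hlt := S.time_lt e
  set a := S.time e.castSucc with ha
  set b := S.time e.succ with hb
  have hmem : ∀ v, intervalPoint a b v ∈ Icc a b := intervalPoint_mem hlt.le
  obtain ⟨y, hy⟩ := exists_intervalPoint_eq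
    (show G u ∈ Icc a b from ⟨(hmem s).1.trans hsu, hut.trans (hmem t).2⟩)
  rw [← hy, intervalPoint_le_iff hlt] at hsu hut
  have hmono := intervalPoint_monotone hlt.le
  have hcov := hA.subset_iUnion_cellRegion
  refine hD (fun s t => bothRegion P (A e) s t) (X u) y hsu hut (fun v w h1 h2 h3 h4 => ?_) ?_
  · obtain ⟨X', G', hm, h0, h1', u', hu'⟩ := h.restrict (u := u) (hs.trans (hmono h1))
      (hy ▸ hmono h2) (hy ▸ hmono h3) ((hmono h4).trans ht)
    obtain ⟨Y, hY, hYG⟩ := hm.exists_subcurve hlt fun w =>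
      ⟨(hmem v).1.trans (h0 ▸ hm.monotone_right unitInterval.nonneg'),
        ((hm.monotone_right unitInterval.le_one').trans_eq h1').trans (hmem _).2⟩
    have inj : ∀ z z', intervalPoint a b z = intervalPoint a b z' → z = z' := fun z z' h =>
      le_antisymm ((intervalPoint_le_iff hlt).1 h.le) ((intervalPoint_le_iff hlt).1 h.ge)
    have e0 : Y 0 = v := inj _ _ (by rw [hYG, h0])
    have e1 : Y 1 = w := inj _ _ (by rw [hYG, h1'])
    have := mem_reachRegion_of_path hA.lower hcov hY.continuous_left hY.monotone_left
      hY.continuous_right hY.monotone_right hY.dist_le u'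
    rw [e0, e1, hu'] at this
    exact Or.inl this
  · have : ((X u : ℝ), (y : ℝ)) ∈ A e := by
      refine hA.lower ⟨X u, y, rfl, ?_⟩
      have := h.dist_le u
      rwa [← hy] at this
    obtain ⟨i, hi⟩ := mem_iUnion.1 (hcov this)
    exact gapCovered_bothRegion hlin hE (hA.convex_cellRegion i) hi

/-- At most `n` candidates suffice to cover, up to finitely many points, the part between the
heights `a` and `b` of all traversals of `P` along `S[s,t]`. -/
def PathsCovered (P : PolygonalCurve d) (A : Fin S.numEdges → Set (ℝ × ℝ)) (δ : ℝ) (l : ℕ)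
    (s t : unitInterval) (n : ℕ) (a b : unitInterval) : Prop :=
  ∃ C : Finset (Candidate S), C.card ≤ n ∧
    (∀ c ∈ C, IsCandidate l (fun e => heights P (A e)) c) ∧ ∃ N : Set ℝ, N.Finite ∧
    ∀ X G, IsMatching P.toCurve S.toCurve δ X G → G 0 = s → G 1 = t → ∀ u, a ≤ G u → G u ≤ b →
      (X u : ℝ) ∈ N ∪ ⋃ c ∈ C, proxyCoverage P δ A c

theorem PathsCovered.trans {s t a b c : unitInterval} {m n : ℕ}
    (h : PathsCovered P A δ l s t m a b) (h' : PathsCovered P A δ l s t n b c) :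
    PathsCovered P A δ l s t (m + n) a c := by
  classical
  obtain ⟨C, hC, hadm, N, hN, hcov⟩ := h
  obtain ⟨C', hC', hadm', N', hN', hcov'⟩ := h'
  refine ⟨C ∪ C', (Finset.card_union_le _ _).trans (add_le_add hC hC'), ?_, N ∪ N', hN.union hN',
    fun X G hm h0 h1 u hau huc => ?_⟩
  · intro c hc
    exact (Finset.mem_union.1 hc).elim (hadm c) (hadm' c)
  · rw [Finset.set_biUnion_union]
    rcases le_total (G u) b with h | h
    · rcases hcov X G hm h0 h1 u hau h with h | h
      · exact Or.inl (Or.inl h)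
      · exact Or.inr (Or.inl h)
    · rcases hcov' X G hm h0 h1 u h huc with h | h
      · exact Or.inl (Or.inr h)
      · exact Or.inr (Or.inr h)

/-- Each pair of heights contributes a subedge and its reversal, hence the factor `2`. -/
theorem pathsCovered_of_coversBetween {e : Fin S.numEdges}
    (hA : IsApproxFreeSpace P (S.edge e) α δ (A e)) (hlin : IsPiecewiseLinear P (A e))
    {E : Finset unitInterval} (hE : heights P (A e) = (fun z : unitInterval => (z : ℝ)) '' E)
    {s t : unitInterval} {D : Finset (unitInterval × unitInterval)} (hD : CoversBetween E s t D)
    (hadm : ∀ p ∈ D, p.1 ≤ p.2 ∧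
      (IsTypeTwo (heights P (A e)) p.1 p.2 ∨ IsTypeThree (heights P (A e)) p.1 p.2))
    {s' t' : unitInterval}
    (hs : s' ≤ intervalPoint (S.time e.castSucc) (S.time e.succ) s)
    (ht : intervalPoint (S.time e.castSucc) (S.time e.succ) t ≤ t') {n : ℕ}
    (hn : 2 * D.card ≤ n) :
    PathsCovered P A δ l s' t' n (intervalPoint (S.time e.castSucc) (S.time e.succ) s)
      (intervalPoint (S.time e.castSucc) (S.time e.succ) t) := by
  classical
  have hN : ∀ p : unitInterval × unitInterval, ∃ N : Set ℝ, N.Finite ∧ (p.1 ≤ p.2 →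
      bothRegion P (A e) p.1 p.2 ⊆ N ∪ (subedgeProxy P (A e) p.1 p.2 ∪
        subedgeProxy P (mirror (A e)) (1 - (p.2 : ℝ)) (1 - (p.1 : ℝ)))) := by
    intro p
    by_cases hp : p.1 ≤ p.2
    · obtain ⟨N, hN, h⟩ := exists_finite_bothRegion_subset (fun i => hA.convex_cellRegion i)
        (show (p.1 : ℝ) ≤ p.2 from hp)
      exact ⟨N, hN, fun _ => h⟩
    · exact ⟨∅, finite_empty, fun h => absurd h hp⟩
  choose N hNfin hN using hN
  refine ⟨D.image (fun p => .subedge e p.1 p.2) ∪ D.image (fun p => .reversed e p.1 p.2), ?_, ?_,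
    ⋃ p ∈ D, N p, D.finite_toSet.biUnion fun p _ => hNfin p, ?_⟩
  · have h1 := Finset.card_union_le (D.image fun p => Candidate.subedge e p.1 p.2)
      (D.image fun p => Candidate.reversed e p.1 p.2)
    have h2 := Finset.card_image_le (s := D) (f := fun p => Candidate.subedge e p.1 p.2)
    have h3 := Finset.card_image_le (s := D) (f := fun p => Candidate.reversed e p.1 p.2)
    omega
  · intro c hc
    rcases Finset.mem_union.1 hc with hc | hc
    · obtain ⟨p, hp, rfl⟩ := Finset.mem_image.1 hc
      exact (hadm p hp).2
    · obtain ⟨p, hp, rfl⟩ := Finset.mem_image.1 hc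
      exact (hadm p hp).2
  · intro X G hm h0 h1 u hsu hut
    obtain ⟨p, hp, hpx⟩ := hm.exists_mem_bothRegion hA hlin hE hD (h0 ▸ hs) (h1 ▸ ht) hsu hut
    rcases hN p (hadm p hp).1 hpx with h | h | h
    · exact Or.inl (mem_iUnion₂.2 ⟨p, hp, h⟩)
    · exact Or.inr (mem_iUnion₂.2 ⟨.subedge e p.1 p.2,
        Finset.mem_union_left _ (Finset.mem_image_of_mem _ hp), h⟩)
    · exact Or.inr (mem_iUnion₂.2 ⟨.reversed e p.1 p.2,
        Finset.mem_union_right _ (Finset.mem_image_of_mem _ hp), h⟩)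

theorem pathsCovered_subedge {e : Fin S.numEdges}
    (hA : IsApproxFreeSpace P (S.edge e) α δ (A e)) (hlin : IsPiecewiseLinear P (A e))
    {s t : unitInterval} (hst : s ≤ t) (hs : S.time e.castSucc ≤ s) (ht : t ≤ S.time e.succ) :
    PathsCovered P A δ l s t 8 s t := by
  obtain ⟨E, hE⟩ := exists_heightFinset hlin
  obtain ⟨s, rfl⟩ := exists_intervalPoint_eq ⟨hs, hst.trans ht⟩
  obtain ⟨t, rfl⟩ := exists_intervalPoint_eq ⟨hs.trans hst, ht⟩
  obtain ⟨D, hD, hD', hcov⟩ := exists_coversBetween E s t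
  exact pathsCovered_of_coversBetween hA hlin hE hcov
    (fun p hp => ⟨(hD' p hp).1, Or.inr (hE ▸ (hD' p hp).2.isTypeThree)⟩) le_rfl le_rfl (by omega)

theorem pathsCovered_prefix {e : Fin S.numEdges}
    (hA : IsApproxFreeSpace P (S.edge e) α δ (A e)) (hlin : IsPiecewiseLinear P (A e))
    {s t : unitInterval} (hs : s ≤ S.time e.castSucc)
    (ht : t ∈ Icc (S.time e.castSucc) (S.time e.succ)) :
    PathsCovered P A δ l s t 4 (S.time e.castSucc) t := by
  obtain ⟨E, hE⟩ := exists_heightFinset hlin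
  obtain ⟨t, rfl⟩ := exists_intervalPoint_eq ht
  obtain ⟨D, hD, hD', hcov⟩ := exists_coversBetween_bot E t
  have h0 : intervalPoint (S.time e.castSucc) (S.time e.succ) ⊥ = S.time e.castSucc :=
    intervalPoint_zero _ _
  have := pathsCovered_of_coversBetween (l := l) (s' := s) hA hlin hE hcov
    (fun p hp => ⟨(hD' p hp).1, (hD' p hp).2.symm.imp
      (fun h => Or.inl ⟨h.1, hE ▸ mem_image_of_mem _ h.2⟩) (fun h => hE ▸ h.isTypeThree)⟩)
    (hs.trans_eq h0.symm) le_rfl (n := 4) (by omega)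
  rwa [h0] at this

theorem pathsCovered_suffix {e : Fin S.numEdges}
    (hA : IsApproxFreeSpace P (S.edge e) α δ (A e)) (hlin : IsPiecewiseLinear P (A e))
    {s t : unitInterval} (hs : s ∈ Icc (S.time e.castSucc) (S.time e.succ))
    (ht : S.time e.succ ≤ t) :
    PathsCovered P A δ l s t 4 s (S.time e.succ) := by
  obtain ⟨E, hE⟩ := exists_heightFinset hlin
  obtain ⟨s, rfl⟩ := exists_intervalPoint_eq hs
  obtain ⟨D, hD, hD', hcov⟩ := exists_coversBetween_top E s
  have h1 : intervalPoint (S.time e.castSucc) (S.time e.succ) ⊤ = S.time e.succ :=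
    intervalPoint_one _ _
  have := pathsCovered_of_coversBetween (l := l) (t' := t) hA hlin hE hcov
    (fun p hp => ⟨(hD' p hp).1, (hD' p hp).2.symm.imp
      (fun h => Or.inr ⟨hE ▸ mem_image_of_mem _ h.1, h.2⟩) (fun h => hE ▸ h.isTypeThree)⟩)
    le_rfl (h1.trans_le ht) (n := 4) (by omega)
  rwa [h1] at this

/-- With `2^m ≤ j - i < 2^(m+1)`, the windows of `2^m` edges starting at `i` and ending at `j`
overlap and cover everything. Their proxy is the exact coverage, so no exceptional points arise. -/
theorem pathsCovered_vertexVertex {s t : unitInterval} {i j : Fin (S.numEdges + 1)}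
    (hij : i < j) (hl : (j : ℕ) - i + 1 ≤ l) (hs : s ≤ S.time i) (ht : S.time j ≤ t) :
    PathsCovered P A δ l s t 2 (S.time i) (S.time j) := by
  classical
  have hij' : (i : ℕ) < j := hij
  have hj := j.2
  set n : ℕ := (j : ℕ) - i
  have hn0 : n ≠ 0 := by omega
  set m := Nat.log 2 n
  have hm1 : 2 ^ m ≤ n := Nat.pow_log_le_self 2 hn0
  have hm2 : n < 2 ^ (m + 1) := Nat.lt_pow_succ_log_self one_lt_two n
  rw [pow_succ] at hm2
  let j' : Fin (S.numEdges + 1) := ⟨i + 2 ^ m, by omega⟩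
  let i' : Fin (S.numEdges + 1) := ⟨j - 2 ^ m, by omega⟩
  have hmono := S.time_strictMono.monotone
  have hi'j' : S.time i' ≤ S.time j' := hmono (by rw [Fin.mk_le_mk]; omega)
  have hii' : S.time i ≤ S.time i' := hmono (by rw [Fin.le_def]; simp only [i']; omega)
  have hj'j : S.time j' ≤ S.time j := hmono (by rw [Fin.le_def]; simp only [j']; omega)
  refine ⟨{.vertexVertex i j', .vertexVertex i' j}, Finset.card_le_two, ?_, ∅, finite_empty, ?_⟩
  · intro c hc
    rcases Finset.mem_insert.1 hc with rfl | hc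
    · exact ⟨m, rfl, by omega⟩
    · rw [Finset.mem_singleton.1 hc]
      exact ⟨m, by simp only [i']; omega, by omega⟩
  · intro X G hm h0 h1 u hiu huj
    have key : ∀ a b : Fin (S.numEdges + 1), S.time i ≤ S.time a → S.time b ≤ S.time j →
        S.time a ≤ G u → G u ≤ S.time b →
        (X u : ℝ) ∈ coverage P.toCurve {subcurve S.toCurve (S.time a) (S.time b)} δ := by
      intro a b ha hb hau hub
      obtain ⟨X', G', hm', e0, e1, u', hu'⟩ := hm.restrict (h0 ▸ hs.trans ha) hau hub
        (h1 ▸ hb.trans ht)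
      have := hm'.mem_coverage u'
      rwa [e0, e1, hu'] at this
    refine Or.inr (mem_iUnion₂.2 ?_)
    rcases le_total (G u) (S.time j') with h | h
    · exact ⟨.vertexVertex i j', by simp, key i j' le_rfl hj'j hiu h⟩
    · exact ⟨.vertexVertex i' j, by simp, key i' j hii' le_rfl (hi'j'.trans h) huj⟩

theorem PathsCovered.mono {s t a b : unitInterval} {m n : ℕ}
    (h : PathsCovered P A δ l s t m a b) (hmn : m ≤ n) : PathsCovered P A δ l s t n a b := by
  obtain ⟨C, hC, h⟩ := h
  exact ⟨C, hC.trans hmn, h⟩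

/-- Ten candidates suffice to cover all traversals of `P` along a subcurve of `S` of complexity at
most `l + 2`. -/
theorem pathsCovered_of_subcurveComplexity_le
    (hA : ∀ e, IsApproxFreeSpace P (S.edge e) α δ (A e))
    (hlin : ∀ e, IsPiecewiseLinear P (A e)) {s t : unitInterval} (hst : s ≤ t)
    (h : S.subcurveComplexity s t ≤ l + 2) : PathsCovered P A δ l s t 10 s t := by
  classical
  set I : Finset (Fin (S.numEdges + 1)) := Finset.univ.filter fun i => s < S.time i ∧ S.time i < t
    with hI
  have hmemI : ∀ i, i ∈ I ↔ s < S.time i ∧ S.time i < t := fun i => by simp [hI]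
  have hcard : I.card ≤ l := by
    have : {i : Fin (S.numEdges + 1) | s < S.time i ∧ S.time i < t} = I := by
      ext i
      simp [hI]
    rw [PolygonalCurve.subcurveComplexity, this, ncard_coe_finset] at h
    omega
  have hmono := S.time_strictMono
  -- Without inner vertices the subcurve lies on one edge and costs `8`. Otherwise the cost is `4 +
  -- 2 + 4`, without the `2` if there is only one inner vertex.
  rcases I.eq_empty_or_nonempty with hemp | hne
  · obtain ⟨e, he1, he2⟩ : ∃ e : Fin S.numEdges, S.time e.castSucc ≤ s ∧ t ≤ S.time e.succ := by
      rcases lt_or_eq_of_le (show s ≤ 1 from unitInterval.le_one') with hs | hs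
      · obtain ⟨e, he1, he2⟩ := S.exists_edge hs
        refine ⟨e, he1, ?_⟩
        by_contra! hlt
        have := (hmemI e.succ).2 ⟨he2, hlt⟩
        simp [hemp] at this
      · obtain ⟨e, he⟩ := S.exists_edge_Icc s
        exact ⟨e, he.1, (show t ≤ 1 from unitInterval.le_one').trans (hs ▸ he.2)⟩
    exact (pathsCovered_subedge (hA e) (hlin e) hst he1 he2).mono (by norm_num)
  · set i := I.min' hne with hi
    set j := I.max' hne with hj
    have hiI := (hmemI i).1 (I.min'_mem hne)
    have hjI := (hmemI j).1 (I.max'_mem hne)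
    have hij : i ≤ j := I.min'_le_max' hne
    have hi0 : i ≠ 0 := by
      intro h0
      rw [h0, S.time_zero] at hiI
      exact absurd hiI.1 (not_lt.2 unitInterval.nonneg')
    have hjl : j ≠ Fin.last _ := by
      intro h0
      rw [h0, S.time_last] at hjI
      exact absurd hjI.2 (not_lt.2 unitInterval.le_one')
    obtain ⟨e, he⟩ := Fin.exists_succ_eq.2 hi0
    obtain ⟨f, hf⟩ := Fin.exists_castSucc_eq.2 hjl
    have hes : S.time e.castSucc ≤ s := by
      by_contra! hlt
      have h1 : e.castSucc < i := he ▸ Fin.castSucc_lt_succ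
      exact absurd (I.min'_le _ ((hmemI _).2 ⟨hlt, (hmono h1).trans hiI.2⟩)) (not_le.2 h1)
    have hft : t ≤ S.time f.succ := by
      by_contra! hlt
      have h1 : j < f.succ := hf ▸ Fin.castSucc_lt_succ
      exact absurd (I.le_max' _ ((hmemI _).2 ⟨hjI.1.trans (hmono h1), hlt⟩)) (not_le.2 h1)
    have hpre := pathsCovered_suffix (l := l) (s := s) (t := t) (hA e) (hlin e)
      ⟨hes, he ▸ hiI.1.le⟩ (he ▸ hiI.2.le)
    have hsuf := pathsCovered_prefix (l := l) (s := s) (t := t) (hA f) (hlin f)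
      (hf ▸ hjI.1.le) ⟨hf ▸ hjI.2.le, hft⟩
    rw [he] at hpre
    rw [hf] at hsuf
    rcases eq_or_lt_of_le hij with heq | hlt
    · rw [← heq] at hsuf
      exact (hpre.trans hsuf).mono (by norm_num)
    -- The vertices from `i` to `j` are all inner ones, so there are at most `l` of them; the `+ 2`
    -- in the simplification pays for the endpoints `s` and `t`.
    · have hsub : Finset.Icc i j ⊆ I := fun z hz => by
        rw [Finset.mem_Icc] at hz
        exact (hmemI z).2 ⟨hiI.1.trans_le (hmono.monotone hz.1),
          (hmono.monotone hz.2).trans_lt hjI.2⟩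
      have hc := (Finset.card_le_card hsub).trans hcard
      rw [Fin.card_Icc] at hc
      have hlt' : (i : ℕ) < j := hlt
      have hmid := pathsCovered_vertexVertex (P := P) (A := A) (δ := δ) (l := l) (s := s) (t := t)
        hlt (by omega) hiI.1.le hjI.2.le
      exact (hpre.trans hmid).trans hsuf

/-- The coverage of a curve of complexity at most `l` is covered, up to finitely many points, by
the proxy coverages of ten candidates. -/
theorem exists_candidates_cover {Δ : ℝ} (hΔ : 0 ≤ Δ) (hS : IsSimplification P S Δ l)
    (hA : ∀ e, IsApproxFreeSpace P (S.edge e) α (4 * Δ) (A e))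
    (hlin : ∀ e, IsPiecewiseLinear P (A e)) {q : Curve d} (hq : q ∈ curveSpace d l) :
    ∃ C : Finset (Candidate S), C.card ≤ 10 ∧
      (∀ c ∈ C, IsCandidate l (fun e => heights P (A e)) c) ∧ ∃ N : Set ℝ, N.Finite ∧
      coverage P.toCurve {q} Δ ⊆ N ∪ ⋃ c ∈ C, proxyCoverage P (4 * Δ) A c := by
  rcases (coverage P.toCurve {q} Δ).eq_empty_or_nonempty with hemp | ⟨_, _, rfl, s₀, t₀, hst₀, h₀, -⟩
  · exact ⟨∅, by simp, by simp, ∅, finite_empty, by simp [hemp]⟩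
  -- The simplification is used only once, for one arbitrary subcurve of `P` near `q`; the resulting
  -- `S[s',t']` serves all the others.
  · obtain ⟨s', t', hst', hd, hc⟩ := hS.2 _ hq s₀ t₀ hst₀ (by rwa [frechetDist_comm])
    obtain ⟨C, hC, hadm, N, hN, hcov⟩ := pathsCovered_of_subcurveComplexity_le hA hlin hst' hc
    refine ⟨C, hC, hadm, N, hN, ?_⟩
    rintro x ⟨_, rfl, s, t, hst, h, hx⟩
    obtain ⟨X, G, hm, h0, h1, u, hu⟩ := exists_isMatching_of_frechetDist_le P.continuous
      (continuous_of_mem_curveSpace hq) S.continuous hΔ hst hst' h h₀ hd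
      (x := ⟨x, s.2.1.trans hx.1, hx.2.trans t.2.2⟩) ⟨hx.1, hx.2⟩
    have := hcov X G hm h0 h1 u (h0 ▸ hm.monotone_right unitInterval.nonneg')
      (h1 ▸ hm.monotone_right unitInterval.le_one')
    rwa [hu] at this

end Cover

/-! ### Candidates -/

section Candidates

variable {d : ℕ} {P S : PolygonalCurve d} {l : ℕ}

theorem curveSpace_mono {m n : ℕ} (h : m ≤ n) : curveSpace d m ⊆ curveSpace d n := by
  rintro _ ⟨P, hP, rfl⟩
  exact ⟨P, hP.trans h, rfl⟩

theorem lineMap_intervalPoint {V : Type*} [AddCommGroup V] [Module ℝ V] (a b : V)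
    (s t u : unitInterval) :
    AffineMap.lineMap a b (intervalPoint s t u : ℝ) =
      AffineMap.lineMap (k := ℝ) (AffineMap.lineMap (k := ℝ) a b (s : ℝ))
        (AffineMap.lineMap (k := ℝ) a b (t : ℝ)) (u : ℝ) := by
  simp only [coe_intervalPoint, AffineMap.lineMap_apply, vsub_eq_sub, vadd_eq_add]
  module

theorem lineMap_mem_curveSpace (a b : EuclideanSpace ℝ (Fin d)) :
    (fun u : unitInterval => AffineMap.lineMap a b (u : ℝ)) ∈ curveSpace d 2 := by
  refine ⟨⟨fun u : unitInterval => AffineMap.lineMap a b (u : ℝ), 1, ![0, 1], ?_, rfl, rfl, ?_⟩,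
    le_rfl, rfl⟩
  · rw [Fin.strictMono_iff_lt_succ]
    intro i
    fin_cases i
    exact zero_lt_one
  · intro i u
    rw [subcurve_apply, lineMap_intervalPoint]

theorem subcurve_edge_eq_lineMap (e : Fin S.numEdges) (s t : unitInterval) :
    ∃ a b, subcurve (S.edge e) s t = fun u : unitInterval => AffineMap.lineMap a b (u : ℝ) := by
  refine ⟨AffineMap.lineMap (S.toCurve (S.time e.castSucc)) (S.toCurve (S.time e.succ)) (s : ℝ),
    AffineMap.lineMap (S.toCurve (S.time e.castSucc)) (S.toCurve (S.time e.succ)) (t : ℝ),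
    funext fun u => ?_⟩
  rw [subcurve_apply, PolygonalCurve.edge, S.linear, lineMap_intervalPoint]

theorem subcurve_vertices_mem_curveSpace {i j : Fin (S.numEdges + 1)} {n : ℕ} (hn : 0 < n)
    (hij : (j : ℕ) = i + n) :
    subcurve S.toCurve (S.time i) (S.time j) ∈ curveSpace d (n + 1) := by
  have hj := j.2
  have hmono := S.time_strictMono
  let v : Fin (n + 1) → Fin (S.numEdges + 1) := fun k => ⟨i + k, by omega⟩
  have hlt : S.time i < S.time j := hmono (by rw [Fin.lt_def]; omega)
  have hmem : ∀ k, S.time (v k) ∈ Icc (S.time i) (S.time j) := fun k =>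
    ⟨hmono.monotone (by rw [Fin.le_def]; simp [v]),
      hmono.monotone (by rw [Fin.le_def]; simp only [v]; omega)⟩
  choose τ hτ using fun k => exists_intervalPoint_eq (hmem k)
  have inj : ∀ z z', intervalPoint (S.time i) (S.time j) z = intervalPoint (S.time i) (S.time j) z'
      → z = z' := fun z z' h =>
    le_antisymm ((intervalPoint_le_iff hlt).1 h.le) ((intervalPoint_le_iff hlt).1 h.ge)
  refine ⟨⟨subcurve S.toCurve (S.time i) (S.time j), n, τ, fun k k' hk => ?_, ?_, ?_, ?_⟩,
    le_rfl, rfl⟩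
  · rw [← not_le, ← intervalPoint_le_iff hlt, hτ, hτ, not_le]
    have : (k : ℕ) < k' := hk
    exact hmono (by rw [Fin.lt_def]; simp only [v]; omega)
  · refine inj _ _ ?_
    rw [hτ, intervalPoint_zero]
    congr 1
  · refine inj _ _ ?_
    rw [hτ, intervalPoint_one]
    congr 1
    ext
    simp [v, hij]
  · intro k u
    have := S.linear ⟨i + k, by omega⟩ u
    have e1 : (⟨i + k, by omega⟩ : Fin S.numEdges).castSucc = v k.castSucc := rfl
    have e2 : (⟨i + k, by omega⟩ : Fin S.numEdges).succ = v k.succ := by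
      ext
      simp [v, add_assoc]
    rw [e1, e2] at this
    rw [subcurve_subcurve, hτ, hτ, this, subcurve_apply, subcurve_apply, hτ, hτ]

theorem curve_mem_curveSpace (hl : 2 ≤ l) {E : Fin S.numEdges → Set ℝ} {c : Candidate S}
    (hc : IsCandidate l E c) : c.curve ∈ curveSpace d l := by
  cases c with
  | vertexVertex i j =>
    obtain ⟨m, hm, hml⟩ := hc
    exact curveSpace_mono hml (subcurve_vertices_mem_curveSpace (by positivity) hm)
  | subedge e s t =>
    obtain ⟨a, b, h⟩ := subcurve_edge_eq_lineMap e s t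
    rw [Candidate.curve, h]
    exact curveSpace_mono hl (lineMap_mem_curveSpace a b)
  | reversed e s t =>
    obtain ⟨a, b, h⟩ := subcurve_edge_eq_lineMap e s t
    have : (Candidate.reversed e s t).curve =
        fun u : unitInterval => AffineMap.lineMap b a (u : ℝ) := by
      funext u
      simp only [Candidate.curve, reverseCurve, h, unitInterval.coe_symm_eq,
        AffineMap.lineMap_apply_one_sub]
    rw [this]
    exact curveSpace_mono hl (lineMap_mem_curveSpace b a)

/-! ### Soundness and measurability of proxy coverages -/

variable {A : Fin S.numEdges → Set (ℝ × ℝ)} {α δ : ℝ}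

theorem proxyCoverage_subset_coverage (hα : 1 ≤ α) (hδ : 0 ≤ δ)
    (hA : ∀ e, IsApproxFreeSpace P (S.edge e) α δ (A e)) {E : Fin S.numEdges → Set ℝ}
    {c : Candidate S} (hc : IsCandidate l E c) :
    proxyCoverage P δ A c ⊆ coverage P.toCurve {c.curve} (α * δ) := by
  cases c with
  | vertexVertex i j => exact coverage_mono _ subset_rfl (le_mul_of_one_le_left hδ hα)
  | subedge e s t =>
    have hst : s ≤ t := hc.elim IsTypeTwo.le IsTypeThree.le
    exact (subedgeProxy_subset_reachRegion (fun i => (hA e).convex_cellRegion i) hst).trans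
      (reachRegion_subset_coverage (fun i => (hA e).convex_cellRegion i)
        ((hA e).closure_subset (S.continuous_edge e)) s t)
  | reversed e s t =>
    have hst : (s : ℝ) ≤ t := show s ≤ t from hc.elim IsTypeTwo.le IsTypeThree.le
    have hconv : ∀ i, Convex ℝ (cellRegion P (mirror (A e)) i) := fun i => by
      rw [cellRegion_mirror]
      exact convex_mirror ((hA e).convex_cellRegion i)
    have hcl : closure (mirror (A e)) ⊆
        freeSpace P.toCurve (reverseCurve (S.edge e)) (α * δ) := by
      rw [closure_mirror, freeSpace_reverseCurve]
      exact fun p hp => (hA e).closure_subset (S.continuous_edge e) hp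
    rw [Candidate.curve, reverseCurve_subcurve]
    have := reachRegion_subset_coverage hconv hcl (unitInterval.symm t) (unitInterval.symm s)
    rw [unitInterval.coe_symm_eq, unitInterval.coe_symm_eq] at this
    exact (subedgeProxy_subset_reachRegion hconv (by linarith)).trans this

theorem measurableSet_subedgeProxy (A : Set (ℝ × ℝ)) (s t : ℝ) :
    MeasurableSet (subedgeProxy P A s t) :=
  ((toFinite _).measurableSet_biUnion fun _ _ => measurableSet_Icc).union
    ((toFinite _).measurableSet_biUnion fun _ _ => measurableSet_Icc)

theorem measurableSet_proxyCoverage (hδ : 0 ≤ δ) (c : Candidate S) :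
    MeasurableSet (proxyCoverage P δ A c) := by
  cases c with
  | vertexVertex i j =>
    exact (isClosed_coverage P.continuous (Continuous.subcurve S.continuous _ _) hδ).measurableSet
  | subedge e s t => exact measurableSet_subedgeProxy _ _ _
  | reversed e s t => exact measurableSet_subedgeProxy _ _ _

end Candidates

/-! ### The greedy algorithm -/

/-- Convexity of `exp` between `0` and `-1`, with weights `15/16` and `1/16`. -/
theorem exp_neg_one_sixteenth_le :
    Real.exp (-(1 / 16)) ≤ 1 - (Real.exp 1 - 1) / (16 * Real.exp 1) := by
  have h := convexOn_exp.2 (mem_univ (0 : ℝ)) (mem_univ (-1 : ℝ))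
    (show (0 : ℝ) ≤ 15 / 16 by norm_num) (show (0 : ℝ) ≤ 1 / 16 by norm_num) (by norm_num)
  simp only [smul_eq_mul, Real.exp_zero, Real.exp_neg] at h
  have h2 : (15 / 16 * 0 + 1 / 16 * -1 : ℝ) = -(1 / 16) := by norm_num
  rw [h2] at h
  refine h.trans (le_of_eq ?_)
  have := Real.exp_pos 1
  field_simp
  ring

/-- The classical maximum-coverage argument with a family `D` that may be `16` times larger than the
number of rounds and may miss a null set of `O`. -/
theorem greedy_bound {α : Type*} {admissible : α → Prop} {cov : α → Set ℝ} {k : ℕ}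
    {c : Fin k → α} (hc : IsGreedyRun admissible cov c)
    (hmeas : ∀ i, MeasurableSet (cov (c i))) (hfin : ∀ i, cov (c i) ⊆ Icc 0 1) {O : Set ℝ}
    (hO : O ⊆ Icc 0 1) {D : Finset α} (hD : D.card ≤ 16 * k) (hadm : ∀ a ∈ D, admissible a)
    {N : Set ℝ} (hN : volume N = 0) (hcov : O ⊆ N ∪ ⋃ a ∈ D, cov a) :
    ENNReal.ofReal ((Real.exp 1 - 1) / (16 * Real.exp 1)) * volume O ≤
      volume (⋃ i, cov (c i)) := by
  rcases Nat.eq_zero_or_pos k with rfl | hk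
  · have hD0 : D = ∅ := Finset.card_eq_zero.1 (by omega)
    have : volume O = 0 := measure_mono_null (by simpa [hD0] using hcov) hN
    simp [this]
  have hfinite : ∀ T ⊆ Icc (0 : ℝ) 1, volume T ≠ ∞ := fun T hT =>
    ((measure_mono hT).trans_lt (by simp)).ne
  let U : ℕ → Set ℝ := fun n => ⋃ j ∈ {j : Fin k | (j : ℕ) < n}, cov (c j)
  have hUI : ∀ n, U n ⊆ Icc 0 1 := fun n => iUnion₂_subset fun j _ => hfin j
  have hUm : ∀ n, MeasurableSet (U n) := fun n =>
    (toFinite _).measurableSet_biUnion fun j _ => hmeas j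
  set o := volume.real O with ho
  set a : ℕ → ℝ := fun n => volume.real (U n) with ha
  have hkR : (0 : ℝ) < k := by exact_mod_cast hk
  -- The members of `D` cover the part of `O` outside `U n` up to a null set, and by the greedy
  -- choice none of them adds more than the chosen candidate does.
  have hstep : ∀ n < k, o ≤ a n + 16 * k * (a (n + 1) - a n) := by
    intro n hn
    let i : Fin k := ⟨n, hn⟩
    have hUi : (⋃ j : {j : Fin k // j < i}, cov (c j)) = U n := by
      rw [iUnion_subtype]
      rfl
    have hsucc : U (n + 1) = U n ∪ cov (c i) \ U n := by
      rw [union_sdiff_self]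
      ext x
      simp only [U, mem_union, mem_iUnion₂, mem_ofPred_eq, exists_prop]
      constructor
      · rintro ⟨j, hj, hx⟩
        rcases Nat.lt_succ_iff_lt_or_eq.1 hj with h | h
        · exact Or.inl ⟨j, h, hx⟩
        · obtain rfl : j = i := Fin.ext h
          exact Or.inr hx
      · rintro (⟨j, hj, hx⟩ | hx)
        · exact ⟨j, by omega, hx⟩
        · exact ⟨i, Nat.lt_succ_self n, hx⟩
    have hgain : a (n + 1) = a n + volume.real (cov (c i) \ U n) := by
      simp only [ha]
      rw [hsucc, measureReal_union disjoint_sdiff_right ((hmeas i).diff (hUm n))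
        (hfinite _ (hUI n)) (hfinite _ (sdiff_subset.trans (hfin i)))]
    have hbound : volume O ≤ volume (U n) + D.card * volume (cov (c i) \ U n) := by
      have hsub : O ⊆ N ∪ (U n ∪ ⋃ b ∈ D, cov b \ U n) := by
        intro x hx
        rcases hcov hx with h | h
        · exact Or.inl h
        · by_cases hxU : x ∈ U n
          · exact Or.inr (Or.inl hxU)
          · obtain ⟨b, hb, hxb⟩ := mem_iUnion₂.1 h
            exact Or.inr (Or.inr (mem_iUnion₂.2 ⟨b, hb, hxb, hxU⟩))
      calc volume O ≤ volume (N ∪ (U n ∪ ⋃ b ∈ D, cov b \ U n)) := measure_mono hsub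
        _ ≤ volume N + (volume (U n) + volume (⋃ b ∈ D, cov b \ U n)) :=
          (measure_union_le _ _).trans (add_le_add le_rfl (measure_union_le _ _))
        _ ≤ volume (U n) + ∑ b ∈ D, volume (cov b \ U n) := by
          rw [hN, zero_add]
          exact add_le_add le_rfl (measure_biUnion_finset_le _ _)
        _ ≤ volume (U n) + ∑ _b ∈ D, volume (cov (c i) \ U n) := by
          refine add_le_add le_rfl (Finset.sum_le_sum fun b hb => ?_)
          have := (hc i).2 b (hadm b hb)
          rwa [hUi] at this
        _ = _ := by rw [Finset.sum_const, nsmul_eq_mul]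
    have hgfin := hfinite _ (sdiff_subset.trans (hfin i) : cov (c i) \ U n ⊆ _)
    have hreal : o ≤ a n + D.card * volume.real (cov (c i) \ U n) := by
      have h := ENNReal.toReal_mono
        (ENNReal.add_ne_top.2 ⟨hfinite _ (hUI n),
          ENNReal.mul_ne_top (ENNReal.natCast_ne_top _) hgfin⟩) hbound
      rwa [ENNReal.toReal_add (hfinite _ (hUI n)) (ENNReal.mul_ne_top (ENNReal.natCast_ne_top _)
        hgfin), ENNReal.toReal_mul, ENNReal.toReal_natCast] at h
    have hDR : (D.card : ℝ) ≤ 16 * k := by exact_mod_cast hD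
    have hg0 : 0 ≤ volume.real (cov (c i) \ U n) := measureReal_nonneg
    rw [hgain]
    nlinarith
  have hM : (0 : ℝ) < 16 * k := by positivity
  have hr0 : (0 : ℝ) ≤ 1 - 1 / 16 / k := by
    have : (1 : ℝ) ≤ k := by exact_mod_cast hk
    rw [sub_nonneg, div_le_one hkR]
    linarith
  -- The deficit shrinks by the factor `1 - 1/(16k)` in every round.
  have hind : ∀ n ≤ k, o - a n ≤ (1 - 1 / 16 / (k : ℝ)) ^ n * o := by
    intro n
    induction n with
    | zero =>
      intro _
      have : 0 ≤ a 0 := measureReal_nonneg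
      rw [pow_zero, one_mul]
      linarith
    | succ n ih =>
      intro hn
      have h1 := ih (by omega)
      have h2 := hstep n (by omega)
      have h3 : (o - a n) / (16 * k) ≤ a (n + 1) - a n := by
        rw [div_le_iff₀ hM]
        linarith
      have h4 : (o - a n) / (16 * k) = 1 / 16 / k * (o - a n) := by
        field_simp
      calc o - a (n + 1) ≤ (1 - 1 / 16 / k) * (o - a n) := by rw [h4] at h3; linarith
        _ ≤ (1 - 1 / 16 / k) * ((1 - 1 / 16 / (k : ℝ)) ^ n * o) :=
          mul_le_mul_of_nonneg_left h1 hr0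
        _ = _ := by ring
  have ho0 : 0 ≤ o := measureReal_nonneg
  have hpow : (1 - 1 / 16 / (k : ℝ)) ^ k ≤ Real.exp (-(1 / 16)) :=
    Real.one_sub_div_pow_le_exp_neg (by
      have : (1 : ℝ) ≤ k := by exact_mod_cast hk
      linarith)
  have hfinal : (Real.exp 1 - 1) / (16 * Real.exp 1) * o ≤ a k := by
    have h1 := hind k le_rfl
    have h2 := mul_le_mul_of_nonneg_right (hpow.trans exp_neg_one_sixteenth_le) ho0
    linarith
  have hUk : U k = ⋃ i, cov (c i) := by
    simp [U]
  rw [← hUk, ← ENNReal.ofReal_toReal (hfinite O hO),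
    ← ENNReal.ofReal_toReal (hfinite (U k) (hUI k)), ← ENNReal.ofReal_mul]
  · exact ENNReal.ofReal_le_ofReal hfinal
  · have : 1 ≤ Real.exp 1 := Real.one_le_exp zero_le_one
    exact div_nonneg (by linarith) (by positivity)

end SubtrajectoryCoverage

/-! ### The approximation guarantee -/

open SubtrajectoryCoverage
theorem mainTheorem6 {d : ℕ} (P S : PolygonalCurve d) (Δ ε : ℝ) (hΔ : 0 < Δ) (hε : 0 < ε)
    (l k : ℕ) (hl : 2 ≤ l) (hS : IsSimplification P S Δ l)
    (A : Fin S.numEdges → Set (ℝ × ℝ))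
    (hA : ∀ e, IsApproxFreeSpace P (S.edge e) (1 + ε / 4) (4 * Δ) (A e))
    (hlin : ∀ e, IsPiecewiseLinear P (A e))
    (c : Fin k → Candidate S)
    (hc : IsGreedyRun (IsCandidate l (fun e => heights P (A e)))
      (proxyCoverage P (4 * Δ) A) c) :
    (∀ i, (c i).curve ∈ curveSpace d l) ∧
    ∀ C : Finset (Curve d), (C : Set (Curve d)) ⊆ curveSpace d l → C.card = k →
      ENNReal.ofReal ((Real.exp 1 - 1) / (16 * Real.exp 1)) *
          volume (coverage P.toCurve (C : Set (Curve d)) Δ) ≤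
        volume (coverage P.toCurve (Set.range fun i => (c i).curve) ((4 + ε) * Δ)) := by
  classical
  refine ⟨fun i => curve_mem_curveSpace hl (hc i).1, fun C hC hCk => ?_⟩
  have hsound : ∀ i, proxyCoverage P (4 * Δ) A (c i) ⊆
      coverage P.toCurve {(c i).curve} ((4 + ε) * Δ) := fun i => by
    have := proxyCoverage_subset_coverage (α := 1 + ε / 4) (by linarith) (by positivity) hA (hc i).1
    rwa [show (1 + ε / 4) * (4 * Δ) = (4 + ε) * Δ by ring] at this
  choose! D hD hadm N hN hcov using fun q (hq : q ∈ curveSpace d l) =>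
    exists_candidates_cover hΔ.le hS hA hlin hq
  have hbound := greedy_bound hc (fun i => measurableSet_proxyCoverage (by positivity) (c i))
    (fun i => (hsound i).trans (coverage_subset_Icc _ _ _))
    (coverage_subset_Icc P.toCurve (C : Set (Curve d)) Δ) (D := C.biUnion D) (N := ⋃ q ∈ C, N q)
    (by
      -- Ten candidates for each of the `k` curves, well within the budget of `16k`.
      refine (Finset.card_biUnion_le_card_mul C D 10 fun q hq => hD q (hC hq)).trans ?_
      omega)
    (fun a ha => by
      obtain ⟨q, hq, hqa⟩ := Finset.mem_biUnion.1 ha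
      exact hadm q (hC hq) a hqa)
    ((C.finite_toSet.biUnion fun q hq => hN q (hC hq)).measure_zero _)
    (by
      rintro x ⟨q, hq, h⟩
      rcases hcov q (hC hq) ⟨q, rfl, h⟩ with h | h
      · exact Or.inl (mem_iUnion₂.2 ⟨q, hq, h⟩)
      · obtain ⟨a, ha, hxa⟩ := mem_iUnion₂.1 h
        exact Or.inr (mem_iUnion₂.2 ⟨a, Finset.mem_biUnion.2 ⟨q, hq, ha⟩, hxa⟩))
  refine hbound.trans (measure_mono (iUnion_subset fun i => (hsound i).trans ?_))
  exact coverage_mono _ (by simp) le_rfl
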